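/- Let $X$ be a connected CW-complex with finite $1$-skeleton, let $x_0\in X$, $G=\pi_1(X,x_0)$, and let $\varkappa(X)=\sup\{k\mid X^{(k)}\text{ is finite}\}\in\{1,2,\dots,\infty\}$. Let $\Bbbk$ be a field and let $\nu\colon G\twoheadrightarrow H$ be an epimorphism onto an abelian group. Let $\widetilde X\to X$ be the universal cover, with $G$ acting by deck transformations, and let $X^\nu\to X$ be the Galois cover corresponding to $\nu$, with group of deck transformations $H$. For a character $\rho\in\operatorname{Hom}(G,\Bbbk^\times)$ let $H_i(X,\Bbbk_\rho)$ be the homology of $\Bbbk_\rho\otimes_{\mathbb Z G}C_\bullet(\widetilde X,\mathbb Z)$, where $g\in G$ acts on $\Bbbk_\rho=\Bbbk$ as multiplication by $\rho(g)$. For $i\le\varkappa(X)$ and $d>0$ put $$\mathcal V^i_d(X,\Bbbk)=\{\rho\in\operatorname{Hom}(G,\Bbbk^\times)\mid \dim_{\Bbbk}H_i(X,\Bbbk_\rho)\ge d\}, \qquad \mathcal W^i_d(X,\nu,\Bbbk)=\nu^*\bigl(V(E_{d-1}(H_i(X^\nu,\Bbbk)))\bigr).$$ Here $H_i(X^\nu,\Bbbk)$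 is viewed as a module over the group ring $\Bbbk H$; $E_j(M)$ is the $j$-th elementary ideal of a finitely presented module $M$, generated by the minors of size $n-j$ of an $n\times m$ presentation matrix of $M$ (with $E_j(M)$ the whole ring if $j\ge n$, and $0$ if $n-j>m$); $V(I)\subseteq\operatorname{Hom}(H,\Bbbk^\times)$ is the set of characters whose linear extension $\Bbbk H\to\Bbbk$ vanishes on the ideal $I$; and $\nu^*\colon\operatorname{Hom}(H,\Bbbk^\times)\to\operatorname{Hom}(G,\Bbbk^\times)$ is $\rho\mapsto\rho\circ\nu$. Then, for every $k\in\{0,1,2,\dots,\infty\}$ with $k\le\varkappa(X)$, $$\bigcup_{0\le i\le k}\mathcal W^i_1(X,\nu,\Bbbk)=\operatorname{im}(\nu^*)\cap\bigcup_{0\le i\le k}\mathcal V^i_1(X,\Bbbk),$$ where $i$ ranges over non-negative integers. -/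

import Mathlib

open CategoryTheory

noncomputable section

namespace JumpLoci

universe t u v w

/-! ### Finiteness length of a CW complex -/

/-- The finiteness length of a CW complex `X`: the supremum of all `k` such that the `k`-skeleton
of `X` is finite, i.e. such that `X` has finitely many `j`-cells for each `j ≤ k`. -/
def finitenessLength (X : Type u) [TopologicalSpace X]
    [Topology.CWComplex (Set.univ : Set X)] : ℕ∞ :=
  ⨆ (k : ℕ) (_ : ∀ j ≤ k, Finite (Topology.CWComplex.cell (Set.univ : Set X) j)), (k : ℕ∞)

/-! ### Galois covers -/

/-- Let `θ : π₁(X, x₀) → D` be a map to a group `D` that acts on `E`. The map `p : E → X` with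
`p e₀ = x₀` is the connected Galois cover of `X` with group of deck transformations `D`
corresponding to `θ`: it is a covering map which is the quotient by a free, properly
discontinuous action of `D` (the deck transformations), the total space is path connected, and the
loops at `x₀` that lift to a path from `e₀` to `d • e₀` are sent by `θ` to `d`. -/
structure IsGaloisCover {X : Type u} [TopologicalSpace X] {E : Type v} [TopologicalSpace E]
    {D : Type w} [Group D] [MulAction D E] (p : E → X) (x₀ : X) (e₀ : E)
    (θ : FundamentalGroup X x₀ → D) : Prop where
  isQuotientCoveringMap : IsQuotientCoveringMap p D
  pathConnectedSpace : PathConnectedSpace E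
  map_basepoint : p e₀ = x₀
  monodromy : ∀ (d : D) (Γ : Path e₀ (d • e₀)) (γ : Path x₀ x₀), (∀ t, p (Γ t) = γ t) →
    θ (FundamentalGroup.fromPath (Path.Homotopic.Quotient.mk γ)) = d

/-- `p : E → X` is the universal cover of `X`, on which the fundamental group acts by deck
transformations through the lift `e₀` of `x₀`: a class `g` moves `e₀` to the endpoint of the lift
at `e₀` of any loop representing `g`.
(In Mathlib the product `g * h` in `FundamentalGroup X x₀` is represented by a loop running first
through `h` and then through `g`. The left action by deck transformations is therefore an action
of the opposite group, in which `op g * op h` runs first through `g` and then through `h`.) -/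
structure IsUniversalCover {X : Type u} [TopologicalSpace X] {E : Type v} [TopologicalSpace E]
    (p : E → X) (x₀ : X) (e₀ : E) [MulAction (FundamentalGroup X x₀)ᵐᵒᵖ E] : Prop where
  isGaloisCover : IsGaloisCover p x₀ e₀ (MulOpposite.op : _ → (FundamentalGroup X x₀)ᵐᵒᵖ)
  simplyConnectedSpace : SimplyConnectedSpace E

/-! ### Singular chains of a space with a group action -/

/-- The singular simplices of `E`. -/
abbrev Simplex (E : Type v) [TopologicalSpace E] (n : SimplexCategory) : Type v :=
  C(stdSimplex ℝ (Fin (n.len + 1)), E)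

/-- Precomposition of a singular simplex with the affine map given by `f` on the vertices. -/
def Simplex.pull {E : Type v} [TopologicalSpace E] {m n : SimplexCategory} (f : m ⟶ n)
    (σ : Simplex E n) : Simplex E m :=
  σ.comp ⟨stdSimplex.map f, stdSimplex.continuous_map f⟩

theorem Simplex.pull_id {E : Type v} [TopologicalSpace E] {n : SimplexCategory}
    (σ : Simplex E n) : Simplex.pull (𝟙 n) σ = σ := by
  ext x
  simp [Simplex.pull]

theorem Simplex.pull_comp {E : Type v} [TopologicalSpace E] {l m n : SimplexCategory}
    (f : l ⟶ m) (g : m ⟶ n) (σ : Simplex E n) :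
    Simplex.pull (f ≫ g) σ = Simplex.pull f (Simplex.pull g σ) := by
  ext x
  simp only [Simplex.pull, ContinuousMap.comp_apply, ContinuousMap.coe_mk,
    stdSimplex.map_comp_apply]
  rfl

theorem Simplex.pull_smul {E : Type v} [TopologicalSpace E] {D : Type w} [Group D] [MulAction D E]
    [ContinuousConstSMul D E] {m n : SimplexCategory} (f : m ⟶ n) (d : D) (σ : Simplex E n) :
    Simplex.pull f (d • σ) = d • Simplex.pull f σ := rfl

/-- Singular chains of `E` with coefficients in `k`. -/
abbrev Chains (k : Type w) [Field k] (E : Type v) [TopologicalSpace E] (n : SimplexCategory) :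
    Type (max v w) :=
  Simplex E n →₀ k

/-- The map on singular chains induced by `Simplex.pull f`. -/
def Chains.pull (k : Type w) [Field k] (E : Type v) [TopologicalSpace E] {m n : SimplexCategory}
    (f : m ⟶ n) : Chains k E n →ₗ[k] Chains k E m :=
  Finsupp.lmapDomain k k (Simplex.pull f)

theorem Chains.pull_id (k : Type w) [Field k] (E : Type v) [TopologicalSpace E]
    (n : SimplexCategory) (c : Chains k E n) : Chains.pull k E (𝟙 n) c = c := by
  have h : (Simplex.pull (E := E) (𝟙 n)) = id := funext Simplex.pull_id
  simp [Chains.pull, h]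

theorem Chains.pull_comp (k : Type w) [Field k] (E : Type v) [TopologicalSpace E]
    {l m n : SimplexCategory} (f : l ⟶ m) (g : m ⟶ n) (c : Chains k E n) :
    Chains.pull k E (f ≫ g) c = Chains.pull k E f (Chains.pull k E g c) := by
  have h : (Simplex.pull (E := E) (f ≫ g)) = Simplex.pull f ∘ Simplex.pull g :=
    funext (Simplex.pull_comp f g)
  simp only [Chains.pull, h, Finsupp.lmapDomain_apply, Finsupp.mapDomain_comp]

/-- The action of a group `D` acting on `E` on the singular chains of `E`. -/
def chainRep (k : Type w) [Field k] (D : Type u) (E : Type v) [TopologicalSpace E] [Group D]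
    [MulAction D E] [ContinuousConstSMul D E] (n : SimplexCategory) :
    Representation k D (Chains k E n) where
  toFun d := Finsupp.lmapDomain k k (d • ·)
  map_one' := by ext; simp
  map_mul' a b := by ext; simp [mul_smul]

theorem chainRep_pull (k : Type w) [Field k] {D : Type u} {E : Type v} [TopologicalSpace E]
    [Group D] [MulAction D E] [ContinuousConstSMul D E] {m n : SimplexCategory} (f : m ⟶ n)
    (d : D) (c : Chains k E n) :
    Chains.pull k E f (chainRep k D E n d c) = chainRep k D E m d (Chains.pull k E f c) := by
  simp only [Chains.pull, chainRep, MonoidHom.coe_mk, OneHom.coe_mk, Finsupp.lmapDomain_apply,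
    ← Finsupp.mapDomain_comp]
  rfl

/-! ### The homology of a space as a module over the group ring of a group acting on it -/

/-- The `k[D]`-linear map on singular chains induced by `Simplex.pull f`. -/
def equivariantPull (k : Type w) [Field k] (D : Type u) (E : Type v) [TopologicalSpace E] [Group D]
    [MulAction D E] [ContinuousConstSMul D E] {m n : SimplexCategory} (f : m ⟶ n) :
    (chainRep k D E n).asModule →ₗ[MonoidAlgebra k D] (chainRep k D E m).asModule :=
  Representation.IntertwiningMap.equivLinearMapAsModule _ _
    ((Chains.pull k E f).intertwiningMap_of_isIntertwiningMap (chainRep k D E n)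
      (chainRep k D E m) (chainRep_pull k f))

/-- The simplicial `k[D]`-module of singular chains of `E`. -/
def equivariantChains (k : Type w) [Field k] (D : Type u) (E : Type v) [TopologicalSpace E]
    [Group D] [MulAction D E] [ContinuousConstSMul D E] :
    SimplicialObject (ModuleCat.{max v w} (MonoidAlgebra k D)) where
  obj n := ModuleCat.of (MonoidAlgebra k D) (chainRep k D E n.unop).asModule
  map f := ModuleCat.ofHom (equivariantPull k D E f.unop)
  map_id n := by
    ext c
    exact Chains.pull_id k E n.unop c
  map_comp f g := by
    ext c
    exact Chains.pull_comp k E g.unop f.unop c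

/-- The singular homology `H_i(E; k)`, as a module over the group ring `k[D]` of a group `D`
acting on `E`. -/
abbrev EquivariantHomology (k : Type w) [Field k] (D : Type u) (E : Type v) [TopologicalSpace E]
    [Group D] [MulAction D E] [ContinuousConstSMul D E] (i : ℕ) :
    ModuleCat.{max v w} (MonoidAlgebra k D) :=
  ((AlgebraicTopology.alternatingFaceMapComplex _).obj (equivariantChains k D E)).homology i

/-! ### Homology with coefficients in a rank one local system -/

/-- The relations `a ⊗ (d • σ) = (a * χ d) ⊗ σ` that define `k_χ ⊗_{ℤ[D]} C_n(E; ℤ)` as a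
quotient of `k ⊗_ℤ C_n(E; ℤ)`, the singular chains of `E` with coefficients in `k`. -/
def twistRel (k : Type w) [Field k] {D : Type u} (E : Type v) [TopologicalSpace E]
    [Group D] [MulAction D E] [ContinuousConstSMul D E] (χ : D → kˣ) (n : SimplexCategory) :
    Submodule k (Chains k E n) :=
  Submodule.span k {c | ∃ (d : D) (σ : Simplex E n) (a : k),
    c = Finsupp.single (d • σ) a - Finsupp.single σ (a * (χ d : k))}

theorem twistRel_le_comap (k : Type w) [Field k] {D : Type u} (E : Type v) [TopologicalSpace E]
    [Group D] [MulAction D E] [ContinuousConstSMul D E] (χ : D → kˣ) {m n : SimplexCategory}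
    (f : m ⟶ n) : twistRel k E χ n ≤ (twistRel k E χ m).comap (Chains.pull k E f) := by
  refine Submodule.span_le.2 ?_
  rintro _ ⟨d, σ, a, rfl⟩
  refine Submodule.subset_span ⟨d, Simplex.pull f σ, a, ?_⟩
  rw [map_sub]
  simp only [Chains.pull, Finsupp.lmapDomain_apply, Finsupp.mapDomain_single, Simplex.pull_smul]

/-- The simplicial `k`-vector space `k_χ ⊗_{ℤ[D]} C_•(E; ℤ)`. -/
def twistedChains (k : Type w) [Field k] {D : Type u} (E : Type v) [TopologicalSpace E]
    [Group D] [MulAction D E] [ContinuousConstSMul D E] (χ : D → kˣ) :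
    SimplicialObject (ModuleCat.{max v w} k) where
  obj n := ModuleCat.of k (Chains k E n.unop ⧸ twistRel k E χ n.unop)
  map f := ModuleCat.ofHom
    (Submodule.mapQ _ _ (Chains.pull k E f.unop) (twistRel_le_comap k E χ f.unop))
  map_id n := by
    refine ModuleCat.hom_ext (LinearMap.ext fun c => ?_)
    obtain ⟨c, rfl⟩ := Submodule.Quotient.mk_surjective _ c
    exact congrArg Submodule.Quotient.mk (Chains.pull_id k E n.unop c)
  map_comp f g := by
    refine ModuleCat.hom_ext (LinearMap.ext fun c => ?_)
    obtain ⟨c, rfl⟩ := Submodule.Quotient.mk_surjective _ c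
    exact congrArg Submodule.Quotient.mk (Chains.pull_comp k E g.unop f.unop c)

/-- The homology of the chain complex `k_χ ⊗_{ℤ[D]} C_•(E; ℤ)`. -/
abbrev TwistedHomology (k : Type w) [Field k] {D : Type u} (E : Type v) [TopologicalSpace E]
    [Group D] [MulAction D E] [ContinuousConstSMul D E] (χ : D → kˣ) (i : ℕ) :
    ModuleCat.{max v w} k :=
  ((AlgebraicTopology.alternatingFaceMapComplex _).obj (twistedChains k E χ)).homology i

/-! ### Characteristic varieties -/

/-- The characteristic variety `V^i_d(X, k)` of a space `X` with universal cover `E`: the set of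
characters `ρ : π₁(X, x₀) → kˣ` with `dim_k H_i(X; k_ρ) ≥ d`, where
`H_i(X; k_ρ) = H_i(k_ρ ⊗ C_•(E; ℤ))`, the tensor product being taken over the integral group ring
of the fundamental group. -/
def characteristicVariety {X : Type u} [TopologicalSpace X] (x₀ : X) (k : Type w) [Field k]
    (E : Type v) [TopologicalSpace E] [MulAction (FundamentalGroup X x₀)ᵐᵒᵖ E]
    [ContinuousConstSMul (FundamentalGroup X x₀)ᵐᵒᵖ E] (i d : ℕ) :
    Set (FundamentalGroup X x₀ →* kˣ) :=
  {ρ | (d : Cardinal) ≤ Module.rank k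
    (TwistedHomology k E (fun g : (FundamentalGroup X x₀)ᵐᵒᵖ => ρ g.unop) i)}

/-! ### Alexander varieties -/

/-- The matrix `A` presents the module `M`: there is an exact sequence `R^m → R^n → M → 0` whose
first map is multiplication by `A`. -/
def IsPresentation {R : Type u} [CommRing R] (M : Type v) [AddCommGroup M] [Module R M] {n m : ℕ}
    (A : Matrix (Fin n) (Fin m) R) : Prop :=
  ∃ π : (Fin n → R) →ₗ[R] M, Function.Surjective π ∧ LinearMap.ker π = LinearMap.range A.mulVecLin

/-- The `j`-th elementary ideal of a finitely presented module `M`: the ideal generated by the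
minors of size `n - j` of an `n × m` matrix presenting `M`. It does not depend on the presentation,
so the minors of all presentations may be used. If `j ≥ n` these are the minors of size `0`, which
are `1`. If `n - j > m`, then all the minors, which have a repeated column, vanish. -/
def elementaryIdeal (R : Type u) [CommRing R] (M : Type v) [AddCommGroup M] [Module R M] (j : ℕ) :
    Ideal R :=
  Ideal.span {a | ∃ (n m : ℕ) (A : Matrix (Fin n) (Fin m) R) (r : Fin (n - j) → Fin n)
    (c : Fin (n - j) → Fin m), IsPresentation M A ∧ a = (A.submatrix r c).det}

/-- The zero locus in the character group `Hom(H, kˣ)` of an ideal of the group ring `k[H]`. -/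
def zeroLocus {k : Type w} [Field k] {H : Type u} [CommGroup H]
    (I : Ideal (MonoidAlgebra k H)) : Set (H →* kˣ) :=
  {ρ | ∀ f ∈ I, MonoidAlgebra.lift k k H ((Units.coeHom k).comp ρ) f = 0}

/-- The map `ν^* : Hom(H, kˣ) → Hom(G, kˣ)` given by composition with `ν : G → H`. -/
def pullback {G : Type u} {H : Type v} [Group G] [Group H] (ν : G →* H) (k : Type w) [Field k]
    (ρ : H →* kˣ) : G →* kˣ :=
  ρ.comp ν

/-- The Alexander variety `W^i_d(X, ν, k) = ν^*(V(E_{d-1}(H_i(X^ν; k))))`, for `d > 0`, where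
`ν : π₁(X, x₀) → H` is a homomorphism to an abelian group, and `E = X^ν` is the corresponding Galois
cover with its action of `H` by deck transformations. -/
def alexanderVariety {G : Type t} [Group G] {H : Type u} [CommGroup H] (ν : G →* H) (k : Type w)
    [Field k] (E : Type v) [TopologicalSpace E] [MulAction H E] [ContinuousConstSMul H E]
    (i d : ℕ) : Set (G →* kˣ) :=
  pullback ν k '' zeroLocus (elementaryIdeal (MonoidAlgebra k H) (EquivariantHomology k H E i)
    (d - 1))

end JumpLoci

end

/-! Write R = k[H], let C be the singular chain complex of X^ν with coefficients in k, and for a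
character ρ of H let I be the kernel of the induced map R → k. Two translations turn the theorem
into algebra over R. First, for a finitely presented module M, ρ lies in V(E_0(M)) exactly when IM ≠
M (`elementaryIdeal_zero_le_ker_iff`): Cramer's rule gives one direction and Nakayama's lemma the
other. Secondly, the singular simplices of X^ν are the orbits of the simplices of the universal
cover under the kernel of ν, so the homology of X twisted by ρ ∘ ν is the homology of C/IC
(`IsUniversalCover.twistExact_iff`, `mem_ker_smul_top_iff`).

It remains to show that H_n(C) = I H_n(C) for all n ≤ N if and only if H_n(C/IC) = 0 for all n ≤ N
(`forall_homologyEqSMul_iff`). Degree by degree this is false: for the circle, its universal cover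
and the trivial character, it fails in degree 1. This is why the theorem compares unions. The
modules C_n are projective and H_n(C) is finitely generated for n ≤ N. If H_n(C) = I H_n(C),
Nakayama gives e ≡ 1 mod I that annihilates H_n(C), and after inverting e the complex would split in
low degrees. Instead of localizing, the proof carries along an endomorphism of C_n that takes values
in the cycles and is multiplication by some e ≡ 1 on the cycles (`IsCycleRetraction`). Projectivity
produces the one in degree n + 1 from the one in degree n, and it suffices for both implications.

The remaining input is topological: H is finitely generated, so that R is Noetherian, and H_n(X^ν,
k) is finitely generated when the n-skeleton of X is finite. Both are proved with singular chains.
Barycentric subdivision gives Mayer–Vietoris arguments for chains in subsets of a cover. Over an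
open cell and over the cell without its center these compute enough homology to show that attaching
an N-cell induces a surjection on H_n for n < N and an injection for n + 1 < N
(`IsCellAttachment.homologySurj`, `IsCellAttachment.homologyInj`), and preserves finite generation.
Since chains have compact support, the preimage of a finite n-skeleton surjects on H_n
(`homologyFG_univ`). For the group, finitely many edges generate over R the relations between
vertices in H_0 of the preimage of the 1-skeleton. Connectedness of X^ν then forces the deck
transformations read off from the ends of these edges to generate H
(`group_fg_of_finite_one_skeleton`). -/

noncomputable section
namespace JumpLoci

/-! ### Chains on ordered tuples of points -/

/-- The chains on `n`-tuples of points of `K`. -/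
abbrev OrdChains (k : Type*) [CommRing k] (n : ℕ) (K : Type*) := (Fin n → K) →₀ k

section OrdChains

variable (k : Type*) [CommRing k] {K K' : Type*}

/-- The boundary map, given by the alternating sum of the faces. In degree `0` it is the
augmentation. -/
def ordBoundary (K : Type*) (n : ℕ) : OrdChains k (n + 1) K →ₗ[k] OrdChains k n K :=
  ∑ i : Fin (n + 1), (-1 : ℤ) ^ (i : ℕ) • Finsupp.lmapDomain k k (fun v => v ∘ i.succAbove)

theorem ordBoundary_single (n : ℕ) (v : Fin (n + 1) → K) (a : k) :
    ordBoundary k K n (Finsupp.single v a) =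
      ∑ i : Fin (n + 1), (-1 : ℤ) ^ (i : ℕ) • Finsupp.single (v ∘ i.succAbove) a := by
  simp [ordBoundary, LinearMap.sum_apply, Finsupp.mapDomain_single]

/-- The cone with apex `b`. -/
def ordCone (b : K) (n : ℕ) : OrdChains k n K →ₗ[k] OrdChains k (n + 1) K :=
  Finsupp.lmapDomain k k (Fin.cons (α := fun _ => K) b)

theorem ordCone_single (b : K) (n : ℕ) (v : Fin n → K) (a : k) :
    ordCone k b n (Finsupp.single v a) = Finsupp.single (Fin.cons (α := fun _ => K) b v) a := by
  simp [ordCone]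

/-- The zeroth face of a cone deletes the apex; the other faces are cones over faces, with the sign
shifted by one. So the cone is a contracting homotopy of the augmented complex, and a cycle is the
boundary of its cone. -/
theorem ordBoundary_ordCone (b : K) (n : ℕ) (c : OrdChains k (n + 1) K) :
    ordBoundary k K (n + 1) (ordCone k b (n + 1) c) = c - ordCone k b n (ordBoundary k K n c) := by
  induction c using Finsupp.induction_linear with
  | zero => simp
  | add f g hf hg => simp only [map_add, hf, hg]; abel
  | single v a =>
    rw [ordCone_single, ordBoundary_single, ordBoundary_single, Fin.sum_univ_succ, map_sum,
      sub_eq_add_neg, ← Finset.sum_neg_distrib]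
    congr 1
    · simp only [Fin.val_zero, pow_zero, one_smul]
      congr 1
    · refine Finset.sum_congr rfl fun i _ => ?_
      rw [map_zsmul, ordCone_single, Fin.val_succ, pow_succ, mul_neg_one, neg_smul]
      congr 3
      funext j
      refine Fin.cases ?_ (fun j => ?_) j <;> simp [Function.comp]

theorem ordBoundary_ordCone_zero (b : K) (c : OrdChains k 0 K) :
    ordBoundary k K 0 (ordCone k b 0 c) = c := by
  induction c using Finsupp.induction_linear with
  | zero => simp
  | add f g hf hg => simp only [map_add, hf, hg]
  | single v a =>
    rw [ordCone_single, ordBoundary_single]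
    simp [Subsingleton.elim _ v]

/-- No pairing of faces is needed: every tuple is the cone from its first entry over its tail, and
the cone formula reduces the claim to one degree less. -/
theorem ordBoundary_ordBoundary (n : ℕ) (c : OrdChains k (n + 2) K) :
    ordBoundary k K n (ordBoundary k K (n + 1) c) = 0 := by
  induction n with
  | zero =>
    induction c using Finsupp.induction_linear with
    | zero => simp
    | add f g hf hg => simp only [map_add, hf, hg, add_zero]
    | single v a =>
      rw [← Fin.cons_self_tail v, ← ordCone_single, ordBoundary_ordCone, map_sub,
        ordBoundary_ordCone_zero, sub_self]
  | succ n ih =>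
    induction c using Finsupp.induction_linear with
    | zero => simp
    | add f g hf hg => simp only [map_add, hf, hg, add_zero]
    | single v a =>
      rw [← Fin.cons_self_tail v, ← ordCone_single, ordBoundary_ordCone, map_sub,
        ordBoundary_ordCone, ih]
      simp

/-- The map on chains induced by a map of points. -/
def ordMap (f : K → K') (n : ℕ) : OrdChains k n K →ₗ[k] OrdChains k n K' :=
  Finsupp.lmapDomain k k (f ∘ ·)

theorem ordMap_single (f : K → K') (n : ℕ) (v : Fin n → K) (a : k) :
    ordMap k f n (Finsupp.single v a) = Finsupp.single (f ∘ v) a := by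
  simp [ordMap]

theorem ordMap_ordCone (f : K → K') (b : K) (n : ℕ) (c : OrdChains k n K) :
    ordMap k f (n + 1) (ordCone k b n c) = ordCone k (f b) n (ordMap k f n c) := by
  induction c using Finsupp.induction_linear with
  | zero => simp
  | add f g hf hg => simp only [map_add, hf, hg]
  | single v a =>
    simp only [ordCone_single, ordMap_single]
    congr 1
    funext j
    refine Fin.cases ?_ (fun j => ?_) j <;> simp

theorem ordBoundary_ordMap (f : K → K') (n : ℕ) (c : OrdChains k (n + 1) K) :
    ordBoundary k K' n (ordMap k f (n + 1) c) = ordMap k f n (ordBoundary k K n c) := by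
  induction c using Finsupp.induction_linear with
  | zero => simp
  | add f g hf hg => simp only [map_add, hf, hg]
  | single v a =>
    simp only [ordMap_single, ordBoundary_single, map_sum, map_zsmul]
    rfl

/-- The linear map on chains with prescribed values on tuples. -/
def ordLift {n : ℕ} {N : Type*} [AddCommGroup N] [Module k N] (f : (Fin n → K) → N) :
    OrdChains k n K →ₗ[k] N :=
  Finsupp.lsum k fun v => LinearMap.toSpanSingleton k N (f v)

theorem ordLift_single {n : ℕ} {N : Type*} [AddCommGroup N] [Module k N] (f : (Fin n → K) → N)
    (v : Fin n → K) (a : k) : ordLift k f (Finsupp.single v a) = a • f v := by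
  simp [ordLift]

/-- The homotopy between two chain maps that is built inductively by cones with apices `b`. -/
def ordHomotopy (φ ψ : ∀ n, OrdChains k n K →ₗ[k] OrdChains k n K')
    (b : ∀ n, (Fin (n + 1) → K) → K') : ∀ n, OrdChains k n K →ₗ[k] OrdChains k (n + 1) K'
  | 0 => 0
  | n + 1 => ordLift k fun v => ordCone k (b n v) (n + 1)
      (ψ (n + 1) (Finsupp.single v 1) - φ (n + 1) (Finsupp.single v 1) -
        ordHomotopy φ ψ b n (ordBoundary k K n (Finsupp.single v 1)))

theorem ordHomotopy_single (φ ψ : ∀ n, OrdChains k n K →ₗ[k] OrdChains k n K')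
    (b : ∀ n, (Fin (n + 1) → K) → K') (n : ℕ) (v : Fin (n + 1) → K) (a : k) :
    ordHomotopy k φ ψ b (n + 1) (Finsupp.single v a) = ordCone k (b n v) (n + 1)
      (ψ (n + 1) (Finsupp.single v a) - φ (n + 1) (Finsupp.single v a) -
        ordHomotopy k φ ψ b n (ordBoundary k K n (Finsupp.single v a))) := by
  rw [ordHomotopy, ordLift_single, ← map_smul, smul_sub, smul_sub, ← map_smul, ← map_smul,
    ← map_smul, ← map_smul, Finsupp.smul_single, smul_eq_mul, mul_one]

/-- The method of acyclic models with explicit fillings. The chain that is coned off is a cycle by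
the homotopy formula one degree lower, so the boundary of its cone is the chain itself. -/
theorem ordBoundary_ordHomotopy (φ ψ : ∀ n, OrdChains k n K →ₗ[k] OrdChains k n K')
    (b : ∀ n, (Fin (n + 1) → K) → K')
    (hφ : ∀ n c, ordBoundary k K' n (φ (n + 1) c) = φ n (ordBoundary k K n c))
    (hψ : ∀ n c, ordBoundary k K' n (ψ (n + 1) c) = ψ n (ordBoundary k K n c))
    (h₀ : φ 0 = ψ 0) (n : ℕ) (c : OrdChains k (n + 1) K) :
    ordBoundary k K' (n + 1) (ordHomotopy k φ ψ b (n + 1) c) =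
      ψ (n + 1) c - φ (n + 1) c - ordHomotopy k φ ψ b n (ordBoundary k K n c) := by
  induction c using Finsupp.induction_linear with
  | zero => simp
  | add f g hf hg => simp only [map_add, hf, hg]; abel
  | single v a =>
    rw [ordHomotopy_single, ordBoundary_ordCone, sub_eq_self]
    convert map_zero (ordCone k (b n v) n)
    rw [map_sub, map_sub, hφ, hψ]
    cases n with
    | zero => simp [ordHomotopy, h₀]
    | succ n =>
      rw [ordBoundary_ordHomotopy φ ψ b hφ hψ h₀ n, ordBoundary_ordBoundary, map_zero, sub_zero,
        sub_self]

/-- Naturality needs only that the apices correspond under the maps of points. It is applied to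
faces of simplices and prisms, to pass from models to singular chains. -/
theorem ordMap_ordHomotopy {L L' : Type*} (φ ψ : ∀ n, OrdChains k n K →ₗ[k] OrdChains k n K')
    (b : ∀ n, (Fin (n + 1) → K) → K') (φ' ψ' : ∀ n, OrdChains k n L →ₗ[k] OrdChains k n L')
    (b' : ∀ n, (Fin (n + 1) → L) → L') (f : K → L) (g : K' → L')
    (hφ : ∀ n c, ordMap k g n (φ n c) = φ' n (ordMap k f n c))
    (hψ : ∀ n c, ordMap k g n (ψ n c) = ψ' n (ordMap k f n c))
    (hb : ∀ n v, g (b n v) = b' n (f ∘ v)) (n : ℕ) (c : OrdChains k n K) :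
    ordMap k g (n + 1) (ordHomotopy k φ ψ b n c) = ordHomotopy k φ' ψ' b' n (ordMap k f n c) := by
  induction n with
  | zero => simp [ordHomotopy]
  | succ n ih =>
    induction c using Finsupp.induction_linear with
    | zero => simp
    | add f g hf hg => simp only [map_add, hf, hg]
    | single v a =>
      rw [ordHomotopy_single, ordMap_ordCone, map_sub (ordMap k g (n + 1)), map_sub (ordMap k g (n + 1)), hφ, hψ, ih, ordMap_single,
        ordHomotopy_single, hb, ← ordBoundary_ordMap, ordMap_single]

/-- The subdivision in which a tuple `v` is replaced by cones with apex `b v`. -/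
def ordSubdivision (b : ∀ n, (Fin (n + 1) → K) → K) : ∀ n, OrdChains k n K →ₗ[k] OrdChains k n K
  | 0 => LinearMap.id
  | n + 1 => ordLift k fun v => ordCone k (b n v) n
      (ordSubdivision b n (ordBoundary k K n (Finsupp.single v 1)))

theorem ordSubdivision_single (b : ∀ n, (Fin (n + 1) → K) → K) (n : ℕ) (v : Fin (n + 1) → K)
    (a : k) : ordSubdivision k b (n + 1) (Finsupp.single v a) = ordCone k (b n v) n
      (ordSubdivision k b n (ordBoundary k K n (Finsupp.single v a))) := by
  rw [ordSubdivision, ordLift_single, ← map_smul, ← map_smul, ← map_smul, Finsupp.smul_single,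
    smul_eq_mul, mul_one]

theorem ordBoundary_ordSubdivision (b : ∀ n, (Fin (n + 1) → K) → K) (n : ℕ)
    (c : OrdChains k (n + 1) K) : ordBoundary k K n (ordSubdivision k b (n + 1) c) =
      ordSubdivision k b n (ordBoundary k K n c) := by
  induction c using Finsupp.induction_linear with
  | zero => simp
  | add f g hf hg => simp only [map_add, hf, hg]
  | single v a =>
    rw [ordSubdivision_single]
    cases n with
    | zero => rw [ordBoundary_ordCone_zero]
    | succ n =>
      rw [ordBoundary_ordCone, ordBoundary_ordSubdivision b n, ordBoundary_ordBoundary, map_zero,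
        map_zero, sub_zero]

theorem ordMap_ordSubdivision (b : ∀ n, (Fin (n + 1) → K) → K) (b' : ∀ n, (Fin (n + 1) → K') → K')
    (f : K → K') (hb : ∀ n v, f (b n v) = b' n (f ∘ v)) (n : ℕ) (c : OrdChains k n K) :
    ordMap k f n (ordSubdivision k b n c) = ordSubdivision k b' n (ordMap k f n c) := by
  induction n with
  | zero => simp [ordSubdivision]
  | succ n ih =>
    induction c using Finsupp.induction_linear with
    | zero => simp
    | add f g hf hg => simp only [map_add, hf, hg]
    | single v a =>
      rw [ordSubdivision_single, ordMap_ordCone, ih, ordMap_single, ordSubdivision_single, hb,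
        ← ordBoundary_ordMap, ordMap_single]

end OrdChains

/-! ### Affine simplices -/

section AffineSimplex

variable {V : Type*} [NormedAddCommGroup V] [NormedSpace ℝ V] {s : Set V} (hs : Convex ℝ s)
  {V' : Type*} [NormedAddCommGroup V'] [NormedSpace ℝ V'] {s' : Set V'} (hs' : Convex ℝ s')

/-- The affine simplex with the given vertices in a convex set. -/
def affineSimplex {n : ℕ} (v : Fin (n + 1) → s) : C(stdSimplex ℝ (Fin (n + 1)), s) where
  toFun t := ⟨∑ i, t.1 i • (v i : V),
    hs.sum_mem (fun i _ => t.2.1 i) t.2.2 fun i _ => (v i).2⟩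
  continuous_toFun := by
    refine Continuous.subtype_mk (continuous_finsetSum _ fun i _ => ?_) _
    exact ((continuous_apply i).comp continuous_subtype_val).smul continuous_const

theorem affineSimplex_coe {n : ℕ} (v : Fin (n + 1) → s) (t : stdSimplex ℝ (Fin (n + 1))) :
    (affineSimplex hs v t : V) = ∑ i, t.1 i • (v i : V) := rfl

/-- A point of the source gives each vertex of the target the sum of the weights over its fibre
under `f`. For face maps this is what makes the realization of tuples as singular simplices a chain
map. -/
theorem affineSimplex_comp_map {m n : ℕ} (v : Fin (n + 1) → s) (f : Fin (m + 1) → Fin (n + 1)) :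
    (affineSimplex hs v).comp ⟨stdSimplex.map f, stdSimplex.continuous_map f⟩ =
      affineSimplex hs (v ∘ f) := by
  ext t
  simp only [ContinuousMap.comp_apply, affineSimplex_coe, ContinuousMap.coe_mk, Function.comp]
  have h (j : Fin (n + 1)) : (stdSimplex.map f t).1 j = ∑ i with f i = j, t.1 i :=
    FunOnFinite.linearMap_apply_apply ..
  simp only [h, Finset.sum_smul]
  rw [← Finset.sum_fiberwise Finset.univ f]
  refine Finset.sum_congr rfl fun j _ => Finset.sum_congr rfl fun i hi => ?_
  rw [(Finset.mem_filter.1 hi).2]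

/-- A map of convex sets is affine if it commutes with the formation of affine simplices. -/
def IsAffineMap (f : s → s') : Prop :=
  ∀ (n : ℕ) (v : Fin (n + 1) → s) (t : stdSimplex ℝ (Fin (n + 1))),
    f (affineSimplex hs v t) = affineSimplex hs' (f ∘ v) t

theorem isAffineMap_affineSimplex {n : ℕ} (v : Fin (n + 1) → s) :
    IsAffineMap (convex_stdSimplex ℝ (Fin (n + 1))) hs (affineSimplex hs v) := by
  intro m w t
  ext
  simp only [affineSimplex_coe, Function.comp, Finset.sum_apply, Pi.smul_apply, smul_eq_mul,
    Finset.sum_smul, Finset.smul_sum, mul_smul]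
  rw [Finset.sum_comm]

/-- Consequently every singular simplex is the realization along itself of the tuple of vertices,
and natural operators are determined by their value on that tuple. -/
theorem affineSimplex_vertex (n : ℕ) :
    affineSimplex (convex_stdSimplex ℝ (Fin (n + 1))) stdSimplex.vertex = ContinuousMap.id _ := by
  ext t j
  change (∑ i, t.1 i • (Pi.single i 1 : Fin (n + 1) → ℝ)) j = t.1 j
  simp [Finset.sum_apply, Pi.single_apply]

theorem isAffineMap_map {m n : ℕ} (f : Fin (m + 1) → Fin (n + 1)) :
    IsAffineMap (convex_stdSimplex ℝ (Fin (m + 1))) (convex_stdSimplex ℝ (Fin (n + 1)))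
      (stdSimplex.map f) := by
  have h := affineSimplex_comp_map (convex_stdSimplex ℝ (Fin (n + 1))) stdSimplex.vertex f
  rw [affineSimplex_vertex, ContinuousMap.id_comp] at h
  have h' : (stdSimplex.map f : stdSimplex ℝ (Fin (m + 1)) → stdSimplex ℝ (Fin (n + 1))) =
    affineSimplex (convex_stdSimplex ℝ (Fin (n + 1))) (stdSimplex.vertex ∘ f) :=
      congrArg DFunLike.coe h
  rw [h']
  exact isAffineMap_affineSimplex _ _

theorem affineSimplex_apply_vertex {n : ℕ} (v : Fin (n + 1) → s) (i : Fin (n + 1)) :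
    affineSimplex hs v (stdSimplex.vertex i) = v i := by
  ext
  simp [affineSimplex_coe, Pi.single_apply]

/-- The barycenter of a tuple of points. -/
def tupleBarycenter (n : ℕ) (v : Fin (n + 1) → s) : s :=
  affineSimplex hs v stdSimplex.barycenter

theorem IsAffineMap.map_tupleBarycenter {f : s → s'} (hf : IsAffineMap hs hs' f) (n : ℕ)
    (v : Fin (n + 1) → s) : f (tupleBarycenter hs n v) = tupleBarycenter hs' n (f ∘ v) :=
  hf n v _

theorem dist_affineSimplex_le {n : ℕ} (v : Fin (n + 1) → s) (t : stdSimplex ℝ (Fin (n + 1)))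
    (x : s) (r : ℝ) (h : ∀ i, dist (v i) x ≤ r) : dist (affineSimplex hs v t) x ≤ r := by
  have := (convex_closedBall (x : V) r).sum_mem (t := Finset.univ) (w := t.1)
    (z := fun i => (v i : V)) (fun i _ => t.2.1 i) t.2.2 fun i _ => h i
  exact this

/-- The vector from the barycenter to `v i` is the average of the `n + 1` differences `v i - v j`,
one of which is zero. This gives the factor `n / (n + 1)`. -/
theorem dist_tupleBarycenter_le {n : ℕ} (v : Fin (n + 1) → s) (i : Fin (n + 1)) (D : ℝ)
    (h : ∀ i j, dist (v i) (v j) ≤ D) :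
    dist (v i) (tupleBarycenter hs n v) ≤ n / (n + 1) * D := by
  have hb : (tupleBarycenter hs n v : V) = ∑ j, (1 / (n + 1) : ℝ) • (v j : V) := by
    rw [tupleBarycenter, affineSimplex_coe]
    refine Finset.sum_congr rfl fun j _ => ?_
    congr 1
    simp
  have h1 : (v i : V) - tupleBarycenter hs n v = ∑ j, (1 / (n + 1) : ℝ) • ((v i : V) - v j) := by
    simp only [smul_sub, Finset.sum_sub_distrib, Finset.sum_const, Finset.card_univ,
      Fintype.card_fin, hb]
    congr 1
    rw [← Nat.cast_smul_eq_nsmul ℝ, smul_smul, Nat.cast_add_one, mul_one_div_cancel, one_smul]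
    positivity
  rw [Subtype.dist_eq, dist_eq_norm, h1]
  refine (norm_sum_le _ _).trans ?_
  have h2 (j : Fin (n + 1)) :
      ‖(1 / (n + 1) : ℝ) • ((v i : V) - v j)‖ ≤ if j = i then 0 else 1 / (n + 1) * D := by
    split_ifs with hj
    · simp [hj]
    · rw [norm_smul, Real.norm_of_nonneg (by positivity), ← dist_eq_norm]
      exact mul_le_mul_of_nonneg_left (h i j) (by positivity)
  refine (Finset.sum_le_sum fun j _ => h2 j).trans_eq ?_
  rw [Finset.sum_ite, Finset.sum_const_zero, zero_add, Finset.sum_const, Finset.filter_ne',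
    Finset.card_erase_of_mem (Finset.mem_univ _), Finset.card_univ, Fintype.card_fin,
    Nat.add_sub_cancel, nsmul_eq_mul]
  ring

variable (k : Type*) [CommRing k]

/-- The chains on tuples whose vertices have mutual distance at most `D` and lie in all the closed
balls that contain the vertices of `v`. -/
def fineChains {m : ℕ} (v : Fin m → s) (n : ℕ) (D : ℝ) : Submodule k (OrdChains k n s) :=
  Finsupp.supported k k {w | (∀ i j, dist (w i) (w j) ≤ D) ∧
    ∀ x r, (∀ i, dist (v i) x ≤ r) → ∀ i, dist (w i) x ≤ r}

/-- Here `n` counts vertices. A tuple in the subdivision consists of the barycenter and a tuple from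
the subdivision of a face. Distances within the face are bounded by induction. Carrying the
closed-ball condition through the induction bounds the distance to the new apex. -/
theorem ordSubdivision_single_mem {n : ℕ} (v : Fin n → s) (D : ℝ) (hD : 0 ≤ D) (a : k)
    (h : ∀ i j, dist (v i) (v j) ≤ D) :
    ordSubdivision k (tupleBarycenter hs) n (Finsupp.single v a) ∈
      fineChains k v n ((n - 1 : ℝ) / n * D) := by
  induction n generalizing a with
  | zero => exact Finsupp.single_mem_supported _ _ ⟨fun i => i.elim0, fun _ _ _ i => i.elim0⟩
  | succ n ih =>
    rw [ordSubdivision_single, ordBoundary_single, map_sum, map_sum]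
    refine Submodule.sum_mem _ fun l _ => ?_
    rw [map_zsmul, map_zsmul]
    refine zsmul_mem ?_ _
    have h1 := ih (v ∘ l.succAbove) a fun i j => h _ _
    have h2 : fineChains k (v ∘ l.succAbove) n ((n - 1 : ℝ) / n * D) ≤
        (fineChains k v (n + 1) (((n + 1 : ℕ) - 1 : ℝ) / (n + 1 : ℕ) * D)).comap
          (ordCone k (tupleBarycenter hs n v) n) := by
      rw [fineChains, Finsupp.supported_eq_span_single, Submodule.span_le]
      rintro _ ⟨w, ⟨hw1, hw2⟩, rfl⟩
      rw [SetLike.mem_coe, Submodule.mem_comap, ordCone_single]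
      refine Finsupp.single_mem_supported _ _ ?_
      -- The ball condition is used for the ball around the new apex that contains all the vertices
      -- of the face.
      have hb (j) : dist (w j) (tupleBarycenter hs n v) ≤ n / (n + 1) * D :=
        hw2 _ _ (fun i => dist_tupleBarycenter_le hs v _ D h) j
      have hc : ((n - 1 : ℝ) / n * D) ≤ n / (n + 1) * D := by
        refine mul_le_mul_of_nonneg_right ?_ hD
        rcases Nat.eq_zero_or_pos n with rfl | hn
        · simp
        · have : (0 : ℝ) < n := Nat.cast_pos.2 hn
          rw [div_le_div_iff₀ this (by positivity)]
          nlinarith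
      push_cast
      rw [add_sub_cancel_right]
      refine ⟨?_, fun x r hx i => ?_⟩
      · intro i j
        refine Fin.cases ?_ (fun i => ?_) i <;> refine Fin.cases ?_ (fun j => ?_) j
        · simp only [Fin.cons_zero, dist_self]
          positivity
        · simpa [dist_comm] using hb j
        · simpa using hb i
        · simpa using (hw1 i j).trans hc
      · refine Fin.cases ?_ (fun i => ?_) i
        · exact dist_affineSimplex_le hs v _ x r hx
        · simpa using hw2 x r (fun i => hx _) i
    exact h2 h1

theorem ordSubdivision_pow_mem {n : ℕ} (v : Fin (n + 1) → s) (D : ℝ) (hD : 0 ≤ D)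
    (h : ∀ i j, dist (v i) (v j) ≤ D) (N : ℕ) :
    ((ordSubdivision k (tupleBarycenter hs) (n + 1) : Module.End k _) ^ N) (Finsupp.single v 1) ∈
      Finsupp.supported k k
        {w : Fin (n + 1) → s | ∀ i j, dist (w i) (w j) ≤ ((n : ℝ) / (n + 1)) ^ N * D} := by
  induction N with
  | zero => exact Finsupp.single_mem_supported _ _ (by simpa using h)
  | succ N ih =>
    rw [pow_succ' (ordSubdivision k (tupleBarycenter hs) (n + 1) : Module.End k _),
      Module.End.mul_apply]
    suffices h1 : Finsupp.supported k k
        {w : Fin (n + 1) → s | ∀ i j, dist (w i) (w j) ≤ ((n : ℝ) / (n + 1)) ^ N * D} ≤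
        (Finsupp.supported k k {w : Fin (n + 1) → s |
          ∀ i j, dist (w i) (w j) ≤ ((n : ℝ) / (n + 1)) ^ (N + 1) * D}).comap
          (ordSubdivision k (tupleBarycenter hs) (n + 1)) from h1 ih
    rw [Finsupp.supported_eq_span_single, Submodule.span_le]
    rintro _ ⟨w, hw, rfl⟩
    have := ordSubdivision_single_mem hs k w _ (by positivity) 1 hw
    refine Finsupp.supported_mono ?_ this
    rintro u ⟨hu, -⟩ i j
    refine (hu i j).trans_eq ?_
    push_cast
    ring

end AffineSimplex

/-! ### The singular chain complex and natural operators -/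

section Singular

variable (k : Type*) [Field k]

/-- The boundary map of the singular chain complex. -/
def singBoundary (E : Type*) [TopologicalSpace E] (n : ℕ) :
    Chains k E (.mk (n + 1)) →ₗ[k] Chains k E (.mk n) :=
  ∑ i : Fin (n + 2), (-1 : ℤ) ^ (i : ℕ) • Chains.pull k E (SimplexCategory.δ i)

variable {E : Type*} [TopologicalSpace E] {E' : Type*} [TopologicalSpace E']

theorem singBoundary_single (n : ℕ) (σ : Simplex E (.mk (n + 1))) (a : k) :
    singBoundary k E n (Finsupp.single σ a) = ∑ i : Fin (n + 2), (-1 : ℤ) ^ (i : ℕ) •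
      Finsupp.single (Simplex.pull (SimplexCategory.δ i) σ) a := by
  simp [singBoundary, LinearMap.sum_apply, Chains.pull, Finsupp.mapDomain_single]

variable {V : Type*} [NormedAddCommGroup V] [NormedSpace ℝ V] {s : Set V} (hs : Convex ℝ s)
  {V' : Type*} [NormedAddCommGroup V'] [NormedSpace ℝ V'] {s' : Set V'} (hs' : Convex ℝ s')

/-- The singular chain given by a chain on tuples of points in a convex set `s` and a map on
`s`. -/
def ordRealize (g : C(s, E)) (n : ℕ) : OrdChains k (n + 1) s →ₗ[k] Chains k E (.mk n) :=
  Finsupp.lmapDomain k k fun v => g.comp (affineSimplex hs v)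

theorem ordRealize_single (g : C(s, E)) (n : ℕ) (v : Fin (n + 1) → s) (a : k) :
    ordRealize k hs g n (Finsupp.single v a) = Finsupp.single (g.comp (affineSimplex hs v)) a := by
  simp [ordRealize]

theorem singBoundary_ordRealize (g : C(s, E)) (n : ℕ) (c : OrdChains k (n + 2) s) :
    singBoundary k E n (ordRealize k hs g (n + 1) c) =
      ordRealize k hs g n (ordBoundary k s (n + 1) c) := by
  induction c using Finsupp.induction_linear with
  | zero => simp
  | add f g hf hg => simp only [map_add, hf, hg]
  | single v a =>
    simp only [ordRealize_single, ordBoundary_single, map_sum, map_zsmul, singBoundary_single]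
    refine Finset.sum_congr rfl fun i _ => ?_
    congr 2
    exact congrArg g.comp (affineSimplex_comp_map hs v i.succAbove)

theorem ordRealize_ordMap (f : C(s', s)) (hf : IsAffineMap hs' hs f) (g : C(s, E)) (n : ℕ)
    (c : OrdChains k (n + 1) s') :
    ordRealize k hs g n (ordMap k f (n + 1) c) = ordRealize k hs' (g.comp f) n c := by
  induction c using Finsupp.induction_linear with
  | zero => simp
  | add f g hf hg => simp only [map_add, hf, hg]
  | single v a =>
    rw [ordMap_single, ordRealize_single, ordRealize_single]
    congr 1
    ext t
    exact congrArg g (hf n v t).symm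

/-- The operator on singular chains that sends a simplex `σ` to the realization of `θ` along
`g σ`. -/
def singOperator {m n : ℕ} (g : Simplex E (.mk n) → C(s, E')) (θ : OrdChains k (m + 1) s) :
    Chains k E (.mk n) →ₗ[k] Chains k E' (.mk m) :=
  Finsupp.lsum k fun σ => LinearMap.toSpanSingleton k _ (ordRealize k hs (g σ) m θ)

theorem singOperator_single {m n : ℕ} (g : Simplex E (.mk n) → C(s, E'))
    (θ : OrdChains k (m + 1) s) (σ : Simplex E (.mk n)) (a : k) :
    singOperator k hs g θ (Finsupp.single σ a) = a • ordRealize k hs (g σ) m θ := by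
  simp [singOperator]

/-- Applying a natural operator to the faces of `σ` is realizing, along the map for `σ` itself, the
alternating sum of the copies of `θ` on the faces of the model. Homotopy formulas for singular
chains thus reduce to one identity between chains on tuples. -/
theorem singOperator_singBoundary {m n : ℕ} (g : Simplex E (.mk n) → C(s, E'))
    (g' : Simplex E (.mk (n + 1)) → C(s', E')) (θ : OrdChains k (m + 1) s)
    (D : Fin (n + 2) → C(s, s')) (hD : ∀ i, IsAffineMap hs hs' (D i))
    (hg : ∀ i σ, g (Simplex.pull (SimplexCategory.δ i) σ) = (g' σ).comp (D i))
    (σ : Simplex E (.mk (n + 1))) (a : k) :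
    singOperator k hs g θ (singBoundary k E n (Finsupp.single σ a)) =
      a • ordRealize k hs' (g' σ) m
        (∑ i : Fin (n + 2), (-1 : ℤ) ^ (i : ℕ) • ordMap k (D i) (m + 1) θ) := by
  rw [singBoundary_single, map_sum, map_sum, Finset.smul_sum]
  refine Finset.sum_congr rfl fun i _ => ?_
  rw [map_zsmul, map_zsmul, singOperator_single, hg, ordRealize_ordMap k hs' hs _ (hD i),
    smul_comm]

/-- The fundamental chain of the standard simplex. -/
def ordFundamental (n : ℕ) : OrdChains k (n + 1) (stdSimplex ℝ (Fin (n + 1))) :=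
  Finsupp.single stdSimplex.vertex 1

/-- The `i`-th face of the standard simplex. -/
def stdFace {n : ℕ} (i : Fin (n + 2)) :
    C(stdSimplex ℝ (Fin (n + 1)), stdSimplex ℝ (Fin (n + 2))) :=
  ⟨stdSimplex.map i.succAbove, stdSimplex.continuous_map _⟩

theorem sum_ordMap_ordFundamental (n : ℕ) :
    ∑ i : Fin (n + 2), (-1 : ℤ) ^ (i : ℕ) • ordMap k (stdFace i) (n + 1) (ordFundamental k n) =
      ordBoundary k _ (n + 1) (ordFundamental k (n + 1)) := by
  simp only [ordFundamental, ordBoundary_single, ordMap_single]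
  refine Finset.sum_congr rfl fun i _ => ?_
  congr 2
  funext j
  exact stdSimplex.map_vertex _ _

theorem ordRealize_ordFundamental (n : ℕ) (σ : C(stdSimplex ℝ (Fin (n + 1)), E)) :
    ordRealize k (convex_stdSimplex ℝ _) σ n (ordFundamental k n) = Finsupp.single σ 1 := by
  rw [ordFundamental, ordRealize_single, affineSimplex_vertex, ContinuousMap.comp_id]

theorem singBoundary_singBoundary (n : ℕ) (c : Chains k E (.mk (n + 2))) :
    singBoundary k E n (singBoundary k E (n + 1) c) = 0 := by
  induction c using Finsupp.induction_linear with
  | zero => simp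
  | add f g hf hg => simp only [map_add, hf, hg, add_zero]
  | single σ a =>
    rw [← mul_one a, ← smul_eq_mul, ← Finsupp.smul_single, ← ordRealize_ordFundamental, map_smul,
      map_smul, singBoundary_ordRealize, singBoundary_ordRealize, ordBoundary_ordBoundary,
      map_zero, smul_zero]

end Singular

/-! ### Chains in a subset, subdivision and homotopies -/

section Operators

variable (k : Type*) [Field k] {E : Type*} [TopologicalSpace E] {E' : Type*} [TopologicalSpace E']

/-- The singular chains in a subset. -/
def chainsIn (A : Set E) (n : ℕ) : Submodule k (Chains k E (.mk n)) :=
  Finsupp.supported k k {σ | ∀ x, σ x ∈ A}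

theorem single_mem_chainsIn {A : Set E} {n : ℕ} {σ : Simplex E (.mk n)} (a : k)
    (h : ∀ x, σ x ∈ A) : Finsupp.single σ a ∈ chainsIn k A n :=
  Finsupp.single_mem_supported _ _ h

theorem chainsIn_le {A : Set E} {n : ℕ} {P : Submodule k (Chains k E (.mk n))}
    (h : ∀ σ : Simplex E (.mk n), (∀ x, σ x ∈ A) → Finsupp.single σ 1 ∈ P) :
    chainsIn k A n ≤ P := by
  rw [chainsIn, Finsupp.supported_eq_span_single, Submodule.span_le]
  rintro _ ⟨σ, hσ, rfl⟩
  exact h σ hσ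

theorem chainsIn_mono {A B : Set E} (h : A ⊆ B) (n : ℕ) : chainsIn k A n ≤ chainsIn k B n :=
  Finsupp.supported_mono fun _ hσ x => h (hσ x)

theorem chainsIn_inter (A B : Set E) (n : ℕ) :
    chainsIn k (A ∩ B) n = chainsIn k A n ⊓ chainsIn k B n := by
  rw [chainsIn, chainsIn, chainsIn, ← Finsupp.supported_inter]
  congr 1
  ext σ
  exact forall_and

theorem singBoundary_mem {A : Set E} {n : ℕ} {c : Chains k E (.mk (n + 1))}
    (hc : c ∈ chainsIn k A (n + 1)) : singBoundary k E n c ∈ chainsIn k A n := by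
  suffices h : chainsIn k A (n + 1) ≤ (chainsIn k A n).comap (singBoundary k E n) from h hc
  refine chainsIn_le k fun σ hσ => ?_
  rw [Submodule.mem_comap, singBoundary_single]
  exact Submodule.sum_mem _ fun i _ => zsmul_mem
    (single_mem_chainsIn k (σ := Simplex.pull (SimplexCategory.δ i) σ) _ fun x => hσ _) _

variable {V : Type*} [NormedAddCommGroup V] [NormedSpace ℝ V] {s : Set V} (hs : Convex ℝ s)

theorem ordRealize_mem {A : Set E} (g : C(s, E)) (hg : ∀ x, g x ∈ A) (n : ℕ)
    (c : OrdChains k (n + 1) s) : ordRealize k hs g n c ∈ chainsIn k A n := by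
  induction c using Finsupp.induction_linear with
  | zero => simp
  | add f g hf hg => rw [map_add]; exact add_mem hf hg
  | single v a =>
    rw [ordRealize_single]
    exact single_mem_chainsIn k _ fun x => hg _

theorem singOperator_mem {m n : ℕ} {A : Set E} {B : Set E'} (g : Simplex E (.mk n) → C(s, E'))
    (θ : OrdChains k (m + 1) s) (hg : ∀ σ, (∀ x, σ x ∈ A) → ∀ x, g σ x ∈ B)
    {c : Chains k E (.mk n)} (hc : c ∈ chainsIn k A n) :
    singOperator k hs g θ c ∈ chainsIn k B m := by
  suffices h : chainsIn k A n ≤ (chainsIn k B m).comap (singOperator k hs g θ) from h hc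
  refine chainsIn_le k fun σ hσ => ?_
  rw [Submodule.mem_comap, singOperator_single]
  exact Submodule.smul_mem _ _ (ordRealize_mem k hs _ (hg σ hσ) _ _)

/-- Barycentric subdivision of singular chains. -/
def singSubdivision (E : Type*) [TopologicalSpace E] (n : ℕ) : Module.End k (Chains k E (.mk n)) :=
  singOperator k (convex_stdSimplex ℝ (Fin (n + 1))) id
    (ordSubdivision k (tupleBarycenter (convex_stdSimplex ℝ (Fin (n + 1)))) (n + 1)
      (ordFundamental k n))

theorem singSubdivision_mem {A : Set E} {n : ℕ} {c : Chains k E (.mk n)}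
    (hc : c ∈ chainsIn k A n) : singSubdivision k E n c ∈ chainsIn k A n :=
  singOperator_mem k _ _ _ (fun _ hσ => hσ) hc

/-- Affine simplices preserve barycenters, so subdividing the standard simplex and mapping it agrees
with subdividing the tuple of images. This allows subdivision to be iterated on the level of tuples.
-/
theorem singSubdivision_ordRealize (g : C(s, E)) (n : ℕ) (c : OrdChains k (n + 1) s) :
    singSubdivision k E n (ordRealize k hs g n c) =
      ordRealize k hs g n (ordSubdivision k (tupleBarycenter hs) (n + 1) c) := by
  induction c using Finsupp.induction_linear with
  | zero => simp
  | add f g hf hg => simp only [map_add, hf, hg]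
  | single v a =>
    rw [ordRealize_single, singSubdivision, singOperator_single, id,
      ← ordRealize_ordMap k hs _ _ (isAffineMap_affineSimplex hs v),
      ordMap_ordSubdivision k _ _ _ fun n w =>
        (isAffineMap_affineSimplex hs v).map_tupleBarycenter _ _ n w,
      ordFundamental, ordMap_single, ← map_smul, ← map_smul, Finsupp.smul_single, smul_eq_mul,
      mul_one]
    congr 3
    funext i
    exact affineSimplex_apply_vertex hs v i

theorem singBoundary_singSubdivision (n : ℕ) (c : Chains k E (.mk (n + 1))) :
    singBoundary k E n (singSubdivision k E (n + 1) c) =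
      singSubdivision k E n (singBoundary k E n c) := by
  induction c using Finsupp.induction_linear with
  | zero => simp
  | add f g hf hg => simp only [map_add, hf, hg]
  | single σ a =>
    rw [singSubdivision, singOperator_single, map_smul, id, singBoundary_ordRealize,
      ordBoundary_ordSubdivision, ← singSubdivision_ordRealize, ← singBoundary_ordRealize,
      ordRealize_ordFundamental, ← map_smul, ← map_smul, Finsupp.smul_single, smul_eq_mul, mul_one]

/-- The subdivision homotopy on tuples of points of a convex set. -/
def ordSubdivisionHomotopy (n : ℕ) : OrdChains k n s →ₗ[k] OrdChains k (n + 1) s :=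
  ordHomotopy k (fun _ => LinearMap.id) (ordSubdivision k (tupleBarycenter hs)) (fun _ v => v 0) n

theorem ordBoundary_ordSubdivisionHomotopy (n : ℕ) (c : OrdChains k (n + 1) s) :
    ordBoundary k s (n + 1) (ordSubdivisionHomotopy k hs (n + 1) c) =
      ordSubdivision k (tupleBarycenter hs) (n + 1) c - c -
        ordSubdivisionHomotopy k hs n (ordBoundary k s n c) := by
  have h := ordBoundary_ordHomotopy k (fun _ => LinearMap.id)
    (ordSubdivision k (tupleBarycenter hs)) (fun _ v => v 0)
    (fun _ _ => by simp only [LinearMap.id_apply])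
    (ordBoundary_ordSubdivision k _) (by rw [ordSubdivision]) n c
  rwa [LinearMap.id_apply] at h

theorem ordMap_ordSubdivisionHomotopy {V' : Type*} [NormedAddCommGroup V'] [NormedSpace ℝ V']
    {s' : Set V'} (hs' : Convex ℝ s') (f : s → s') (hf : IsAffineMap hs hs' f) (n : ℕ)
    (c : OrdChains k n s) : ordMap k f (n + 1) (ordSubdivisionHomotopy k hs n c) =
      ordSubdivisionHomotopy k hs' n (ordMap k f n c) :=
  ordMap_ordHomotopy k (fun _ => LinearMap.id) (ordSubdivision k (tupleBarycenter hs))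
    (fun _ v => v 0) (fun _ => LinearMap.id) (ordSubdivision k (tupleBarycenter hs'))
    (fun _ v => v 0) f f (fun _ _ => by simp only [LinearMap.id_apply])
    (ordMap_ordSubdivision k _ _ _ fun n w => hf.map_tupleBarycenter _ _ n w)
    (fun _ _ => by simp only [Function.comp_apply]) n c

/-- The chain homotopy between the identity and the barycentric subdivision. -/
def singSubdivisionHomotopy (E : Type*) [TopologicalSpace E] (n : ℕ) :
    Chains k E (.mk n) →ₗ[k] Chains k E (.mk (n + 1)) :=
  singOperator k (convex_stdSimplex ℝ (Fin (n + 1))) id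
    (ordSubdivisionHomotopy k (convex_stdSimplex ℝ (Fin (n + 1))) (n + 1) (ordFundamental k n))

theorem singSubdivisionHomotopy_mem {A : Set E} {n : ℕ} {c : Chains k E (.mk n)}
    (hc : c ∈ chainsIn k A n) : singSubdivisionHomotopy k E n c ∈ chainsIn k A (n + 1) :=
  singOperator_mem k _ _ _ (fun _ hσ => hσ) hc

theorem singBoundary_singSubdivisionHomotopy_zero (c : Chains k E (.mk 0)) :
    singBoundary k E 0 (singSubdivisionHomotopy k E 0 c) = singSubdivision k E 0 c - c := by
  induction c using Finsupp.induction_linear with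
  | zero => simp
  | add f g hf hg => simp only [map_add, hf, hg]; abel
  | single σ a =>
    rw [singSubdivisionHomotopy, singOperator_single, map_smul, id, singBoundary_ordRealize,
      ordBoundary_ordSubdivisionHomotopy, map_sub, map_sub, smul_sub, smul_sub,
      ordRealize_ordFundamental, singSubdivision, singOperator_single, Finsupp.smul_single,
      smul_eq_mul, mul_one, id]
    simp [ordSubdivisionHomotopy, ordHomotopy]

theorem singBoundary_singSubdivisionHomotopy (n : ℕ) (c : Chains k E (.mk (n + 1))) :
    singBoundary k E (n + 1) (singSubdivisionHomotopy k E (n + 1) c) =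
      singSubdivision k E (n + 1) c - c - singSubdivisionHomotopy k E n (singBoundary k E n c) := by
  induction c using Finsupp.induction_linear with
  | zero => simp
  | add f g hf hg => simp only [map_add, hf, hg]; abel
  | single σ a =>
    rw [singSubdivisionHomotopy, singOperator_single, map_smul, id, singBoundary_ordRealize,
      ordBoundary_ordSubdivisionHomotopy, map_sub, map_sub, smul_sub, smul_sub,
      ordRealize_ordFundamental, singSubdivision, singOperator_single, Finsupp.smul_single,
      smul_eq_mul, mul_one, id, singSubdivisionHomotopy,
      singOperator_singBoundary k _ (convex_stdSimplex ℝ (Fin (n + 2))) id id _ stdFace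
        (fun i => isAffineMap_map _) (fun _ _ => rfl)]
    congr 3
    rw [← sum_ordMap_ordFundamental, map_sum]
    refine Finset.sum_congr rfl fun i _ => ?_
    rw [map_zsmul]
    congr 1
    exact (ordMap_ordSubdivisionHomotopy k _ _ _ (isAffineMap_map _) _ _).symm

/-- The preimages of `U` and `V` cover the compact standard simplex, so they have a Lebesgue number.
Repeated subdivision makes the mesh smaller than that number. -/
theorem exists_singSubdivision_pow_mem_single {n : ℕ} (σ : Simplex E (.mk n)) {W U V : Set E}
    (hU : IsOpen U) (hV : IsOpen V) (hW : W ⊆ U ∪ V) (hσ : ∀ x, σ x ∈ W) :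
    ∃ N : ℕ, (singSubdivision k E n ^ N) (Finsupp.single σ 1) ∈
      chainsIn k (W ∩ U) n ⊔ chainsIn k (W ∩ V) n := by
  obtain ⟨δ, hδ, hball⟩ := lebesgue_number_lemma_of_metric
    (isCompact_univ (X := stdSimplex ℝ (Fin (n + 1)))) (c := fun b : Bool => σ ⁻¹' (cond b U V))
    (by rintro (_ | _) <;> simp only [cond] <;> exact IsOpen.preimage σ.continuous ‹_›)
    (fun x _ => by
      rcases hW (hσ x) with h | h
      · exact Set.mem_iUnion.2 ⟨true, h⟩
      · exact Set.mem_iUnion.2 ⟨false, h⟩)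
  have hc : (n : ℝ) / (n + 1) < 1 := by
    rw [div_lt_one (by positivity)]
    linarith
  obtain ⟨N, hN⟩ := exists_pow_lt_of_lt_one hδ hc
  refine ⟨N, ?_⟩
  have h1 (N : ℕ) : (singSubdivision k E n ^ N) (Finsupp.single σ 1) =
      ordRealize k (convex_stdSimplex ℝ _) σ n
        ((ordSubdivision k (tupleBarycenter (convex_stdSimplex ℝ _)) (n + 1) :
          Module.End k _) ^ N <| ordFundamental k n) := by
    induction N with
    | zero => simp [ordRealize_ordFundamental]
    | succ N ih =>
      rw [pow_succ', Module.End.mul_apply, ih, singSubdivision_ordRealize,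
        pow_succ' (ordSubdivision k _ (n + 1) : Module.End k _), Module.End.mul_apply]
  rw [h1]
  -- The standard simplex has diameter at most one, so the mesh after `N` subdivisions is at most
  -- `(n / (n + 1)) ^ N`.
  have h2 := ordSubdivision_pow_mem (convex_stdSimplex ℝ (Fin (n + 1))) k stdSimplex.vertex 1
    zero_le_one (fun i j => by
      refine (Metric.dist_le_diam_of_mem (bounded_stdSimplex _) (Subtype.prop _)
        (Subtype.prop _)).trans diam_stdSimplex_le) N
  rw [mul_one] at h2
  refine (?_ : Finsupp.supported k k _ ≤ (chainsIn k (W ∩ U) n ⊔ chainsIn k (W ∩ V) n).comap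
    (ordRealize k (convex_stdSimplex ℝ (Fin (n + 1))) σ n)) h2
  rw [Finsupp.supported_eq_span_single, Submodule.span_le]
  rintro _ ⟨w, hw, rfl⟩
  rw [SetLike.mem_coe, Submodule.mem_comap, ordRealize_single]
  obtain ⟨b, hb⟩ := hball (w 0) (Set.mem_univ _)
  have h3 (x) : σ (affineSimplex (convex_stdSimplex ℝ _) w x) ∈ cond b U V :=
    hb ((dist_affineSimplex_le _ w x (w 0) _ fun i => hw i 0).trans_lt hN)
  cases b with
  | true =>
    exact Submodule.mem_sup_left (single_mem_chainsIn k _ fun x => ⟨hσ _, h3 x⟩)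
  | false =>
    exact Submodule.mem_sup_right (single_mem_chainsIn k _ fun x => ⟨hσ _, h3 x⟩)

theorem singSubdivision_mem_sup {A B : Set E} {n : ℕ} {c : Chains k E (.mk n)}
    (hc : c ∈ chainsIn k A n ⊔ chainsIn k B n) (N : ℕ) :
    (singSubdivision k E n ^ N) c ∈ chainsIn k A n ⊔ chainsIn k B n := by
  induction N with
  | zero => simpa
  | succ N ih =>
    rw [pow_succ', Module.End.mul_apply]
    obtain ⟨a, ha, b, hb, h⟩ := Submodule.mem_sup.1 ih
    rw [← h, map_add]
    exact Submodule.add_mem_sup (singSubdivision_mem k ha) (singSubdivision_mem k hb)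

theorem exists_singSubdivision_pow_mem {n : ℕ} {W U V : Set E} (hU : IsOpen U) (hV : IsOpen V)
    (hW : W ⊆ U ∪ V) {c : Chains k E (.mk n)} (hc : c ∈ chainsIn k W n) :
    ∃ N : ℕ, (singSubdivision k E n ^ N) c ∈ chainsIn k (W ∩ U) n ⊔ chainsIn k (W ∩ V) n := by
  rw [chainsIn, Finsupp.supported_eq_span_single] at hc
  induction hc using Submodule.span_induction with
  | mem x h =>
    obtain ⟨σ, hσ, rfl⟩ := h
    exact exists_singSubdivision_pow_mem_single k σ hU hV hW hσ
  | zero => exact ⟨0, by simp⟩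
  | add x y _ _ hx hy =>
    obtain ⟨M, hM⟩ := hx
    obtain ⟨N, hN⟩ := hy
    -- Subdividing a small chain further keeps it small, so the two exponents may be added.
    refine ⟨M + N, ?_⟩
    rw [map_add]
    refine add_mem ?_ ?_
    · rw [add_comm, pow_add, Module.End.mul_apply]
      exact singSubdivision_mem_sup k hM N
    · rw [pow_add, Module.End.mul_apply]
      exact singSubdivision_mem_sup k hN M
  | smul a x _ hx =>
    obtain ⟨M, hM⟩ := hx
    exact ⟨M, by rw [map_smul]; exact Submodule.smul_mem _ _ hM⟩

/-- The chains whose boundary lies in given submodules. -/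
def relCycles (P : ∀ n, Submodule k (Chains k E (.mk n))) : ∀ n, Submodule k (Chains k E (.mk n))
  | 0 => ⊤
  | n + 1 => (P n).comap (singBoundary k E n)

/-- Up to a boundary, a chain with small boundary is small. -/
theorem exists_sub_singBoundary_mem {n : ℕ} {W U V : Set E} (hU : IsOpen U) (hV : IsOpen V)
    (hW : W ⊆ U ∪ V) {c : Chains k E (.mk n)} (hc : c ∈ chainsIn k W n)
    (hdc : c ∈ relCycles k (fun n => chainsIn k (W ∩ U) n ⊔ chainsIn k (W ∩ V) n) n) :
    ∃ w ∈ chainsIn k W (n + 1), c - singBoundary k E n w ∈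
      chainsIn k (W ∩ U) n ⊔ chainsIn k (W ∩ V) n := by
  obtain ⟨N, hN⟩ := exists_singSubdivision_pow_mem k hU hV hW hc
  induction N generalizing c with
  | zero => exact ⟨0, zero_mem _, by simpa using hN⟩
  | succ N ih =>
    have hmem : singSubdivision k E n c ∈ chainsIn k W n := singSubdivision_mem k hc
    have hrel : singSubdivision k E n c ∈
        relCycles k (fun n => chainsIn k (W ∩ U) n ⊔ chainsIn k (W ∩ V) n) n := by
      cases n with
      | zero => trivial
      | succ n =>
        rw [relCycles, Submodule.mem_comap]
        rw [singBoundary_singSubdivision]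
        simpa using singSubdivision_mem_sup k hdc 1
    obtain ⟨w, hw, hw'⟩ := ih hmem hrel (by rwa [pow_succ, Module.End.mul_apply] at hN)
    -- With subdivision S and homotopy T, the formula ∂T + T∂ = S - 1 gives c - ∂(w - Tc) = (Sc -
    -- ∂w) - T∂c. The first term is small by induction, the second because ∂c is small.
    refine ⟨w - singSubdivisionHomotopy k E n c, sub_mem hw (singSubdivisionHomotopy_mem k hc), ?_⟩
    cases n with
    | zero =>
      rw [map_sub, singBoundary_singSubdivisionHomotopy_zero]
      convert hw' using 1
      abel
    | succ n =>
      rw [map_sub, singBoundary_singSubdivisionHomotopy]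
      have h1 : singSubdivisionHomotopy k E n (singBoundary k E n c) ∈
          chainsIn k (W ∩ U) (n + 1) ⊔ chainsIn k (W ∩ V) (n + 1) := by
        obtain ⟨a, ha, b, hb, h⟩ := Submodule.mem_sup.1 hdc
        rw [← h, map_add]
        exact Submodule.add_mem_sup (singSubdivisionHomotopy_mem k ha)
          (singSubdivisionHomotopy_mem k hb)
      convert sub_mem hw' h1 using 1
      abel

end Operators

/-! ### The prism operator of a homotopy on singular chains -/

section Homotopy

variable (k : Type*) [Field k] {E : Type*} [TopologicalSpace E] {Z : Type*} [TopologicalSpace Z]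

/-- The map on singular chains induced by a continuous map. -/
def singPush (f : C(Z, E)) (n : ℕ) : Chains k Z (.mk n) →ₗ[k] Chains k E (.mk n) :=
  Finsupp.lmapDomain k k fun σ => f.comp σ

theorem singPush_single (f : C(Z, E)) (n : ℕ) (σ : Simplex Z (.mk n)) (a : k) :
    singPush k f n (Finsupp.single σ a) = Finsupp.single (f.comp σ) a := by
  simp [singPush]

theorem singBoundary_singPush (f : C(Z, E)) (n : ℕ) (c : Chains k Z (.mk (n + 1))) :
    singBoundary k E n (singPush k f (n + 1) c) = singPush k f n (singBoundary k Z n c) := by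
  induction c using Finsupp.induction_linear with
  | zero => simp
  | add f g hf hg => simp only [map_add, hf, hg]
  | single σ a =>
    simp only [singPush_single, singBoundary_single, map_sum, map_zsmul]
    rfl

theorem singPush_mem {f : C(Z, E)} {A : Set Z} {B : Set E} (hf : ∀ z ∈ A, f z ∈ B) {n : ℕ}
    {c : Chains k Z (.mk n)} (hc : c ∈ chainsIn k A n) : singPush k f n c ∈ chainsIn k B n := by
  suffices h : chainsIn k A n ≤ (chainsIn k B n).comap (singPush k f n) from h hc
  refine chainsIn_le k fun σ hσ => ?_
  rw [Submodule.mem_comap, singPush_single]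
  exact single_mem_chainsIn k _ fun x => hf _ (hσ x)

theorem singPush_injective {f : C(Z, E)} (hf : Function.Injective f) (n : ℕ) :
    Function.Injective (singPush k f n) :=
  Finsupp.mapDomain_injective fun _ _ h => ContinuousMap.ext fun x =>
    hf (congrArg (fun τ : Simplex E (.mk n) => τ x) h)

theorem exists_singPush_eq {A B : Set E} (h : A ⊆ B) {n : ℕ} {c : Chains k E (.mk n)}
    (hc : c ∈ chainsIn k A n) :
    ∃ c' ∈ chainsIn k (Subtype.val ⁻¹' A : Set B) n,
      singPush k ⟨Subtype.val, continuous_subtype_val⟩ n c' = c := by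
  suffices h' : chainsIn k A n ≤ (chainsIn k (Subtype.val ⁻¹' A : Set B) n).map
    (singPush k ⟨Subtype.val, continuous_subtype_val⟩ n) from h' hc
  refine chainsIn_le k fun σ hσ => ?_
  let τ : Simplex B (.mk n) := ⟨fun x => ⟨σ x, h (hσ x)⟩, σ.continuous.subtype_mk _⟩
  exact ⟨Finsupp.single τ 1, single_mem_chainsIn k (σ := τ) 1 hσ, singPush_single ..⟩

/-- The prism over the standard simplex. -/
def stdPrism (n : ℕ) : Set (ℝ × (Fin (n + 1) → ℝ)) := unitInterval ×ˢ stdSimplex ℝ (Fin (n + 1))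

theorem convex_stdPrism (n : ℕ) : Convex ℝ (stdPrism n) :=
  (convex_Icc _ _).prod (convex_stdSimplex ℝ _)

/-- The inclusion of the standard simplex in the prism at height `t`. -/
def stdPrismAt (t : unitInterval) (n : ℕ) : C(stdSimplex ℝ (Fin (n + 1)), stdPrism n) :=
  ⟨fun x => ⟨(t, x.1), t.2, x.2⟩, by fun_prop⟩

theorem isAffineMap_stdPrismAt (t : unitInterval) (n : ℕ) :
    IsAffineMap (convex_stdSimplex ℝ _) (convex_stdPrism n) (stdPrismAt t n) := by
  intro m v x
  ext1
  rw [affineSimplex_coe]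
  refine Prod.ext ?_ ?_
  · rw [Prod.fst_sum]
    change t.1 = ∑ i, x.1 i • t.1
    rw [← Finset.sum_smul, x.2.2, one_smul]
  · rw [Prod.snd_sum]
    rfl

/-- The `i`-th side of the prism. -/
def stdPrismFace {n : ℕ} (i : Fin (n + 2)) : C(stdPrism n, stdPrism (n + 1)) :=
  ⟨fun p => ⟨(p.1.1, (stdFace i ⟨p.1.2, p.2.2⟩).1), p.2.1, Subtype.prop _⟩, by fun_prop⟩

theorem isAffineMap_stdPrismFace {n : ℕ} (i : Fin (n + 2)) :
    IsAffineMap (convex_stdPrism n) (convex_stdPrism (n + 1)) (stdPrismFace i) := by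
  intro m v x
  ext1
  rw [affineSimplex_coe]
  refine Prod.ext ?_ ?_
  · rw [Prod.fst_sum]
    change (affineSimplex _ v x).1.1 = _
    rw [affineSimplex_coe, Prod.fst_sum]
    rfl
  · rw [Prod.snd_sum]
    have h := congrArg Subtype.val
      (isAffineMap_map i.succAbove m (fun j => ⟨(v j).1.2, (v j).2.2⟩) x)
    rw [affineSimplex_coe] at h
    refine Eq.trans ?_ h
    change (stdFace i _).1 = (stdFace i _).1
    congr 2
    ext1
    change (affineSimplex _ v x).1.2 = _
    rw [affineSimplex_coe, Prod.snd_sum]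
    rfl

/-- The prism operator on tuples. -/
def ordPrism (N n : ℕ) :
    OrdChains k n (stdSimplex ℝ (Fin (N + 1))) →ₗ[k] OrdChains k (n + 1) (stdPrism N) :=
  ordHomotopy k (ordMap k (stdPrismAt 0 N)) (ordMap k (stdPrismAt 1 N))
    (fun _ v => stdPrismAt 0 N (v 0)) n

theorem ordBoundary_ordPrism (N n : ℕ) (c : OrdChains k (n + 1) (stdSimplex ℝ (Fin (N + 1)))) :
    ordBoundary k _ (n + 1) (ordPrism k N (n + 1) c) =
      ordMap k (stdPrismAt 1 N) (n + 1) c - ordMap k (stdPrismAt 0 N) (n + 1) c -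
        ordPrism k N n (ordBoundary k _ n c) :=
  ordBoundary_ordHomotopy k _ _ _ (ordBoundary_ordMap k _) (ordBoundary_ordMap k _)
    (by
      rw [ordMap, ordMap]
      congr 1
      funext v
      exact Subsingleton.elim _ _) n c

theorem ordMap_stdPrismFace_ordPrism {N : ℕ} (i : Fin (N + 2)) (n : ℕ)
    (c : OrdChains k n (stdSimplex ℝ (Fin (N + 1)))) :
    ordMap k (stdPrismFace i) (n + 1) (ordPrism k N n c) =
      ordPrism k (N + 1) n (ordMap k (stdFace i) n c) := by
  refine ordMap_ordHomotopy k _ _ _ _ _ _ _ _ (fun n c => ?_) (fun n c => ?_) (fun _ _ => rfl) n c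
  all_goals
    induction c using Finsupp.induction_linear with
    | zero => simp
    | add f g hf hg => simp only [map_add, hf, hg]
    | single v a =>
      simp only [ordMap_single]
      rfl

/-- The map on the prism given by a homotopy and a singular simplex. -/
def prismMap (h : C(unitInterval × Z, E)) (n : ℕ) (σ : C(stdSimplex ℝ (Fin (n + 1)), Z)) :
    C(stdPrism n, E) :=
  h.comp ⟨fun p => (⟨p.1.1, p.2.1⟩, σ ⟨p.1.2, p.2.2⟩), by fun_prop⟩

/-- The chain homotopy given by a homotopy. -/
def singPrism (h : C(unitInterval × Z, E)) (n : ℕ) : Chains k Z (.mk n) →ₗ[k] Chains k E (.mk (n + 1)) :=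
  singOperator k (convex_stdPrism n) (prismMap h n) (ordPrism k n (n + 1) (ordFundamental k n))

theorem singPrism_mem {h : C(unitInterval × Z, E)} {A : Set Z} {B : Set E}
    (hAB : ∀ t, ∀ z ∈ A, h (t, z) ∈ B) {n : ℕ} {c : Chains k Z (.mk n)}
    (hc : c ∈ chainsIn k A n) : singPrism k h n c ∈ chainsIn k B (n + 1) :=
  singOperator_mem k _ _ _ (fun _ hσ _ => hAB _ _ (hσ _)) hc

/-- The map at time `t` of a homotopy. -/
def homotopyAt (h : C(unitInterval × Z, E)) (t : unitInterval) : C(Z, E) := ⟨fun z => h (t, z), by fun_prop⟩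

theorem ordRealize_prismMap_stdPrismAt (h : C(unitInterval × Z, E)) (t : unitInterval) (n : ℕ)
    (σ : C(stdSimplex ℝ (Fin (n + 1)), Z)) :
    ordRealize k (convex_stdPrism n) (prismMap h n σ) n
      (ordMap k (stdPrismAt t n) (n + 1) (ordFundamental k n)) =
      Finsupp.single ((homotopyAt h t).comp σ) 1 := by
  rw [ordRealize_ordMap k _ (convex_stdSimplex ℝ _) _ (isAffineMap_stdPrismAt t n),
    ordRealize_ordFundamental]
  rfl

theorem singBoundary_singPrism_zero (h : C(unitInterval × Z, E)) (c : Chains k Z (.mk 0)) :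
    singBoundary k E 0 (singPrism k h 0 c) =
      singPush k (homotopyAt h 1) 0 c - singPush k (homotopyAt h 0) 0 c := by
  induction c using Finsupp.induction_linear with
  | zero => simp
  | add f g hf hg => simp only [map_add, hf, hg]; abel
  | single σ a =>
    rw [singPrism, singOperator_single, map_smul, singBoundary_ordRealize, ordBoundary_ordPrism,
      map_sub, map_sub, ordRealize_prismMap_stdPrismAt, ordRealize_prismMap_stdPrismAt,
      singPush_single, singPush_single, smul_sub, smul_sub]
    simp [ordPrism, ordHomotopy]

theorem singBoundary_singPrism (h : C(unitInterval × Z, E)) (n : ℕ) (c : Chains k Z (.mk (n + 1))) :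
    singBoundary k E (n + 1) (singPrism k h (n + 1) c) =
      singPush k (homotopyAt h 1) (n + 1) c - singPush k (homotopyAt h 0) (n + 1) c -
        singPrism k h n (singBoundary k Z n c) := by
  induction c using Finsupp.induction_linear with
  | zero => simp
  | add f g hf hg => simp only [map_add, hf, hg]; abel
  | single σ a =>
    rw [singPrism, singOperator_single, map_smul, singBoundary_ordRealize, ordBoundary_ordPrism,
      map_sub, map_sub, ordRealize_prismMap_stdPrismAt, ordRealize_prismMap_stdPrismAt,
      singPush_single, singPush_single, smul_sub, smul_sub, Finsupp.smul_single,
      Finsupp.smul_single, smul_eq_mul, mul_one, singPrism,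
      singOperator_singBoundary k (convex_stdPrism n) (convex_stdPrism (n + 1)) _
        (prismMap h (n + 1)) _ stdPrismFace isAffineMap_stdPrismFace (fun _ _ => rfl)]
    congr 3
    rw [← sum_ordMap_ordFundamental, map_sum]
    refine Finset.sum_congr rfl fun i _ => ?_
    rw [map_zsmul, ordMap_stdPrismFace_ordPrism]

end Homotopy

/-! ### The homology of subsets -/

section SubsetHomology

variable (k : Type*) [Field k] {E : Type*} [TopologicalSpace E]

/-- The cycles in a subset. -/
def cyclesIn (A : Set E) (n : ℕ) : Submodule k (Chains k E (.mk n)) :=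
  chainsIn k A n ⊓ relCycles k (fun _ => ⊥) n

/-- The boundaries in a subset. -/
def boundariesIn (A : Set E) (n : ℕ) : Submodule k (Chains k E (.mk n)) :=
  (chainsIn k A (n + 1)).map (singBoundary k E n)

/-- The map `H_n(A) → H_n(B)` is surjective. -/
def HomologySurj (A B : Set E) (n : ℕ) : Prop :=
  cyclesIn k B n ≤ cyclesIn k A n ⊔ boundariesIn k B n

/-- The map `H_n(A) → H_n(B)` is injective. -/
def HomologyInj (A B : Set E) (n : ℕ) : Prop :=
  chainsIn k A n ⊓ boundariesIn k B n ≤ boundariesIn k A n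

theorem boundariesIn_mono {A B : Set E} (h : A ⊆ B) (n : ℕ) :
    boundariesIn k A n ≤ boundariesIn k B n :=
  Submodule.map_mono (chainsIn_mono k h _)

theorem cyclesIn_mono {A B : Set E} (h : A ⊆ B) (n : ℕ) : cyclesIn k A n ≤ cyclesIn k B n :=
  inf_le_inf_right _ (chainsIn_mono k h _)

theorem boundary_mem_relCycles (P : ∀ n, Submodule k (Chains k E (.mk n))) (n : ℕ)
    (c : Chains k E (.mk (n + 1))) : singBoundary k E n c ∈ relCycles k P n := by
  cases n with
  | zero => trivial
  | succ n =>
    rw [relCycles, Submodule.mem_comap, singBoundary_singBoundary]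
    exact zero_mem _

theorem boundariesIn_le_cyclesIn (A : Set E) (n : ℕ) : boundariesIn k A n ≤ cyclesIn k A n := by
  rintro _ ⟨c, hc, rfl⟩
  exact ⟨singBoundary_mem k hc, boundary_mem_relCycles k _ n c⟩

theorem mem_cyclesIn_succ {A : Set E} {n : ℕ} {c : Chains k E (.mk (n + 1))} :
    c ∈ cyclesIn k A (n + 1) ↔ c ∈ chainsIn k A (n + 1) ∧ singBoundary k E n c = 0 := Iff.rfl

theorem mem_cyclesIn_zero {A : Set E} {c : Chains k E (.mk 0)} :
    c ∈ cyclesIn k A 0 ↔ c ∈ chainsIn k A 0 := and_iff_left trivial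

theorem HomologySurj.trans {A B C : Set E} {n : ℕ} (hBC : B ⊆ C) (h₁ : HomologySurj k A B n)
    (h₂ : HomologySurj k B C n) : HomologySurj k A C n := by
  exact le_trans h₂ (sup_le (le_trans h₁ (sup_le_sup_left (boundariesIn_mono k hBC n) _))
    le_sup_right)

theorem HomologyInj.trans {A B C : Set E} {n : ℕ} (hAB : A ⊆ B) (h₁ : HomologyInj k A B n)
    (h₂ : HomologyInj k B C n) : HomologyInj k A C n :=
  fun _ hz => h₁ ⟨hz.1, h₂ ⟨chainsIn_mono k hAB n hz.1, hz.2⟩⟩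

theorem HomologySurj.of_comp {A B C : Set E} {n : ℕ} (hAB : A ⊆ B)
    (h : HomologySurj k A C n) : HomologySurj k B C n :=
  le_trans h (sup_le_sup_right (cyclesIn_mono k hAB n) _)

theorem HomologyInj.of_comp {A B C : Set E} {n : ℕ} (hBC : B ⊆ C)
    (h : HomologyInj k A C n) : HomologyInj k A B n :=
  fun _ hz => h ⟨hz.1, boundariesIn_mono k hBC n hz.2⟩

/-- If `H_n(A) → H_n(B)` is surjective and the composite `H_n(A) → H_n(C)` is injective, then
`H_n(B) → H_n(C)` is injective. -/
theorem HomologyInj.of_surj {A B C : Set E} {n : ℕ} (hAB : A ⊆ B) (hBC : B ⊆ C)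
    (h₁ : HomologySurj k A B n) (h₂ : HomologyInj k A C n) : HomologyInj k B C n := by
  rintro z ⟨hz, hz'⟩
  obtain ⟨a, ha, b, hb, rfl⟩ := Submodule.mem_sup.1
    (h₁ ⟨hz, (boundariesIn_le_cyclesIn k _ _ hz').2⟩)
  refine add_mem (boundariesIn_mono k hAB n (h₂ ⟨ha.1, ?_⟩)) hb
  simpa using sub_mem hz' (boundariesIn_mono k hBC n hb)

/-- If `H_n(A) → H_n(C)` is surjective and `H_n(B) → H_n(C)` is injective, then
`H_n(A) → H_n(B)` is surjective. -/
theorem HomologySurj.of_inj {A B C : Set E} {n : ℕ} (hAB : A ⊆ B) (hBC : B ⊆ C)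
    (h₁ : HomologySurj k A C n) (h₂ : HomologyInj k B C n) : HomologySurj k A B n := by
  intro z hz
  obtain ⟨a, ha, b, hb, rfl⟩ := Submodule.mem_sup.1 (h₁ (cyclesIn_mono k hBC n hz))
  refine Submodule.add_mem_sup ha (h₂ ⟨?_, hb⟩)
  simpa using sub_mem hz.1 (chainsIn_mono k hAB n ha.1)

/-- A homotopy from the identity of `U` to a map into `A` that preserves `A`. -/
structure Deformation (A U : Set E) where
  toHomotopy : C(unitInterval × U, E)
  subset : A ⊆ U
  at_zero (u : U) : toHomotopy (0, u) = u
  mapsTo (t : unitInterval) (u : U) : toHomotopy (t, u) ∈ U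
  at_one (u : U) : toHomotopy (1, u) ∈ A
  mapsTo_sub (t : unitInterval) (u : U) (hu : u.1 ∈ A) : toHomotopy (t, u) ∈ A

variable {k}

theorem Deformation.homotopyAt_zero {A U : Set E} (h : Deformation A U) :
    homotopyAt h.toHomotopy 0 = ⟨Subtype.val, continuous_subtype_val⟩ :=
  ContinuousMap.ext h.at_zero

/-- The prism over a cycle joins it to its image at time one, which lies in `A`. The homotopy is
defined on the subspace `U` only, so the cycle is first regarded as a chain of `U`; it remains a
cycle there because pushing chains along an inclusion is injective. -/
theorem Deformation.homologySurj {A U : Set E} (h : Deformation A U) (n : ℕ) :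
    HomologySurj k A U n := by
  intro z hz
  obtain ⟨z', hz', rfl⟩ := exists_singPush_eq k subset_rfl hz.1
  have hinj := singPush_injective k (E := E) (Z := U)
    (f := ⟨Subtype.val, continuous_subtype_val⟩) Subtype.val_injective
  have h1 : singPush k (homotopyAt h.toHomotopy 1) n z' ∈ chainsIn k A n :=
    singPush_mem k (fun u _ => h.at_one u) hz'
  have h2 : singPrism k h.toHomotopy n z' ∈ chainsIn k U (n + 1) :=
    singPrism_mem k (fun t u _ => h.mapsTo t u) hz'
  cases n with
  | zero =>
    have h3 := singBoundary_singPrism_zero k h.toHomotopy z'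
    rw [h.homotopyAt_zero] at h3
    refine Submodule.mem_sup.2 ⟨_, (mem_cyclesIn_zero k).2 h1, _,
      neg_mem (Submodule.mem_map_of_mem h2), ?_⟩
    rw [h3]
    abel
  | succ n =>
    have h3 := singBoundary_singPrism k h.toHomotopy n z'
    have h4 := ((mem_cyclesIn_succ k).1 hz).2
    rw [singBoundary_singPush] at h4
    have h5 : singBoundary k U n z' = 0 :=
      hinj n (by rw [h4, map_zero])
    rw [h.homotopyAt_zero, h5, map_zero, sub_zero] at h3
    refine Submodule.mem_sup.2 ⟨_, (mem_cyclesIn_succ k).2 ⟨h1, ?_⟩, _,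
      neg_mem (Submodule.mem_map_of_mem h2), ?_⟩
    · rw [singBoundary_singPush, h5, map_zero]
    · rw [h3]
      abel

/-- If z in `A` bounds y in `U`, then the image of y at time one minus the prism over z has boundary
z. Both chains lie in `A`, since the homotopy preserves `A`. -/
theorem Deformation.homologyInj {A U : Set E} (h : Deformation A U) (n : ℕ) :
    HomologyInj k A U n := by
  rintro z ⟨hz, y, hy, hyz⟩
  obtain ⟨y', hy', rfl⟩ := exists_singPush_eq k subset_rfl hy
  obtain ⟨z', hz', hzz⟩ := exists_singPush_eq k h.subset hz
  have h0 : singBoundary k U n y' = z' := by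
    apply singPush_injective k (f := ⟨Subtype.val, continuous_subtype_val⟩) Subtype.val_injective n
    rw [← singBoundary_singPush]
    exact hyz.trans hzz.symm
  have h1 : singPush k (homotopyAt h.toHomotopy 1) (n + 1) y' ∈ chainsIn k A (n + 1) :=
    singPush_mem k (fun u _ => h.at_one u) hy'
  have h2 : singPrism k h.toHomotopy n z' ∈ chainsIn k A (n + 1) :=
    singPrism_mem k (fun t u hu => h.mapsTo_sub t u hu) hz'
  have h3 : singBoundary k E n (singPrism k h.toHomotopy n z') =
      singPush k (homotopyAt h.toHomotopy 1) n z' - z := by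
    rw [← hzz, ← h.homotopyAt_zero]
    cases n with
    | zero => exact singBoundary_singPrism_zero k h.toHomotopy z'
    | succ n =>
      rw [singBoundary_singPrism, ← h0, singBoundary_singBoundary, map_zero, sub_zero]
  refine ⟨_, sub_mem h1 h2, ?_⟩
  rw [map_sub, h3, singBoundary_singPush, h0, sub_sub_cancel]

end SubsetHomology

/-! ### Mayer–Vietoris -/

section MayerVietoris

variable (k : Type*) [Field k] {E : Type*} [TopologicalSpace E]

/-- The set `W` is the union of `U` and `V`, and every chain of `W` with small boundary is small up
to a boundary, where a chain is small if it is a sum of chains in `U` and in `V`. -/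
structure IsExcisive (U V W : Set E) : Prop where
  left : U ⊆ W
  right : V ⊆ W
  exists_small : ∀ n, ∀ c ∈ chainsIn k W n,
    c ∈ relCycles k (fun n => chainsIn k U n ⊔ chainsIn k V n) n →
    ∃ w ∈ chainsIn k W (n + 1), c - singBoundary k E n w ∈ chainsIn k U n ⊔ chainsIn k V n

theorem IsExcisive.of_isOpen {U V W U' V' : Set E} (hU' : IsOpen U') (hV' : IsOpen V')
    (hU : U = W ∩ U') (hV : V = W ∩ V') (hW : W ⊆ U ∪ V) : IsExcisive k U V W := by
  subst hU hV
  exact ⟨Set.inter_subset_left, Set.inter_subset_left, fun n c hc hc' =>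
    exists_sub_singBoundary_mem k hU' hV'
      (hW.trans (Set.union_subset_union Set.inter_subset_right Set.inter_subset_right)) hc hc'⟩

variable {k} {U V W : Set E}

theorem relCycles_mono {P Q : ∀ n, Submodule k (Chains k E (.mk n))} (h : ∀ n, P n ≤ Q n) (n : ℕ) :
    relCycles k P n ≤ relCycles k Q n := by
  cases n with
  | zero => exact le_rfl
  | succ n => exact Submodule.comap_mono (h n)

theorem IsExcisive.exists_add (h : IsExcisive k U V W) {n : ℕ} {z : Chains k E (.mk n)}
    (hz : z ∈ cyclesIn k W n) : ∃ u ∈ chainsIn k U n, ∃ v ∈ chainsIn k V n,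
      ∃ w ∈ chainsIn k W (n + 1), z = u + v + singBoundary k E n w := by
  obtain ⟨w, hw, h1⟩ := h.exists_small n z hz.1 (relCycles_mono (fun n => bot_le) n hz.2)
  obtain ⟨u, hu, v, hv, h2⟩ := Submodule.mem_sup.1 h1
  exact ⟨u, hu, v, hv, w, hw, by rw [h2, sub_add_cancel]⟩

/-- Split a cycle as u + v up to a boundary. Then ∂v = -∂u is a chain in the intersection that
bounds in `V`, hence it bounds some x in the intersection. Now u + x is a cycle of `U`, and the
cycle v - x of `V` is homologous to one in the intersection. -/
theorem HomologySurj.of_isExcisive (h : IsExcisive k U V W) {n : ℕ}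
    (hsurj : HomologySurj k (U ∩ V) V n) (hinj : ∀ j, j + 1 = n → HomologyInj k (U ∩ V) V j) :
    HomologySurj k U W n := by
  intro z hz
  obtain ⟨u, hu, v, hv, w, hw, rfl⟩ := h.exists_add hz
  have key : ∃ x ∈ chainsIn k (U ∩ V) n, v - x ∈ cyclesIn k V n ∧ u + x ∈ cyclesIn k U n := by
    cases n with
    | zero =>
      exact ⟨0, zero_mem _, by simpa [mem_cyclesIn_zero] using hv,
        by simpa [mem_cyclesIn_zero] using hu⟩
    | succ n =>
      have h1 := ((mem_cyclesIn_succ k).1 hz).2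
      rw [map_add, map_add, singBoundary_singBoundary, add_zero] at h1
      have h2 : singBoundary k E n v ∈ chainsIn k (U ∩ V) n := by
        rw [chainsIn_inter]
        refine ⟨?_, singBoundary_mem k hv⟩
        rw [eq_neg_of_add_eq_zero_right h1]
        exact neg_mem (singBoundary_mem k hu)
      obtain ⟨x, hx, hx'⟩ := hinj n rfl ⟨h2, Submodule.mem_map_of_mem hv⟩
      refine ⟨x, hx, (mem_cyclesIn_succ k).2
        ⟨sub_mem hv (chainsIn_mono k Set.inter_subset_right _ hx), ?_⟩,
        (mem_cyclesIn_succ k).2 ⟨add_mem hu (chainsIn_mono k Set.inter_subset_left _ hx), ?_⟩⟩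
      · rw [map_sub, hx', sub_self]
      · rw [map_add, hx', h1]
  obtain ⟨x, hx, hv', hu'⟩ := key
  obtain ⟨y, hy, b, hb, hyb⟩ := Submodule.mem_sup.1 (hsurj hv')
  refine Submodule.mem_sup.2 ⟨u + x + y,
    add_mem hu' (cyclesIn_mono k Set.inter_subset_left n hy), b + singBoundary k E n w,
    add_mem (boundariesIn_mono k h.right n hb) (Submodule.mem_map_of_mem hw), ?_⟩
  rw [eq_sub_iff_add_eq] at hyb
  rw [← hyb]
  abel

/-- A boundary in `W` of a chain with small boundary is the boundary of a small chain. -/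
theorem IsExcisive.exists_add_of_boundary (h : IsExcisive k U V W) {n : ℕ}
    {z : Chains k E (.mk n)} (hz : z ∈ chainsIn k U n) (hz' : z ∈ boundariesIn k W n) :
    ∃ u ∈ chainsIn k U (n + 1), ∃ v ∈ chainsIn k V (n + 1),
      z = singBoundary k E n u + singBoundary k E n v := by
  obtain ⟨y, hy, rfl⟩ := hz'
  obtain ⟨w, hw, h1⟩ := h.exists_small (n + 1) y hy (Submodule.mem_sup_left hz)
  obtain ⟨u, hu, v, hv, h2⟩ := Submodule.mem_sup.1 h1
  refine ⟨u, hu, v, hv, ?_⟩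
  rw [← map_add, h2, map_sub, singBoundary_singBoundary, sub_zero]

/-- If z = ∂u + ∂v lies in `U`, then ∂v lies in the intersection and bounds in `V`, so it already
bounds in the intersection. -/
theorem HomologyInj.of_isExcisive (h : IsExcisive k U V W) {n : ℕ}
    (hinj : HomologyInj k (U ∩ V) V n) : HomologyInj k U W n := by
  rintro z ⟨hz, hz'⟩
  obtain ⟨u, hu, v, hv, rfl⟩ := h.exists_add_of_boundary hz hz'
  refine add_mem (Submodule.mem_map_of_mem hu) (boundariesIn_mono k Set.inter_subset_left n
    (hinj ⟨?_, Submodule.mem_map_of_mem hv⟩))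
  rw [chainsIn_inter]
  refine ⟨?_, singBoundary_mem k hv⟩
  simpa using sub_mem hz (singBoundary_mem k hu)

end MayerVietoris

/-! ### Subsets in which all simplices are constant -/

section Discrete

variable (k : Type*) [Field k] {E : Type*} [TopologicalSpace E]

/-- All singular simplices in `A` are constant. -/
def HasConstantSimplices (A : Set E) : Prop :=
  ∀ (n : ℕ) (σ : Simplex E (.mk n)), (∀ x, σ x ∈ A) → ∀ x y, σ x = σ y

/-- The constant simplex at the image of the `0`-simplex `σ`. -/
def constSimplex (n : ℕ) (σ : Simplex E (.mk 0)) : Simplex E (.mk n) :=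
  ContinuousMap.const _ (σ (stdSimplex.vertex 0))

/-- The operator on chains that sends `0`-simplices to constant simplices. -/
def constChain (n : ℕ) : Chains k E (.mk 0) →ₗ[k] Chains k E (.mk n) :=
  Finsupp.lmapDomain k k (constSimplex n)

theorem constSimplex_injective (n : ℕ) : Function.Injective (constSimplex (E := E) n) := by
  intro σ τ h
  have h1 : σ (stdSimplex.vertex 0) = τ (stdSimplex.vertex 0) :=
    congrArg (fun ρ : Simplex E (.mk n) => ρ (stdSimplex.vertex 0)) h
  refine ContinuousMap.ext fun x => ?_
  have : Subsingleton (stdSimplex ℝ (Fin 1)) := by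
    refine ⟨fun a b => Subtype.ext (funext fun i => ?_)⟩
    have ha := a.2.2
    have hb := b.2.2
    simp only [Finset.univ_unique, Finset.sum_singleton] at ha hb
    rw [Subsingleton.elim i default, ha, hb]
  rw [Subsingleton.elim (α := stdSimplex ℝ (Fin 1)) x (stdSimplex.vertex 0)]
  exact h1

theorem constChain_injective (n : ℕ) : Function.Injective (constChain k (E := E) n) :=
  Finsupp.mapDomain_injective (constSimplex_injective n)

/-- All `n + 2` faces of a constant simplex agree, and their alternating signs sum to `0` or `1`
according to parity. The complex of constant simplices therefore has differentials alternating
between zero and the identity. -/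
theorem singBoundary_constChain (n : ℕ) (c : Chains k E (.mk 0)) :
    singBoundary k E n (constChain k (n + 1) c) =
      if Even n then 0 else constChain k n c := by
  induction c using Finsupp.induction_linear with
  | zero => simp
  | add f g hf hg => rw [map_add, map_add, hf, hg]; split_ifs <;> simp
  | single σ a =>
    have h (n) (a : k) :
        constChain k n (Finsupp.single σ a) = Finsupp.single (constSimplex n σ) a := by
      simp [constChain]
    rw [h, singBoundary_single]
    change ∑ i : Fin (n + 2), (-1 : ℤ) ^ (i : ℕ) • Finsupp.single (constSimplex n σ) a = _
    rw [← Finset.sum_smul, Fin.sum_neg_one_pow, h]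
    simp only [Nat.even_add, even_two, iff_true]
    split_ifs <;> simp

theorem HasConstantSimplices.exists_constChain {A : Set E} (hA : HasConstantSimplices A) {n : ℕ}
    {c : Chains k E (.mk n)} (hc : c ∈ chainsIn k A n) :
    ∃ c' ∈ chainsIn k A 0, constChain k n c' = c := by
  suffices h : chainsIn k A n ≤ (chainsIn k A 0).map (constChain k n) from h hc
  refine chainsIn_le k fun σ hσ => ?_
  refine ⟨Finsupp.single (ContinuousMap.const _ (σ (stdSimplex.vertex 0))) 1,
    single_mem_chainsIn k _ fun _ => hσ _, ?_⟩
  simp only [constChain, Finsupp.lmapDomain_apply, Finsupp.mapDomain_single]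
  congr 1
  exact ContinuousMap.ext fun x => hA n σ hσ _ _

theorem constChain_mem {A : Set E} {n : ℕ} {c : Chains k E (.mk 0)}
    (hc : c ∈ chainsIn k A 0) : constChain k n c ∈ chainsIn k A n := by
  suffices h : chainsIn k A 0 ≤ (chainsIn k A n).comap (constChain k n) from h hc
  refine chainsIn_le k fun σ hσ => ?_
  simp only [Submodule.mem_comap, constChain, Finsupp.lmapDomain_apply, Finsupp.mapDomain_single]
  exact single_mem_chainsIn k (σ := constSimplex n σ) _ fun x => hσ _

theorem HasConstantSimplices.boundariesIn_zero {A : Set E} (hA : HasConstantSimplices A) :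
    boundariesIn k A 0 = ⊥ := by
  rw [eq_bot_iff]
  rintro _ ⟨c, hc, rfl⟩
  obtain ⟨c', -, rfl⟩ := hA.exists_constChain k hc
  rw [Submodule.mem_bot, singBoundary_constChain, if_pos Even.zero]

theorem HasConstantSimplices.cyclesIn_succ_le {A : Set E} (hA : HasConstantSimplices A) (n : ℕ) :
    cyclesIn k A (n + 1) ≤ boundariesIn k A (n + 1) := by
  intro z hz
  obtain ⟨c', hc', rfl⟩ := hA.exists_constChain k hz.1
  by_cases hn : Even n
  · refine ⟨_, constChain_mem k hc', ?_⟩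
    rw [singBoundary_constChain, if_neg (by simpa [Nat.even_add_one] using hn)]
  · have h := ((mem_cyclesIn_succ k).1 hz).2
    rw [singBoundary_constChain, if_neg hn] at h
    rw [constChain_injective k n (h.trans (map_zero _).symm), map_zero]
    exact zero_mem _

end Discrete

/-! ### Finite generation of homology over the group ring -/

section FiniteGeneration

/-- Modulo `B`, the submodule `D` lies in a finitely generated module over a Noetherian ring, so its
image has finitely many generators. These lift to `D`, although `D` itself need not be finitely
generated. -/
theorem exists_fg_le_of_le_sup {R M : Type*} [CommRing R] [IsNoetherianRing R] [AddCommGroup M]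
    [Module R M] {D S B : Submodule R M} (hS : S.FG) (h : D ≤ S ⊔ B) :
    ∃ F : Set M, F.Finite ∧ F ⊆ D ∧ D ≤ Submodule.span R F ⊔ B := by
  have h1 : D.map B.mkQ ≤ S.map B.mkQ := by
    refine (Submodule.map_mono h).trans ?_
    rw [Submodule.map_sup, Submodule.mkQ_map_self, sup_bot_eq]
  obtain ⟨G, hG, hGD⟩ := Submodule.fg_def.1 ((hS.map B.mkQ).of_le h1)
  have h2 : ∀ x : G, ∃ y ∈ D, B.mkQ y = x := fun x =>
    (hGD ▸ Submodule.subset_span x.2 : (x : M ⧸ B) ∈ D.map B.mkQ)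
  choose g hg hg' using h2
  have : Finite G := hG
  refine ⟨Set.range g, Set.finite_range g, by rintro _ ⟨x, rfl⟩; exact hg x, fun x hx => ?_⟩
  have h3 : (Submodule.span R (Set.range g)).map B.mkQ = D.map B.mkQ := by
    rw [Submodule.map_span, ← Set.range_comp, ← hGD]
    congr 1
    ext y
    constructor
    · rintro ⟨x, rfl⟩
      rw [Function.comp_apply, hg']
      exact x.2
    · exact fun hy => ⟨⟨y, hy⟩, hg' _⟩
  obtain ⟨y, hy, hyx⟩ := h3.symm ▸ Submodule.mem_map_of_mem hx
  refine Submodule.mem_sup.2 ⟨y, hy, x - y, ?_, add_sub_cancel _ _⟩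
  rw [← Submodule.ker_mkQ B, LinearMap.mem_ker, map_sub, hyx, sub_self]

/-- Lifting the intersection of two submodules of boundaries, modulo the boundaries of a common
submodule: the algebra of the Mayer–Vietoris connecting map. -/
theorem exists_finite_of_map_inf_map_le {R M₁ M₀ : Type*} [CommRing R] [IsNoetherianRing R]
    [AddCommGroup M₁] [AddCommGroup M₀] [Module R M₁] [Module R M₀] (d : M₁ →ₗ[R] M₀)
    {CU CV CI : Submodule R M₁} (hIU : CI ≤ CU) (hIV : CI ≤ CV) {S : Submodule R M₀} (hS : S.FG)
    (h : CU.map d ⊓ CV.map d ≤ S ⊔ CI.map d) :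
    ∃ F : Set M₁, F.Finite ∧ (∀ f ∈ F, ∃ u ∈ CU, ∃ v ∈ CV, f = v - u ∧ d f = 0) ∧
      ∀ u ∈ CU, ∀ v ∈ CV, d u + d v = 0 → ∃ u' ∈ CU, ∃ v' ∈ CV, ∃ y ∈ Submodule.span R F,
        d u' = 0 ∧ d v' = 0 ∧ u + v = u' + v' + y := by
  obtain ⟨F, hF, hFD, hDF⟩ := exists_fg_le_of_le_sup hS h
  choose u hu hux using fun x : F => (hFD x.2).1
  choose v hv hvx using fun x : F => (hFD x.2).2
  have : Finite F := hF
  -- The liftings chosen on the generators extend to their span in such a way that the difference of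
  -- the two lifts stays in the span of the finite set sought.
  have hlift : ∀ y ∈ Submodule.span R F, ∃ a ∈ CU, ∃ b ∈ CV, d a = y ∧ d b = y ∧
      b - a ∈ Submodule.span R (Set.range fun x : F => v x - u x) := by
    intro y hy
    induction hy using Submodule.span_induction with
    | mem x hx =>
      exact ⟨u ⟨x, hx⟩, hu _, v ⟨x, hx⟩, hv _, hux _, hvx _,
        Submodule.subset_span ⟨⟨x, hx⟩, rfl⟩⟩
    | zero => exact ⟨0, zero_mem _, 0, zero_mem _, map_zero _, map_zero _, by
        rw [sub_zero]; exact zero_mem _⟩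
    | add x y _ _ hx hy =>
      obtain ⟨a, ha, b, hb, h1, h2, h3⟩ := hx
      obtain ⟨a', ha', b', hb', h1', h2', h3'⟩ := hy
      refine ⟨a + a', add_mem ha ha', b + b', add_mem hb hb', by rw [map_add, h1, h1'],
        by rw [map_add, h2, h2'], ?_⟩
      rw [add_sub_add_comm]
      exact add_mem h3 h3'
    | smul r x _ hx =>
      obtain ⟨a, ha, b, hb, h1, h2, h3⟩ := hx
      refine ⟨r • a, Submodule.smul_mem _ _ ha, r • b, Submodule.smul_mem _ _ hb,
        by rw [map_smul, h1], by rw [map_smul, h2], ?_⟩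
      rw [← smul_sub]
      exact Submodule.smul_mem _ _ h3
  refine ⟨_, Set.finite_range fun x : F => v x - u x, ?_, fun a ha b hb hab => ?_⟩
  · rintro _ ⟨x, rfl⟩
    exact ⟨u x, hu x, v x, hv x, rfl, by rw [map_sub, hux, hvx, sub_self]⟩
  · have h2 : d b ∈ CU.map d ⊓ CV.map d :=
      ⟨⟨-a, neg_mem ha, by rw [map_neg, eq_neg_of_add_eq_zero_right hab]⟩, ⟨b, hb, rfl⟩⟩
    obtain ⟨y, hy, w', ⟨w, hw, rfl⟩, hyw⟩ := Submodule.mem_sup.1 (hDF h2)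
    obtain ⟨c, hc, e, he, hcy, hey, hce⟩ := hlift y hy
    -- The boundary of `b` is `y + d w`, while `c` and `e` both have boundary `y`. Shifting `c + w`
    -- into the first chain and taking `e + w` out of the second makes both cycles; the error `e -
    -- c` is a combination of the finite set.
    refine ⟨a + c + w, add_mem (add_mem ha hc) (hIU hw), b - e - w,
      sub_mem (sub_mem hb he) (hIV hw), e - c, hce, ?_, ?_, by abel⟩
    · rw [map_add, map_add, add_assoc, hcy, hyw, hab]
    · rw [map_sub, map_sub, hey, ← hyw]
      abel

variable (k : Type*) [Field k] (H : Type*) [CommGroup H] {E : Type*} [TopologicalSpace E]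
  [MulAction H E] [ContinuousConstSMul H E]

/-- Singular chains as a module over the group ring. -/
abbrev EqChains (E : Type*) [TopologicalSpace E] [MulAction H E] [ContinuousConstSMul H E]
    (n : ℕ) := (chainRep k H E (.mk n)).asModule

variable {k H} in
theorem singBoundary_chainRep (n : ℕ) (h : H) (c : Chains k E (.mk (n + 1))) :
    singBoundary k E n (chainRep k H E _ h c) = chainRep k H E _ h (singBoundary k E n c) := by
  simp only [singBoundary, LinearMap.sum_apply, LinearMap.smul_apply, chainRep_pull, map_sum,
    map_zsmul]

/-- The boundary map as a linear map over the group ring. -/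
def eqBoundary (E : Type*) [TopologicalSpace E] [MulAction H E] [ContinuousConstSMul H E] (n : ℕ) :
    EqChains k H E (n + 1) →ₗ[MonoidAlgebra k H] EqChains k H E n :=
  Representation.IntertwiningMap.equivLinearMapAsModule _ _
    ((singBoundary k E n).intertwiningMap_of_isIntertwiningMap (chainRep k H E _)
      (chainRep k H E _) (singBoundary_chainRep n))

/-- The chains in an invariant subset, as a submodule over the group ring. -/
def eqChainsIn {A : Set E} (hA : ∀ (h : H), ∀ x ∈ A, h • x ∈ A) (n : ℕ) :
    Submodule (MonoidAlgebra k H) (EqChains k H E n) :=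
  Subrepresentation.asSubmodule ⟨chainsIn k A n, fun h c hc => by
    suffices h' : chainsIn k A n ≤ (chainsIn k A n).comap (chainRep k H E _ h) from h' hc
    refine chainsIn_le k fun σ hσ => ?_
    rw [Submodule.mem_comap]
    change Finsupp.mapDomain _ _ ∈ _
    rw [Finsupp.mapDomain_single]
    exact single_mem_chainsIn k (σ := h • σ) _ fun x => hA h _ (hσ x)⟩

/-- The span of a set of chains over the group ring, as a vector space. -/
def eqSpan {n : ℕ} (F : Set (Chains k E (.mk n))) : Submodule k (Chains k E (.mk n)) where
  carrier := {c | @Membership.mem (EqChains k H E n) _ _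
    (Submodule.span (M := EqChains k H E n) (MonoidAlgebra k H) F) c}
  zero_mem' := zero_mem (Submodule.span (M := EqChains k H E n) (MonoidAlgebra k H) F)
  add_mem' ha hb := Submodule.add_mem (M := EqChains k H E n)
    (Submodule.span (M := EqChains k H E n) (MonoidAlgebra k H) F) ha hb
  smul_mem' a c hc := by
    have h := Submodule.smul_mem (M := EqChains k H E n)
      (Submodule.span (M := EqChains k H E n) (MonoidAlgebra k H) F)
      (MonoidAlgebra.single (1 : H) a) hc
    have e := Representation.single_smul (chainRep k H E (.mk n)) a 1 c
    rw [map_one] at e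
    exact Eq.subst (motive := fun x : EqChains k H E n => x ∈ Submodule.span _ _) e h

theorem eqSpan_mono {n : ℕ} {F G : Set (Chains k E (.mk n))} (h : F ⊆ G) :
    eqSpan k H F ≤ eqSpan k H G :=
  Submodule.span_mono (M := EqChains k H E n) (R := MonoidAlgebra k H) h

theorem chainRep_mem_eqSpan {n : ℕ} {F : Set (Chains k E (.mk n))} (h : H)
    {c : Chains k E (.mk n)} (hc : c ∈ eqSpan k H F) : chainRep k H E _ h c ∈ eqSpan k H F := by
  have h' := Submodule.smul_mem (M := EqChains k H E n)
    (Submodule.span (M := EqChains k H E n) (MonoidAlgebra k H) F)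
    (MonoidAlgebra.single h (1 : k)) hc
  have e := Representation.single_smul (chainRep k H E (.mk n)) 1 h c
  rw [one_smul] at e
  exact Eq.subst (motive := fun x : EqChains k H E n => x ∈ Submodule.span _ _) e h'

theorem subset_eqSpan {n : ℕ} {F : Set (Chains k E (.mk n))} {c : Chains k E (.mk n)}
    (hc : c ∈ F) : c ∈ eqSpan k H F :=
  Submodule.subset_span (M := EqChains k H E n) (R := MonoidAlgebra k H) hc

theorem chainRep_single (n : ℕ) (h : H) (σ : Simplex E (.mk n)) (a : k) :
    chainRep k H E _ h (Finsupp.single σ a) = Finsupp.single (h • σ) a :=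
  Finsupp.mapDomain_single

/-- The homology `H_n(A)` is finitely generated over the group ring. -/
def HomologyFG (A : Set E) (n : ℕ) : Prop :=
  ∃ F : Set (Chains k E (.mk n)), F.Finite ∧ F ⊆ cyclesIn k A n ∧ ∀ z ∈ cyclesIn k A n,
    ∃ y : Chains k E (.mk n),
      y ∈ eqSpan k H F ∧
      z - y ∈ boundariesIn k A n

variable {k H}

theorem HomologyFG.of_surj {A B : Set E} {n : ℕ} (hAB : A ⊆ B) (hs : HomologySurj k A B n)
    (h : HomologyFG k H A n) : HomologyFG k H B n := by
  obtain ⟨F, hF, hFA, hFz⟩ := h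
  refine ⟨F, hF, hFA.trans (cyclesIn_mono k hAB n), fun z hz => ?_⟩
  obtain ⟨a, ha, b, hb, rfl⟩ := Submodule.mem_sup.1 (hs hz)
  obtain ⟨y, hy, hy'⟩ := hFz a ha
  refine ⟨y, hy, ?_⟩
  rw [add_sub_right_comm]
  exact add_mem (boundariesIn_mono k hAB n hy') hb

theorem HomologyFG.empty (n : ℕ) : HomologyFG k H (∅ : Set E) n := by
  refine ⟨∅, Set.finite_empty, Set.empty_subset _, fun z hz => ⟨0, zero_mem _, ?_⟩⟩
  have h : chainsIn k (∅ : Set E) n ≤ ⊥ :=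
    chainsIn_le k fun σ hσ => (hσ (stdSimplex.vertex 0)).elim
  rw [(Submodule.mem_bot k).1 (h hz.1), sub_zero]
  exact zero_mem _

theorem HasConstantSimplices.homologyFG_succ {A : Set E} (hA : HasConstantSimplices A) (n : ℕ) :
    HomologyFG k H A (n + 1) :=
  ⟨∅, Set.finite_empty, Set.empty_subset _, fun z hz => ⟨0, zero_mem _, by
    rw [sub_zero]; exact hA.cyclesIn_succ_le k n hz⟩⟩

/-- The `0`-chains on a single orbit are generated over the group ring by one point. -/
theorem homologyFG_zero_of_orbit {A : Set E} (y : E) (hA : A = MulAction.orbit H y) :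
    HomologyFG k H A 0 := by
  let σ₀ : Simplex E (.mk 0) := ContinuousMap.const _ y
  refine ⟨{Finsupp.single σ₀ 1}, Set.finite_singleton _, ?_, fun z hz => ⟨z, ?_, ?_⟩⟩
  · rw [Set.singleton_subset_iff]
    exact (mem_cyclesIn_zero k).2 (single_mem_chainsIn k _ fun _ => hA ▸ MulAction.mem_orbit_self y)
  · have h1 : chainsIn k A 0 ≤ eqSpan k H {Finsupp.single σ₀ 1} := by
      refine chainsIn_le k fun σ hσ => ?_
      have h2 := hσ (stdSimplex.vertex 0)
      rw [hA] at h2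
      obtain ⟨h, hh⟩ := h2
      have h3 : σ = h • σ₀ := constSimplex_injective 0 (ContinuousMap.ext fun x => hh.symm)
      rw [h3, ← chainRep_single]
      exact chainRep_mem_eqSpan k H h (subset_eqSpan k H rfl)
    exact h1 ((mem_cyclesIn_zero k).1 hz)
  · rw [sub_self]
    exact zero_mem _

/-- A chain that is a boundary both from `U` and from `V` is a cycle of the intersection, whose
homology is finitely generated. This supplies the hypothesis of the algebraic lifting lemma. -/
theorem exists_finite_lift [IsNoetherianRing (MonoidAlgebra k H)] {U V : Set E}
    (hU : ∀ (h : H), ∀ x ∈ U, h • x ∈ U) (hV : ∀ (h : H), ∀ x ∈ V, h • x ∈ V) {n : ℕ}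
    (hUV : HomologyFG k H (U ∩ V) n) :
    ∃ F : Set (Chains k E (.mk (n + 1))), F.Finite ∧
      (∀ f ∈ F, ∃ u ∈ chainsIn k U (n + 1), ∃ v ∈ chainsIn k V (n + 1), f = v - u ∧
        singBoundary k E n f = 0) ∧
      ∀ u ∈ chainsIn k U (n + 1), ∀ v ∈ chainsIn k V (n + 1),
        singBoundary k E n u + singBoundary k E n v = 0 →
        ∃ u' ∈ chainsIn k U (n + 1), ∃ v' ∈ chainsIn k V (n + 1), ∃ y ∈ eqSpan k H F,
          singBoundary k E n u' = 0 ∧ singBoundary k E n v' = 0 ∧ u + v = u' + v' + y := by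
  have hUVi : ∀ (h : H), ∀ x ∈ U ∩ V, h • x ∈ U ∩ V := fun h x hx => ⟨hU h x hx.1, hV h x hx.2⟩
  obtain ⟨G, hG, hGc, hGz⟩ := hUV
  refine exists_finite_of_map_inf_map_le (M₁ := EqChains k H E (n + 1))
    (M₀ := EqChains k H E n) (eqBoundary k H E n)
    (CI := eqChainsIn k H hUVi (n + 1)) (CU := eqChainsIn k H hU (n + 1))
    (CV := eqChainsIn k H hV (n + 1))
    (fun c hc => chainsIn_mono k Set.inter_subset_left _ hc)
    (fun c hc => chainsIn_mono k Set.inter_subset_right _ hc)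
    (S := Submodule.span (M := EqChains k H E n) (MonoidAlgebra k H) G)
    (Submodule.fg_span (M := EqChains k H E n) hG) ?_
  rintro x ⟨⟨u, hu, rfl⟩, ⟨v, hv, hvx⟩⟩
  have hc : singBoundary k E n u ∈ cyclesIn k (U ∩ V) n := by
    refine ⟨?_, boundary_mem_relCycles k _ n u⟩
    rw [chainsIn_inter]
    refine ⟨singBoundary_mem k hu, ?_⟩
    have : singBoundary k E n v = singBoundary k E n u := hvx
    rw [SetLike.mem_coe, ← this]
    exact singBoundary_mem k hv
  obtain ⟨y, hy, w, hw, hyw⟩ := hGz _ hc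
  refine Submodule.mem_sup.2 ⟨y, hy, eqBoundary k H E n w, Submodule.mem_map_of_mem hw, ?_⟩
  change y + singBoundary k E n w = singBoundary k E n u
  rw [hyw, add_sub_cancel]

theorem IsExcisive.exists_finite_lift [IsNoetherianRing (MonoidAlgebra k H)] {U V W : Set E}
    (h : IsExcisive k U V W) (hU : ∀ (h : H), ∀ x ∈ U, h • x ∈ U)
    (hV : ∀ (h : H), ∀ x ∈ V, h • x ∈ V) {n : ℕ}
    (hUV : ∀ j, j + 1 = n → HomologyFG k H (U ∩ V) j) :
    ∃ F : Set (Chains k E (.mk n)), F.Finite ∧ F ⊆ cyclesIn k W n ∧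
      ∀ u ∈ chainsIn k U n, ∀ v ∈ chainsIn k V n, u + v ∈ cyclesIn k W n →
      ∃ u' ∈ cyclesIn k U n, ∃ v' ∈ cyclesIn k V n, ∃ y ∈ eqSpan k H F, u + v = u' + v' + y := by
  cases n with
  | zero =>
    exact ⟨∅, Set.finite_empty, Set.empty_subset _, fun u hu v hv _ =>
      ⟨u, (mem_cyclesIn_zero k).2 hu, v, (mem_cyclesIn_zero k).2 hv, 0, zero_mem _,
        (add_zero _).symm⟩⟩
  | succ n =>
    obtain ⟨F, hF, hFc, hFz⟩ := JumpLoci.exists_finite_lift hU hV (hUV n rfl)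
    refine ⟨F, hF, fun f hf => ?_, fun u hu v hv huv => ?_⟩
    · obtain ⟨u, hu, v, hv, rfl, hf0⟩ := hFc f hf
      exact (mem_cyclesIn_succ k).2 ⟨sub_mem (chainsIn_mono k h.right _ hv)
        (chainsIn_mono k h.left _ hu), hf0⟩
    · have h1 := ((mem_cyclesIn_succ k).1 huv).2
      rw [map_add] at h1
      obtain ⟨u', hu', v', hv', y, hy, hu0, hv0, huv'⟩ := hFz u hu v hv h1
      exact ⟨u', (mem_cyclesIn_succ k).2 ⟨hu', hu0⟩, v', (mem_cyclesIn_succ k).2 ⟨hv', hv0⟩,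
        y, hy, huv'⟩

/-- The middle of the Mayer–Vietoris sequence: generators come from H_n(U), from H_n(V) and from
lifts of the image of the connecting map. That image lies in a finitely generated module, and the
Noetherian hypothesis makes it finitely generated. -/
theorem HomologyFG.of_isExcisive [IsNoetherianRing (MonoidAlgebra k H)] {U V W : Set E}
    (h : IsExcisive k U V W) (hU : ∀ (h : H), ∀ x ∈ U, h • x ∈ U)
    (hV : ∀ (h : H), ∀ x ∈ V, h • x ∈ V) {n : ℕ} (hUfg : HomologyFG k H U n)
    (hVfg : HomologyFG k H V n) (hUV : ∀ j, j + 1 = n → HomologyFG k H (U ∩ V) j) :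
    HomologyFG k H W n := by
  obtain ⟨F, hF, hFc, hFz⟩ := h.exists_finite_lift hU hV hUV
  obtain ⟨F₁, hF₁, hFc₁, hFz₁⟩ := hUfg
  obtain ⟨F₂, hF₂, hFc₂, hFz₂⟩ := hVfg
  refine ⟨F₁ ∪ F₂ ∪ F, (hF₁.union hF₂).union hF, Set.union_subset (Set.union_subset
    (hFc₁.trans (cyclesIn_mono k h.left n)) (hFc₂.trans (cyclesIn_mono k h.right n))) hFc,
    fun z hz => ?_⟩
  obtain ⟨u, hu, v, hv, w, hw, rfl⟩ := h.exists_add hz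
  have huv : u + v ∈ cyclesIn k W n := by
    simpa using sub_mem hz (boundariesIn_le_cyclesIn k W n (Submodule.mem_map_of_mem hw))
  obtain ⟨u', hu', v', hv', y, hy, huvy⟩ := hFz u hu v hv huv
  obtain ⟨y₁, hy₁, hb₁⟩ := hFz₁ u' hu'
  obtain ⟨y₂, hy₂, hb₂⟩ := hFz₂ v' hv'
  refine ⟨y₁ + y₂ + y, ?_, ?_⟩
  · exact add_mem (add_mem
      (eqSpan_mono k H (Set.subset_union_left.trans Set.subset_union_left) hy₁)
      (eqSpan_mono k H (Set.subset_union_right.trans Set.subset_union_left) hy₂))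
      (eqSpan_mono k H Set.subset_union_right hy)
  · rw [huvy]
    convert add_mem (add_mem (boundariesIn_mono k h.left n hb₁) (boundariesIn_mono k h.right n hb₂))
      (Submodule.mem_map_of_mem hw : singBoundary k E n w ∈ boundariesIn k W n) using 1
    abel

end FiniteGeneration

/-! ### Subsets of a covering space -/

section Lifting

variable {X Y : Type*} [TopologicalSpace X] [TopologicalSpace Y] {q : Y → X}

/-- The lift of a deformation to a covering space. -/
def Deformation.lift (hq : IsCoveringMap q) {A U : Set X} (h : Deformation A U) :
    Deformation (q ⁻¹' A) (q ⁻¹' U) :=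
  let r : C(unitInterval × (q ⁻¹' U), X) := h.toHomotopy.comp
    ⟨fun z => (z.1, ⟨q z.2, z.2.2⟩), by
      have := hq.continuous
      fun_prop⟩
  have hr : ∀ u : q ⁻¹' U, r (0, u) = q u := fun u => h.at_zero _
  have hl : ∀ z, q (hq.liftHomotopy r ⟨Subtype.val, continuous_subtype_val⟩ hr z) = r z :=
    fun z => congrFun (hq.liftHomotopy_lifts r ⟨Subtype.val, continuous_subtype_val⟩ hr) z
  { toHomotopy := hq.liftHomotopy r ⟨Subtype.val, continuous_subtype_val⟩ hr
    subset := Set.preimage_mono h.subset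
    at_zero := fun u => hq.liftHomotopy_zero _ _ _ u
    mapsTo := fun t u => by
      rw [Set.mem_preimage, hl]
      exact h.mapsTo _ _
    at_one := fun u => by
      rw [Set.mem_preimage, hl]
      exact h.at_one _
    mapsTo_sub := fun t u hu => by
      rw [Set.mem_preimage, hl]
      exact h.mapsTo_sub _ _ hu }

/-- A simplex over a point lifts a constant map, and lifts from a connected space are unique. -/
theorem hasConstantSimplices_fiber (hq : IsCoveringMap q) (x : X) :
    HasConstantSimplices (q ⁻¹' {x}) := by
  intro n σ hσ a b
  have : PreconnectedSpace (stdSimplex ℝ (Fin (n + 1))) :=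
    Subtype.preconnectedSpace (convex_stdSimplex ℝ _).isPreconnected
  exact hq.const_of_comp (A := stdSimplex ℝ (Fin (n + 1))) σ.continuous
    (fun a b => (hσ a).trans (hσ b).symm) a b

theorem fiber_eq_orbit {H : Type*} [Group H] [MulAction H Y]
    (hq : IsQuotientCoveringMap q H) (y : Y) : q ⁻¹' {q y} = MulAction.orbit H y := by
  ext z
  exact hq.apply_eq_iff_mem_orbit

theorem homologyFG_fiber (k : Type*) [Field k] {H : Type*} [CommGroup H] [MulAction H Y]
    [ContinuousConstSMul H Y] (hq : IsQuotientCoveringMap q H) (x : X) (n : ℕ) :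
    HomologyFG k H (q ⁻¹' {x}) n := by
  cases n with
  | zero =>
    obtain ⟨y, rfl⟩ := hq.surjective x
    exact homologyFG_zero_of_orbit y (fiber_eq_orbit hq y)
  | succ n => exact (hasConstantSimplices_fiber hq.isCoveringMap x).homologyFG_succ n

theorem preimage_invariant {H : Type*} [Group H] [MulAction H Y]
    (hq : IsQuotientCoveringMap q H) (A : Set X) (h : H) : ∀ x ∈ q ⁻¹' A, h • x ∈ q ⁻¹' A := by
  intro x hx
  have : q (h • x) = q x := hq.apply_eq_iff_mem_orbit.2 ⟨h, rfl⟩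
  rwa [Set.mem_preimage, this]

theorem IsExcisive.preimage (k : Type*) [Field k] (hq : Continuous q) {U V W U' V' : Set X}
    (hU' : IsOpen U') (hV' : IsOpen V') (hU : U = W ∩ U') (hV : V = W ∩ V') (hW : W ⊆ U ∪ V) :
    IsExcisive k (q ⁻¹' U) (q ⁻¹' V) (q ⁻¹' W) :=
  IsExcisive.of_isOpen k (hU'.preimage hq) (hV'.preimage hq) (by rw [hU, Set.preimage_inter])
    (by rw [hV, Set.preimage_inter]) (by rw [← Set.preimage_union]; exact Set.preimage_mono hW)

end Lifting

/-! ### The homology of an open cell and of the open cell without its center -/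

section Cell

variable {X : Type*} [TopologicalSpace X] {N : ℕ} {g : (Fin N → ℝ) → X}

/-- The image of a star-shaped set under an embedding deforms to a point. -/
def Deformation.ofStarConvex (hg : Topology.IsEmbedding g) {c : Fin N → ℝ} {P : Set (Fin N → ℝ)}
    (hc : c ∈ P) (hP : StarConvex ℝ c P) : Deformation {g c} (g '' P) :=
  let inv : C(g '' P, Fin N → ℝ) := ⟨fun y => hg.toHomeomorph.symm
    ⟨y, Set.image_subset_range _ _ y.2⟩, by fun_prop⟩
  have hinv : ∀ y : g '' P, g (inv y) = y := fun y => by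
    have h := hg.toHomeomorph.apply_symm_apply ⟨y, Set.image_subset_range _ _ y.2⟩
    exact congrArg Subtype.val h
  have hinvP : ∀ y : g '' P, inv y ∈ P := fun y => by
    obtain ⟨x, hx, hxy⟩ := y.2
    rwa [← hg.injective (hxy.trans (hinv y).symm)]
  { toHomotopy := ⟨fun z => g ((1 - (z.1 : ℝ)) • inv z.2 + (z.1 : ℝ) • c), by
      have := hg.continuous
      fun_prop⟩
    subset := by
      rintro _ rfl
      exact Set.mem_image_of_mem g hc
    at_zero := fun u => by simp [hinv]
    mapsTo := fun t u => by
      refine Set.mem_image_of_mem g ?_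
      rw [add_comm]
      exact hP (hinvP u) t.2.1 (sub_nonneg.2 t.2.2) (by ring)
    at_one := fun u => by simp
    mapsTo_sub := fun t u hu => by
      have : inv u = c := hg.injective ((hinv u).trans hu)
      simp [this, ← add_smul] }

/-- The points of `ℝ^N` some coordinate of which among the first `j` does not vanish. -/
def nonzeroBefore (N j : ℕ) : Set (Fin N → ℝ) := {x | ∃ i : Fin N, i.1 < j ∧ x i ≠ 0}

/-- The points of `ℝ^N` some coordinate of which among the first `j` does not vanish or such
that the `j`-th coordinate has the sign `s`. -/
def nonzeroBeforeOr (s : ℝ) (j : Fin N) : Set (Fin N → ℝ) := nonzeroBefore N j ∪ {x | 0 < s * x j}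

theorem isOpen_nonzeroBefore (j : ℕ) : IsOpen (nonzeroBefore N j) := by
  have : nonzeroBefore N j = ⋃ (i : Fin N) (_ : i.1 < j), {x | x i ≠ 0} := by
    ext x
    simp [nonzeroBefore]
  rw [this]
  exact isOpen_iUnion fun i => isOpen_iUnion fun _ => isOpen_ne_fun (by fun_prop) (by fun_prop)

theorem isOpen_nonzeroBeforeOr (s : ℝ) (j : Fin N) : IsOpen (nonzeroBeforeOr s j) :=
  (isOpen_nonzeroBefore _).union (isOpen_lt (by fun_prop) (by fun_prop))

theorem nonzeroBefore_zero : nonzeroBefore N 0 = ∅ := by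
  ext x
  simp [nonzeroBefore]

theorem nonzeroBefore_self : nonzeroBefore N N = {0}ᶜ := by
  ext x
  simp [nonzeroBefore, funext_iff]

theorem nonzeroBefore_subset_or (s : ℝ) (j : Fin N) : nonzeroBefore N j ⊆ nonzeroBeforeOr s j :=
  Set.subset_union_left

/-- Open version of the two hemispheres of a sphere: `nonzeroBefore N j` plays the role of the
sphere of dimension `j - 1`. The two halves meet in it, and their union is the next sphere. -/
theorem nonzeroBeforeOr_inter (j : Fin N) :
    nonzeroBeforeOr 1 j ∩ nonzeroBeforeOr (-1) j = nonzeroBefore N j := by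
  rw [nonzeroBeforeOr, nonzeroBeforeOr, ← Set.union_inter_distrib_left, Set.union_eq_left]
  rintro x ⟨h1, h2⟩
  simp only [Set.mem_ofPred_eq] at h1 h2
  linarith

theorem nonzeroBeforeOr_union (j : Fin N) :
    nonzeroBeforeOr 1 j ∪ nonzeroBeforeOr (-1) j = nonzeroBefore N (j + 1) := by
  ext x
  constructor
  · rintro ((⟨i, hi, h⟩ | h) | (⟨i, hi, h⟩ | h))
    · exact ⟨i, by omega, h⟩
    · exact ⟨j, by omega, fun h' => by simp [h'] at h⟩
    · exact ⟨i, by omega, h⟩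
    · exact ⟨j, by omega, fun h' => by simp [h'] at h⟩
  · rintro ⟨i, hi, h⟩
    rcases Nat.lt_succ_iff_lt_or_eq.1 hi with hi | hi
    · exact Or.inl (Or.inl ⟨i, hi, h⟩)
    · obtain rfl := Fin.ext hi
      rcases lt_or_gt_of_ne h with h | h
      · exact Or.inr (Or.inr (by simpa using h))
      · exact Or.inl (Or.inr (by simpa using h))

theorem single_mem_nonzeroBeforeOr {s : ℝ} (hs : s ≠ 0) (j : Fin N) :
    (Pi.single j s : Fin N → ℝ) ∈ nonzeroBeforeOr s j :=
  Or.inr (by simpa using hs)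

/-- Short of the end point, moving towards the `j`-th axis rescales the earlier coordinates by a
positive factor and preserves the sign `s` of the `j`-th one. -/
theorem starConvex_nonzeroBeforeOr {s : ℝ} (hs : s ≠ 0) (j : Fin N) :
    StarConvex ℝ (Pi.single j s : Fin N → ℝ) (nonzeroBeforeOr s j) := by
  intro x hx a b ha hb hab
  rcases hb.eq_or_lt with rfl | hb
  · obtain rfl : a = 1 := by linarith
    simpa using single_mem_nonzeroBeforeOr hs j
  · rcases hx with ⟨i, hi, h⟩ | h
    · refine Or.inl ⟨i, hi, ?_⟩
      have hij : i ≠ j := fun h => by subst h; exact lt_irrefl _ hi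
      simp [hij, hb.ne', h]
    · refine Or.inr ?_
      have h1 : 0 < s * s := mul_self_pos.2 hs
      simp only [Set.mem_ofPred_eq, Pi.add_apply, Pi.smul_apply, Pi.single_eq_same, smul_eq_mul] at h ⊢
      nlinarith [mul_pos hb h, mul_nonneg ha h1.le]

variable (k : Type*) [Field k] {Y : Type*} [TopologicalSpace Y] {q : Y → X}

theorem starConvex_homologySurj (hq : IsCoveringMap q) (hg : Topology.IsEmbedding g)
    {c : Fin N → ℝ} {P : Set (Fin N → ℝ)} (hc : c ∈ P) (hP : StarConvex ℝ c P) (n : ℕ) :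
    HomologySurj k (q ⁻¹' {g c}) (q ⁻¹' (g '' P)) n :=
  ((Deformation.ofStarConvex hg hc hP).lift hq).homologySurj n

/-- Both sets deform to the same fibre, the one over `g c`. -/
theorem starConvex_homologyInj (hq : IsCoveringMap q) (hg : Topology.IsEmbedding g)
    {c : Fin N → ℝ} {P Q : Set (Fin N → ℝ)} (hc : c ∈ P) (hP : StarConvex ℝ c P) (hPQ : P ⊆ Q)
    (hQ : StarConvex ℝ c Q) (n : ℕ) :
    HomologyInj k (q ⁻¹' (g '' P)) (q ⁻¹' (g '' Q)) n :=
  HomologyInj.of_surj k (Set.preimage_mono (Set.singleton_subset_iff.2 (Set.mem_image_of_mem g hc)))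
    (Set.preimage_mono (Set.image_mono hPQ)) (starConvex_homologySurj k hq hg hc hP n)
    (((Deformation.ofStarConvex hg (hPQ hc) hQ).lift hq).homologyInj n)

theorem isExcisive_image (hq : Continuous q) (hg : Topology.IsEmbedding g)
    {P Q : Set (Fin N → ℝ)} (hP : IsOpen P) (hQ : IsOpen Q) :
    IsExcisive k (q ⁻¹' (g '' P)) (q ⁻¹' (g '' Q)) (q ⁻¹' (g '' (P ∪ Q))) := by
  obtain ⟨U, hU, rfl⟩ := hg.isInducing.isOpen_iff.1 hP
  obtain ⟨V, hV, rfl⟩ := hg.isInducing.isOpen_iff.1 hQ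
  refine IsExcisive.preimage k hq hU hV ?_ ?_ (Set.image_union _ _ _).subset
  · rw [← Set.image_inter_preimage, Set.union_inter_cancel_left]
  · rw [← Set.image_inter_preimage, Set.union_inter_cancel_right]

/-- The whole space is star-shaped about a basis vector, which already lies in the smaller set; the
fibre over that one point suffices. -/
theorem homologySurj_nonzeroBefore (hq : IsCoveringMap q) (hg : Topology.IsEmbedding g) {j : ℕ}
    (hj : 0 < j) (hjN : j ≤ N) (n : ℕ) :
    HomologySurj k (q ⁻¹' (g '' nonzeroBefore N j)) (q ⁻¹' (g '' Set.univ)) n := by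
  refine HomologySurj.of_comp k (Set.preimage_mono (Set.singleton_subset_iff.2 ?_))
    (starConvex_homologySurj k hq hg (c := Pi.single ⟨0, by omega⟩ 1) (Set.mem_univ _)
      (starConvex_univ _) n)
  exact Set.mem_image_of_mem g ⟨⟨0, by omega⟩, hj, by simp⟩

/-- Induction along the hemisphere decomposition. Mayer–Vietoris shows that one half surjects onto
the homology of the union of the halves, using the previous sphere in degrees `n` and `n - 1`. That
half injects into the whole because both are star-shaped about a common point, so the union injects
as well. -/
theorem homologyInj_nonzeroBefore (hq : IsCoveringMap q) (hg : Topology.IsEmbedding g) {j : ℕ}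
    (hjN : j ≤ N) : ∀ n, n + 1 < j →
    HomologyInj k (q ⁻¹' (g '' nonzeroBefore N j)) (q ⁻¹' (g '' Set.univ)) n := by
  induction j with
  | zero => exact fun n hn => absurd hn (by omega)
  | succ j ih =>
    intro n hn
    let j' : Fin N := ⟨j, hjN⟩
    have hinter : q ⁻¹' (g '' nonzeroBeforeOr 1 j') ∩ q ⁻¹' (g '' nonzeroBeforeOr (-1) j') =
        q ⁻¹' (g '' nonzeroBefore N j) := by
      rw [← Set.preimage_inter, ← Set.image_inter hg.injective, nonzeroBeforeOr_inter]
    have hunion : nonzeroBeforeOr 1 j' ∪ nonzeroBeforeOr (-1) j' = nonzeroBefore N (j + 1) :=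
      nonzeroBeforeOr_union j'
    have hex := isExcisive_image k hq.continuous hg (isOpen_nonzeroBeforeOr 1 j')
      (isOpen_nonzeroBeforeOr (-1) j')
    rw [hunion] at hex
    have hinj : ∀ (s : ℝ) (_ : s ≠ 0) (i : ℕ), HomologyInj k (q ⁻¹' (g '' nonzeroBeforeOr s j'))
        (q ⁻¹' (g '' Set.univ)) i := fun s hs i =>
      starConvex_homologyInj k hq hg (single_mem_nonzeroBeforeOr hs j')
        (starConvex_nonzeroBeforeOr hs j') (Set.subset_univ _) (starConvex_univ _) i
    have hsub : q ⁻¹' (g '' nonzeroBefore N j) ⊆ q ⁻¹' (g '' nonzeroBeforeOr (-1) j') :=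
      Set.preimage_mono (Set.image_mono (nonzeroBefore_subset_or _ j'))
    have hsub' (P) : q ⁻¹' (g '' P) ⊆ q ⁻¹' (g '' Set.univ) :=
      Set.preimage_mono (Set.image_mono (Set.subset_univ _))
    refine HomologyInj.of_surj k hex.left (hsub' _) (HomologySurj.of_isExcisive hex ?_ ?_)
      (hinj 1 one_ne_zero n)
    · rw [hinter]
      exact HomologySurj.of_inj k hsub (hsub' _)
        (homologySurj_nonzeroBefore k hq hg (by omega) (by omega) n) (hinj (-1) (by norm_num) n)
    · rintro i rfl
      rw [hinter]
      exact HomologyInj.of_comp k (hsub' _) (ih (by omega) i (by omega))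

theorem homologyFG_starConvex {H : Type*} [CommGroup H] [MulAction H Y] [ContinuousConstSMul H Y]
    (hq : IsQuotientCoveringMap q H) (hg : Topology.IsEmbedding g) {c : Fin N → ℝ}
    {P : Set (Fin N → ℝ)} (hc : c ∈ P) (hP : StarConvex ℝ c P) (n : ℕ) :
    HomologyFG k H (q ⁻¹' (g '' P)) n :=
  (homologyFG_fiber k hq (g c) n).of_surj
    (Set.preimage_mono (Set.singleton_subset_iff.2 (Set.mem_image_of_mem g hc)))
    (starConvex_homologySurj k hq.isCoveringMap hg hc hP n)

theorem homologyFG_nonzeroBefore {H : Type*} [CommGroup H] [MulAction H Y]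
    [ContinuousConstSMul H Y] [IsNoetherianRing (MonoidAlgebra k H)]
    (hq : IsQuotientCoveringMap q H) (hg : Topology.IsEmbedding g) {j : ℕ} (hjN : j ≤ N) (n : ℕ) :
    HomologyFG k H (q ⁻¹' (g '' nonzeroBefore N j)) n := by
  induction j generalizing n with
  | zero =>
    rw [nonzeroBefore_zero, Set.image_empty, Set.preimage_empty]
    exact HomologyFG.empty n
  | succ j ih =>
    let j' : Fin N := ⟨j, hjN⟩
    have hinter : q ⁻¹' (g '' nonzeroBeforeOr 1 j') ∩ q ⁻¹' (g '' nonzeroBeforeOr (-1) j') =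
        q ⁻¹' (g '' nonzeroBefore N j) := by
      rw [← Set.preimage_inter, ← Set.image_inter hg.injective, nonzeroBeforeOr_inter]
    have hunion : nonzeroBeforeOr 1 j' ∪ nonzeroBeforeOr (-1) j' = nonzeroBefore N (j + 1) :=
      nonzeroBeforeOr_union j'
    have hex := isExcisive_image k hq.isCoveringMap.continuous hg (isOpen_nonzeroBeforeOr 1 j')
      (isOpen_nonzeroBeforeOr (-1) j')
    rw [hunion] at hex
    refine HomologyFG.of_isExcisive hex (preimage_invariant hq _) (preimage_invariant hq _)
      (homologyFG_starConvex k hq hg (single_mem_nonzeroBeforeOr one_ne_zero j')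
        (starConvex_nonzeroBeforeOr one_ne_zero j') n)
      (homologyFG_starConvex k hq hg (single_mem_nonzeroBeforeOr (by norm_num) j')
        (starConvex_nonzeroBeforeOr (by norm_num) j') n) fun i _ => ?_
    rw [hinter]
    exact ih (by omega) i

end Cell

/-! ### Attaching a cell -/

section Attach

/-- The radial homotopy which pushes nonzero vectors to the unit sphere. -/
def radialPush {N : ℕ} (t : ℝ) (x : Fin N → ℝ) : Fin N → ℝ := ((1 - t) + t * ‖x‖⁻¹) • x

theorem norm_radialPush {N : ℕ} {t : ℝ} (ht : t ∈ Set.Icc (0 : ℝ) 1) {x : Fin N → ℝ} (hx : x ≠ 0) :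
    ‖radialPush t x‖ = (1 - t) * ‖x‖ + t := by
  have hx' : ‖x‖ ≠ 0 := norm_ne_zero_iff.2 hx
  have h1 := sub_nonneg.2 ht.2
  rw [radialPush, norm_smul, Real.norm_of_nonneg
    (add_nonneg h1 (mul_nonneg ht.1 (inv_nonneg.2 (norm_nonneg x)))), add_mul, mul_assoc,
    inv_mul_cancel₀ hx', mul_one]

theorem radialPush_of_norm_eq_one {N : ℕ} (t : ℝ) {x : Fin N → ℝ} (hx : ‖x‖ = 1) :
    radialPush t x = x := by
  simp [radialPush, hx]

/-- The data of a cell with characteristic map `φ` that is attached to the closed set `A`. -/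
structure IsCellAttachment {X : Type*} [TopologicalSpace X] {N : ℕ} (φ : (Fin N → ℝ) → X)
    (A : Set X) : Prop where
  isClosed : IsClosed A
  continuousOn : ContinuousOn φ (Metric.closedBall 0 1)
  isEmbedding : Topology.IsEmbedding fun x : Metric.ball (0 : Fin N → ℝ) 1 => φ x
  mapsTo : ∀ x, ‖x‖ = 1 → φ x ∈ A
  notMem : ∀ x, ‖x‖ < 1 → φ x ∉ A

variable {X : Type*} [TopologicalSpace X] {N : ℕ} {φ : (Fin N → ℝ) → X} {A : Set X}

namespace IsCellAttachment

theorem eq_of_eq (h : IsCellAttachment φ A) {x y : Fin N → ℝ} (hx : ‖x‖ < 1) (hy : ‖y‖ < 1)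
    (hxy : φ x = φ y) : x = y :=
  congrArg Subtype.val (h.isEmbedding.injective
    (a₁ := ⟨x, mem_ball_zero_iff.2 hx⟩) (a₂ := ⟨y, mem_ball_zero_iff.2 hy⟩) hxy)

/-- The union of `A` and the cell, without the center of the cell. -/
def punctured (φ : (Fin N → ℝ) → X) (A : Set X) : Set X :=
  (A ∪ φ '' Metric.closedBall 0 1) \ {φ 0}

open Classical in
/-- The homotopy that pushes the complement of the center of the cell to `A`. -/
def push (φ : (Fin N → ℝ) → X) (A : Set X) (t : ℝ) (u : X) : X :=
  if u ∈ A then u else φ (radialPush t (Function.invFunOn φ (Metric.ball 0 1) u))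

omit [TopologicalSpace X] in
theorem push_of_mem {t : ℝ} {u : X} (hu : u ∈ A) : push φ A t u = u := if_pos hu

theorem push_apply (h : IsCellAttachment φ A) (t : ℝ) {x : Fin N → ℝ} (hx : ‖x‖ ≤ 1) :
    push φ A t (φ x) = φ (radialPush t x) := by
  rcases hx.eq_or_lt with hx | hx
  · rw [push_of_mem (h.mapsTo x hx), radialPush_of_norm_eq_one t hx]
  · have hex : ∃ y ∈ Metric.ball (0 : Fin N → ℝ) 1, φ y = φ x := ⟨x, mem_ball_zero_iff.2 hx, rfl⟩
    rw [push, if_neg (h.notMem x hx), h.eq_of_eq (mem_ball_zero_iff.1 (Function.invFunOn_mem hex))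
      hx (Function.invFunOn_eq hex)]

theorem zero_notMem (h : IsCellAttachment φ A) : φ 0 ∉ A := h.notMem 0 (by simp)

theorem apply_ne_zero (h : IsCellAttachment φ A) {x : Fin N → ℝ} (hx : ‖x‖ ≤ 1) (hx0 : x ≠ 0) :
    φ x ≠ φ 0 := by
  rcases hx.eq_or_lt with hx | hx
  · exact fun h' => h.zero_notMem (h' ▸ h.mapsTo x hx)
  · exact fun h' => hx0 (h.eq_of_eq hx (by simp) h')

theorem mem_punctured (h : IsCellAttachment φ A) {u : X} :
    u ∈ punctured φ A ↔ u ∈ A ∨ ∃ x, ‖x‖ ≤ 1 ∧ x ≠ 0 ∧ φ x = u := by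
  constructor
  · rintro ⟨hu | ⟨x, hx, rfl⟩, hu0⟩
    · exact Or.inl hu
    · exact Or.inr ⟨x, mem_closedBall_zero_iff.1 hx, fun hx0 => hu0 (by rw [hx0]; rfl), rfl⟩
  · rintro (hu | ⟨x, hx, hx0, rfl⟩)
    · exact ⟨Or.inl hu, fun h' => h.zero_notMem (h' ▸ hu)⟩
    · exact ⟨Or.inr ⟨x, mem_closedBall_zero_iff.2 hx, rfl⟩, h.apply_ne_zero hx hx0⟩

theorem norm_radialPush_le {t : ℝ} (ht : t ∈ Set.Icc (0 : ℝ) 1) {x : Fin N → ℝ} (hx : ‖x‖ ≤ 1)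
    (hx0 : x ≠ 0) : ‖radialPush t x‖ ≤ 1 := by
  rw [norm_radialPush ht hx0]
  nlinarith [ht.1, ht.2]

theorem radialPush_ne_zero {t : ℝ} (ht : t ∈ Set.Icc (0 : ℝ) 1) {x : Fin N → ℝ}
    (hx0 : x ≠ 0) : radialPush t x ≠ 0 := by
  rw [← norm_ne_zero_iff, norm_radialPush ht hx0]
  have h0 : 0 < ‖x‖ := norm_pos_iff.2 hx0
  rcases ht.1.eq_or_lt with rfl | h
  · simpa using hx0
  · nlinarith [ht.1, ht.2, mul_nonneg (sub_nonneg.2 ht.2) h0.le]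

/-- The closed ball is compact and `X` is Hausdorff, so the characteristic map is proper. It remains
so after restriction over the complement of the center and product with the interval. The preimage
of a closed set is then a closed part over `A` together with the image of a closed set under this
closed map. -/
theorem continuous_push [T2Space X] (h : IsCellAttachment φ A) :
    Continuous fun z : unitInterval × punctured φ A => push φ A z.1 z.2 := by
  let D := Metric.closedBall (0 : Fin N → ℝ) 1
  have hDc : CompactSpace D := isCompact_iff_compactSpace.1 (isCompact_closedBall _ _)
  let f : D → X := D.domRestrict φ
  have hf : Continuous f := continuousOn_iff_continuous_domRestrict.1 h.continuousOn
  have hf1 : IsProperMap ((punctured φ A).restrictPreimage f) :=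
    hf.isProperMap.restrictPreimage _
  have hf2 : IsProperMap (Prod.map (id : unitInterval → unitInterval)
    ((punctured φ A).restrictPreimage f)) := isProperMap_id.prodMap hf1
  rw [continuous_iff_isClosed]
  intro C hC
  let A' : Set (unitInterval × punctured φ A) := {z | (z.2 : X) ∈ A}
  have hA' : IsClosed A' := h.isClosed.preimage (by fun_prop)
  have h1 : IsClosed (A' ∩ {z | (z.2 : X) ∈ C}) := hA'.inter (hC.preimage (by fun_prop))
  have h2 : Continuous fun z : unitInterval × (f ⁻¹' punctured φ A) =>
      φ (radialPush z.1 z.2) := by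
    refine h.continuousOn.comp_continuous ?_ fun z => ?_
    · have h3 : Continuous fun z : unitInterval × (f ⁻¹' punctured φ A) =>
          ((z.2 : D) : Fin N → ℝ) := by fun_prop
      refine Continuous.smul (.add (by fun_prop) (.mul (by fun_prop) (.inv₀ h3.norm fun z => ?_)))
        h3
      rw [norm_ne_zero_iff]
      intro h0
      refine z.2.2.2 ?_
      rw [Set.mem_singleton_iff, ← h0]
      rfl
    · refine mem_closedBall_zero_iff.2 (norm_radialPush_le z.1.2
        (mem_closedBall_zero_iff.1 z.2.1.2) fun h0 => z.2.2.2 ?_)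
      rw [Set.mem_singleton_iff, ← h0]
      rfl
  have h3 := h1.union (hf2.isClosedMap _ (hC.preimage h2))
  convert h3 using 1
  ext ⟨t, u, hu⟩
  constructor
  · intro hz
    change push φ A t u ∈ C at hz
    rcases h.mem_punctured.1 hu with hu' | ⟨x, hx, hx0, rfl⟩
    · exact Or.inl ⟨hu', by rwa [push_of_mem hu'] at hz⟩
    · refine Or.inr ⟨(t, ⟨⟨x, mem_closedBall_zero_iff.2 hx⟩, hu⟩), ?_, rfl⟩
      rwa [h.push_apply _ hx] at hz
  · rintro (⟨hu', hz⟩ | ⟨⟨s, ⟨x, hx⟩, hx'⟩, hz, heq⟩)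
    · change push φ A t u ∈ C
      rw [push_of_mem (show u ∈ A from hu')]
      exact hz
    · have hst : s = t := congrArg Prod.fst heq
      have hxu : φ x = u := congrArg (fun z => (z.2 : X)) heq
      subst hst hxu
      change push φ A s (φ x) ∈ C
      rwa [h.push_apply _ (mem_closedBall_zero_iff.1 hx)]

/-- The complement of the center of the cell deforms to `A`. -/
def deformation [T2Space X] (h : IsCellAttachment φ A) : Deformation A (punctured φ A) where
  toHomotopy := ⟨_, h.continuous_push⟩
  subset := fun _ hu => h.mem_punctured.2 (Or.inl hu)
  at_zero := by
    rintro ⟨u, hu⟩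
    change push φ A 0 u = u
    rcases h.mem_punctured.1 hu with hu' | ⟨x, hx, hx0, rfl⟩
    · exact push_of_mem hu'
    · rw [h.push_apply _ hx]
      simp [radialPush]
  mapsTo := by
    rintro t ⟨u, hu⟩
    change push φ A t u ∈ _
    rcases h.mem_punctured.1 hu with hu' | ⟨x, hx, hx0, rfl⟩
    · rwa [push_of_mem hu']
    · rw [h.push_apply _ hx]
      exact h.mem_punctured.2 (Or.inr ⟨_, norm_radialPush_le t.2 hx hx0,
        radialPush_ne_zero t.2 hx0, rfl⟩)
  at_one := by
    rintro ⟨u, hu⟩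
    change push φ A 1 u ∈ _
    rcases h.mem_punctured.1 hu with hu' | ⟨x, hx, hx0, rfl⟩
    · rwa [push_of_mem hu']
    · rw [h.push_apply _ hx]
      refine h.mapsTo _ ?_
      rw [norm_radialPush ⟨zero_le_one, le_rfl⟩ hx0]
      ring
  mapsTo_sub := by
    rintro t ⟨u, hu⟩ hu'
    change push φ A t u ∈ A
    rwa [push_of_mem hu']

/-- The open cell, parametrized by a vector space. -/
def openParam (φ : (Fin N → ℝ) → X) (x : Fin N → ℝ) : X := φ (Homeomorph.unitBall x)

omit [TopologicalSpace X] in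
theorem openParam_zero : openParam φ 0 = φ 0 := by
  rw [openParam, Homeomorph.coe_unitBall_apply_zero]

theorem isEmbedding_openParam (h : IsCellAttachment φ A) : Topology.IsEmbedding (openParam φ) :=
  h.isEmbedding.comp Homeomorph.unitBall.isEmbedding

omit [TopologicalSpace X] in
theorem range_openParam (φ : (Fin N → ℝ) → X) :
    openParam φ '' Set.univ = φ '' Metric.ball 0 1 := by
  rw [Set.image_univ]
  ext u
  constructor
  · rintro ⟨x, rfl⟩
    exact ⟨_, (Homeomorph.unitBall x).2, rfl⟩
  · rintro ⟨x, hx, rfl⟩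
    exact ⟨Homeomorph.unitBall.symm ⟨x, hx⟩, by rw [openParam, Homeomorph.apply_symm_apply]⟩

theorem union_eq (h : IsCellAttachment φ A) :
    A ∪ φ '' Metric.closedBall 0 1 = A ∪ φ '' Metric.ball 0 1 := by
  refine subset_antisymm (Set.union_subset Set.subset_union_left ?_)
    (Set.union_subset_union_right _ (Set.image_mono Metric.ball_subset_closedBall))
  rintro _ ⟨x, hx, rfl⟩
  rcases (mem_closedBall_zero_iff.1 hx).eq_or_lt with hx | hx
  · exact Or.inl (h.mapsTo x hx)
  · exact Or.inr ⟨x, mem_ball_zero_iff.2 hx, rfl⟩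

theorem image_ball_eq (h : IsCellAttachment φ A) :
    φ '' Metric.ball 0 1 = (A ∪ φ '' Metric.closedBall 0 1) ∩ Aᶜ := by
  rw [h.union_eq]
  ext u
  constructor
  · rintro ⟨x, hx, rfl⟩
    exact ⟨Or.inr ⟨x, hx, rfl⟩, h.notMem x (mem_ball_zero_iff.1 hx)⟩
  · rintro ⟨hu | hu, hu'⟩
    · exact absurd hu hu'
    · exact hu

theorem punctured_inter (h : IsCellAttachment φ A) :
    punctured φ A ∩ openParam φ '' Set.univ = openParam φ '' nonzeroBefore N N := by
  rw [nonzeroBefore_self, range_openParam]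
  ext u
  constructor
  · rintro ⟨⟨-, hu⟩, hu'⟩
    rw [← range_openParam] at hu'
    obtain ⟨x, -, rfl⟩ := hu'
    refine ⟨x, fun hx => hu ?_, rfl⟩
    rw [Set.mem_singleton_iff.1 hx, openParam_zero]
    rfl
  · rintro ⟨x, hx, rfl⟩
    have hx' : openParam φ x ∈ φ '' Metric.ball 0 1 :=
      range_openParam φ ▸ Set.mem_image_of_mem _ (Set.mem_univ x)
    exact ⟨⟨Or.inr (Set.image_mono Metric.ball_subset_closedBall hx'), fun h0 => hx
      (h.isEmbedding_openParam.injective (h0.trans openParam_zero.symm))⟩, hx'⟩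

variable (k : Type*) [Field k] {Y : Type*} [TopologicalSpace Y] {q : Y → X}

/-- The two pieces are cut out of the union by the complement of the center and the complement of
`A`, both open. -/
theorem isExcisive [T2Space X] (h : IsCellAttachment φ A) (hq : Continuous q) :
    IsExcisive k (q ⁻¹' punctured φ A) (q ⁻¹' (openParam φ '' Set.univ))
      (q ⁻¹' (A ∪ φ '' Metric.closedBall 0 1)) := by
  refine IsExcisive.preimage k hq (isOpen_compl_singleton (x := φ 0)) h.isClosed.isOpen_compl rfl
    ((range_openParam φ).trans h.image_ball_eq) ?_
  rw [range_openParam]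
  intro u hu
  by_cases hu0 : u = φ 0
  · exact Or.inr ⟨0, by simp, hu0.symm⟩
  · exact Or.inl ⟨hu, hu0⟩

omit [TopologicalSpace Y] in
theorem preimage_inter (h : IsCellAttachment φ A) :
    q ⁻¹' punctured φ A ∩ q ⁻¹' (openParam φ '' Set.univ) =
      q ⁻¹' (openParam φ '' nonzeroBefore N N) := by
  rw [← Set.preimage_inter, h.punctured_inter]

/-- Deform `A` into the complement of the center, then add the open cell. The overlap is the open
cell without its center, a sphere of dimension `N - 1` up to homotopy, so its map to the open cell
is surjective in degree `n` and injective in degree `n - 1`. -/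
theorem homologySurj [T2Space X] (h : IsCellAttachment φ A) (hq : IsCoveringMap q) {n : ℕ}
    (hn : n < N) : HomologySurj k (q ⁻¹' A) (q ⁻¹' (A ∪ φ '' Metric.closedBall 0 1)) n := by
  refine HomologySurj.trans k (h.isExcisive k hq.continuous).left
    ((h.deformation.lift hq).homologySurj n)
    (HomologySurj.of_isExcisive (h.isExcisive k hq.continuous) ?_ ?_)
  · rw [h.preimage_inter]
    exact homologySurj_nonzeroBefore k hq h.isEmbedding_openParam (by omega) le_rfl n
  · rintro i rfl
    rw [h.preimage_inter]
    exact homologyInj_nonzeroBefore k hq h.isEmbedding_openParam le_rfl i hn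

theorem homologyInj [T2Space X] (h : IsCellAttachment φ A) (hq : IsCoveringMap q) {n : ℕ}
    (hn : n + 1 < N) : HomologyInj k (q ⁻¹' A) (q ⁻¹' (A ∪ φ '' Metric.closedBall 0 1)) n := by
  refine HomologyInj.trans k (h.deformation.lift hq).subset
    ((h.deformation.lift hq).homologyInj n)
    (HomologyInj.of_isExcisive (h.isExcisive k hq.continuous) ?_)
  rw [h.preimage_inter]
  exact homologyInj_nonzeroBefore k hq h.isEmbedding_openParam le_rfl n hn

theorem homologyFG [T2Space X] {H : Type*} [CommGroup H] [MulAction H Y] [ContinuousConstSMul H Y]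
    [IsNoetherianRing (MonoidAlgebra k H)] (h : IsCellAttachment φ A)
    (hq : IsQuotientCoveringMap q H) (hA : ∀ n, HomologyFG k H (q ⁻¹' A) n) (n : ℕ) :
    HomologyFG k H (q ⁻¹' (A ∪ φ '' Metric.closedBall 0 1)) n := by
  refine HomologyFG.of_isExcisive (h.isExcisive k hq.isCoveringMap.continuous)
    (preimage_invariant hq _) (preimage_invariant hq _)
    ((hA n).of_surj (h.deformation.lift hq.isCoveringMap).subset
      ((h.deformation.lift hq.isCoveringMap).homologySurj n))
    (homologyFG_starConvex k hq h.isEmbedding_openParam (Set.mem_univ 0) (starConvex_univ _) n)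
    fun i _ => ?_
  rw [h.preimage_inter]
  exact homologyFG_nonzeroBefore k hq h.isEmbedding_openParam le_rfl i

end IsCellAttachment

end Attach

/-! ### Finite subcomplexes of a CW complex -/

section Subcomplexes

open Topology Topology.RelCWComplex

variable (X : Type*) [TopologicalSpace X] [CWComplex (Set.univ : Set X)]

/-- The cells of all dimensions of a CW complex. -/
abbrev Cells := Σ n, RelCWComplex.cell (Set.univ : Set X) n

variable {X}

/-- The union of a set of open cells. -/
def carrier (s : Set (Cells X)) : Set X := ⋃ c ∈ s, openCell c.1 c.2

/-- A finite set of cells the union of which is a subcomplex. -/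
structure IsFiniteSubcomplex (s : Set (Cells X)) : Prop where
  finite : s.Finite
  closedCell_subset : ∀ c ∈ s, closedCell c.1 c.2 ⊆ carrier s

theorem mem_carrier {s : Set (Cells X)} {x : X} :
    x ∈ carrier s ↔ ∃ c ∈ s, x ∈ openCell c.1 c.2 := by
  simp only [carrier, Set.mem_iUnion, exists_prop]

theorem carrier_mono {s t : Set (Cells X)} (h : s ⊆ t) : carrier s ⊆ carrier t :=
  Set.biUnion_subset_biUnion_left h

theorem carrier_insert (c : Cells X) (s : Set (Cells X)) :
    carrier (insert c s) = openCell c.1 c.2 ∪ carrier s :=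
  Set.biUnion_insert _ _ _

theorem exists_mem_openCell (x : X) : ∃ c : Cells X, x ∈ openCell c.1 c.2 := by
  have h : x ∈ ⋃ (n : ℕ) (j : RelCWComplex.cell (Set.univ : Set X) n), openCell n j := by
    rw [CWComplex.iUnion_openCell_eq_complex]
    trivial
  simp only [Set.mem_iUnion] at h
  obtain ⟨n, j, h⟩ := h
  exact ⟨⟨n, j⟩, h⟩

theorem eq_of_mem_openCell {c d : Cells X} {x : X} (hc : x ∈ openCell c.1 c.2)
    (hd : x ∈ openCell d.1 d.2) : c = d :=
  eq_of_not_disjoint_openCell (Set.not_disjoint_iff.2 ⟨x, hc, hd⟩)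

theorem openCell_disjoint_carrier {s : Set (Cells X)} {c : Cells X} (hc : c ∉ s) {x : X}
    (hx : x ∈ openCell c.1 c.2) : x ∉ carrier s := by
  intro h
  obtain ⟨d, hd, h⟩ := mem_carrier.1 h
  exact hc (eq_of_mem_openCell hx h ▸ hd)

theorem IsFiniteSubcomplex.isClosed [T2Space X] {s : Set (Cells X)} (hs : IsFiniteSubcomplex s) :
    IsClosed (carrier s) := by
  have : carrier s = ⋃ c ∈ s, closedCell c.1 c.2 :=
    subset_antisymm (Set.iUnion₂_mono fun c _ => openCell_subset_closedCell _ _)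
      (Set.iUnion₂_subset hs.closedCell_subset)
  rw [this]
  exact hs.finite.isClosed_biUnion fun c _ => isClosed_closedCell

theorem IsFiniteSubcomplex.insertCell {s : Set (Cells X)} (hs : IsFiniteSubcomplex s) {c : Cells X}
    (hc : cellFrontier c.1 c.2 ⊆ carrier s) : IsFiniteSubcomplex (insert c s) := by
  refine ⟨hs.finite.insert c, ?_⟩
  rintro d (rfl | hd)
  · rw [← cellFrontier_union_openCell_eq_closedCell, carrier_insert, Set.union_comm]
    exact Set.union_subset_union_right _ hc
  · exact (hs.closedCell_subset d hd).trans (carrier_mono (Set.subset_insert _ _))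

theorem carrier_insert_eq {s : Set (Cells X)} {c : Cells X}
    (hc : cellFrontier c.1 c.2 ⊆ carrier s) :
    carrier (insert c s) = carrier s ∪ closedCell c.1 c.2 := by
  rw [carrier_insert, ← cellFrontier_union_openCell_eq_closedCell, ← Set.union_assoc,
    Set.union_eq_self_of_subset_right hc, Set.union_comm]

theorem IsFiniteSubcomplex.union {s t : Set (Cells X)} (hs : IsFiniteSubcomplex s)
    (ht : IsFiniteSubcomplex t) : IsFiniteSubcomplex (s ∪ t) := by
  refine ⟨hs.finite.union ht.finite, ?_⟩
  rintro c (hc | hc)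
  · exact (hs.closedCell_subset c hc).trans (carrier_mono Set.subset_union_left)
  · exact (ht.closedCell_subset c hc).trans (carrier_mono Set.subset_union_right)

theorem isFiniteSubcomplex_empty : IsFiniteSubcomplex (∅ : Set (Cells X)) :=
  ⟨Set.finite_empty, by simp⟩

theorem exists_dim_lt_of_mem_cellFrontier {c : Cells X} {x : X} (hx : x ∈ cellFrontier c.1 c.2) :
    ∃ d : Cells X, d.1 < c.1 ∧ x ∈ openCell d.1 d.2 := by
  obtain ⟨I, hI⟩ := CWComplex.cellFrontier_subset_finite_openCell c.1 c.2
  have h := hI hx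
  simp only [Set.mem_iUnion] at h
  obtain ⟨m, hm, j, -, h⟩ := h
  exact ⟨⟨m, j⟩, hm, h⟩

/-- Closure finiteness: the frontier meets finitely many open cells of lower dimension, each
contained in a finite subcomplex by induction. -/
theorem exists_isFiniteSubcomplex_of_mem (n : ℕ) : ∀ c : Cells X, c.1 = n →
    ∃ s, IsFiniteSubcomplex s ∧ c ∈ s := by
  induction n using Nat.strong_induction_on with
  | _ n ih =>
    intro c hc
    obtain ⟨I, hI⟩ := CWComplex.cellFrontier_subset_finite_openCell c.1 c.2
    have h2 : ∀ (m : Fin n) (j : I m), ∃ s, IsFiniteSubcomplex s ∧ (⟨m, j⟩ : Cells X) ∈ s :=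
      fun m j => ih m m.2 _ rfl
    choose s hs hms using h2
    have h3 : IsFiniteSubcomplex (⋃ (m : Fin n) (j : I m), s m j) := by
      refine ⟨Set.finite_iUnion fun m => Set.finite_iUnion fun j => (hs m j).finite,
        fun d hd => ?_⟩
      simp only [Set.mem_iUnion] at hd
      obtain ⟨m, j, hd⟩ := hd
      exact ((hs m j).closedCell_subset d hd).trans
        (carrier_mono (Set.subset_iUnion₂ (s := fun m j => s m j) m j))
    refine ⟨_, h3.insertCell (c := c) fun x hx => ?_, Set.mem_insert _ _⟩
    have h := hI hx
    simp only [Set.mem_iUnion] at h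
    obtain ⟨m, hm, j, hj, h⟩ := h
    refine mem_carrier.2 ⟨⟨m, j⟩, ?_, h⟩
    simp only [Set.mem_iUnion]
    exact ⟨⟨m, hc ▸ hm⟩, ⟨j, hj⟩, hms _ _⟩

theorem exists_isFiniteSubcomplex {F : Set (Cells X)} (hF : F.Finite) :
    ∃ s, IsFiniteSubcomplex s ∧ F ⊆ s := by
  induction F, hF using Set.Finite.induction_on with
  | empty => exact ⟨∅, isFiniteSubcomplex_empty, subset_rfl⟩
  | insert _ _ ih =>
    obtain ⟨s, hs, hFs⟩ := ih
    rename_i c F _ _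
    obtain ⟨t, ht, hct⟩ := exists_isFiniteSubcomplex_of_mem _ c rfl
    exact ⟨t ∪ s, ht.union hs, Set.insert_subset (Or.inl hct) (hFs.trans Set.subset_union_right)⟩

theorem isFiniteSubcomplex_skeleton {n : ℕ} (h : ∀ j ≤ n, Finite
    (RelCWComplex.cell (Set.univ : Set X) j)) : IsFiniteSubcomplex {c : Cells X | c.1 ≤ n} := by
  refine ⟨?_, fun c hc => ?_⟩
  · have : {c : Cells X | c.1 ≤ n} ⊆ ⋃ j : Fin (n + 1), Set.range (Sigma.mk j.1) := by
      rintro ⟨m, c⟩ hc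
      exact Set.mem_iUnion.2 ⟨⟨m, Nat.lt_succ_of_le hc⟩, c, rfl⟩
    refine Set.Finite.subset (Set.finite_iUnion fun j => ?_) this
    have := h j (Nat.lt_succ_iff.1 j.2)
    exact Set.finite_range _
  · rw [← cellFrontier_union_openCell_eq_closedCell]
    refine Set.union_subset (fun x hx => ?_) fun x hx => mem_carrier.2 ⟨c, hc, hx⟩
    obtain ⟨d, hd, hxd⟩ := exists_dim_lt_of_mem_cellFrontier hx
    exact mem_carrier.2 ⟨d, hd.le.trans hc, hxd⟩

/-- Choose a point of `K` in every open cell that it meets. Any set of these points meets each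
closed cell in a finite set, hence is closed. The chosen points thus form a compact discrete set. -/
theorem finite_of_isCompact [T2Space X] {K : Set X} (hK : IsCompact K) :
    {c : Cells X | (K ∩ openCell c.1 c.2).Nonempty}.Finite := by
  choose x hx using fun c : {c : Cells X | (K ∩ openCell c.1 c.2).Nonempty} => c.2
  have hinj : Function.Injective x := fun c d hcd =>
    Subtype.ext (eq_of_mem_openCell (hx c).2 (hcd ▸ (hx d).2))
  have hclosed : ∀ Q ⊆ Set.range x, IsClosed Q := by
    intro Q hQ
    refine (CWComplex.closed Set.univ Q (Set.subset_univ _)).2 fun n j => ?_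
    obtain ⟨s, hs, hjs⟩ := exists_isFiniteSubcomplex_of_mem n ⟨n, j⟩ rfl
    refine Set.Finite.isClosed (((hs.finite.preimage
      (f := (Subtype.val : {c : Cells X | (K ∩ openCell c.1 c.2).Nonempty} → Cells X))
      Subtype.val_injective.injOn).image x).subset ?_)
    rintro _ ⟨hy, hy'⟩
    obtain ⟨c, rfl⟩ := hQ hy
    obtain ⟨d, hd, hcd⟩ := mem_carrier.1 (hs.closedCell_subset _ hjs hy')
    exact ⟨c, by rwa [Set.mem_preimage, eq_of_mem_openCell (hx c).2 hcd], rfl⟩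
  have hcomp : IsCompact (Set.range x) := hK.of_isClosed_subset (hclosed _ subset_rfl)
    (by rintro _ ⟨c, rfl⟩; exact (hx c).1)
  have hdisc : DiscreteTopology (Set.range x) := by
    refine discreteTopology_iff_forall_isClosed.2 fun Q => ?_
    have := (hclosed (Subtype.val '' Q) (by rintro _ ⟨y, -, rfl⟩; exact y.2)).preimage
      (continuous_subtype_val (p := (· ∈ Set.range x)))
    rwa [Set.preimage_image_eq _ Subtype.val_injective] at this
  have hfin : (Set.range x).Finite := hcomp.finite ⟨hdisc⟩
  have : Finite (Set.range x) := hfin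
  exact Finite.of_injective (Set.rangeFactorization x)
    (Set.rangeFactorization_injective.2 hinj)

/-- Finite subcomplexes are built by successively attaching cells. -/
theorem IsFiniteSubcomplex.induction {P : Set (Cells X) → Prop} {s t : Set (Cells X)}
    (hs : IsFiniteSubcomplex s) (ht : IsFiniteSubcomplex t) (hst : s ⊆ t) (h0 : P s)
    (h1 : ∀ (r : Set (Cells X)) (c : Cells X), s ⊆ r → c ∈ t → c ∉ r → IsFiniteSubcomplex r →
      cellFrontier c.1 c.2 ⊆ carrier r → P r → P (insert c r)) : P t := by
  suffices key : ∀ (n : ℕ) (r : Set (Cells X)), IsFiniteSubcomplex r → s ⊆ r → r ⊆ t →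
      (t \ r).ncard = n → P r → P t from key _ s hs subset_rfl hst rfl h0
  intro n
  induction n with
  | zero =>
    intro r hr hsr hrt hn hP
    rw [Set.ncard_eq_zero (ht.finite.subset Set.sdiff_subset), Set.sdiff_eq_empty] at hn
    rwa [← subset_antisymm hrt hn]
  | succ n ih =>
    intro r hr hsr hrt hn hP
    have hne : (t \ r).Nonempty := by
      rw [Set.nonempty_iff_ne_empty]
      intro h
      simp [h] at hn
    -- The next cell is a missing one of least dimension: its frontier lies in cells of `t` of
    -- smaller dimension, which are all present already.
    obtain ⟨c, hc, hmin⟩ := Set.exists_min_image _ Sigma.fst (ht.finite.subset Set.sdiff_subset) hne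
    have hfr : cellFrontier c.1 c.2 ⊆ carrier r := by
      intro x hx
      obtain ⟨d, hd, hxd⟩ := exists_dim_lt_of_mem_cellFrontier hx
      obtain ⟨e, he, hxe⟩ := mem_carrier.1
        (ht.closedCell_subset c hc.1 (cellFrontier_subset_closedCell _ _ hx))
      obtain rfl := eq_of_mem_openCell hxd hxe
      refine mem_carrier.2 ⟨d, by_contra fun hdr => ?_, hxd⟩
      exact absurd (hmin d ⟨he, hdr⟩) (not_le.2 hd)
    refine ih (insert c r) (hr.insertCell hfr) (hsr.trans (Set.subset_insert _ _))
      (Set.insert_subset hc.1 hrt) ?_ (h1 r c hsr hc.1 hc.2 hr hfr hP)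
    have : t \ insert c r = (t \ r) \ {c} := by
      ext d
      simp only [Set.mem_sdiff, Set.mem_insert_iff, Set.mem_singleton_iff]
      tauto
    rw [this, Set.ncard_sdiff_singleton_of_mem hc, hn]
    rfl

theorem isCellAttachment [T2Space X] {s : Set (Cells X)} (hs : IsFiniteSubcomplex s) {c : Cells X}
    (hc : c ∉ s) (hfr : cellFrontier c.1 c.2 ⊆ carrier s) :
    IsCellAttachment (map c.1 c.2) (carrier s) where
  isClosed := hs.isClosed
  continuousOn := continuousOn c.1 c.2
  isEmbedding := by
    have hsrc := source_eq c.1 c.2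
    have hmem : ∀ x : Metric.ball (0 : Fin c.1 → ℝ) 1, (x : Fin c.1 → ℝ) ∈ (map c.1 c.2).source :=
      fun x => by
      rw [hsrc]
      exact x.2
    let e : Metric.ball (0 : Fin c.1 → ℝ) 1 ≃ₜ (map c.1 c.2).target :=
      { toFun := fun x => ⟨map c.1 c.2 x, (map c.1 c.2).map_source (hmem x)⟩
        invFun := fun y => ⟨(map c.1 c.2).symm y, by
          rw [← hsrc]
          exact (map c.1 c.2).map_target y.2⟩
        left_inv := fun x => Subtype.ext ((map c.1 c.2).left_inv (hmem x))
        right_inv := fun y => Subtype.ext ((map c.1 c.2).right_inv y.2)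
        continuous_toFun := by
          refine Continuous.subtype_mk ?_ _
          exact continuousOn_iff_continuous_domRestrict.1
            ((continuousOn c.1 c.2).mono Metric.ball_subset_closedBall)
        continuous_invFun := by
          refine Continuous.subtype_mk ?_ _
          exact continuousOn_iff_continuous_domRestrict.1 (continuousOn_symm c.1 c.2) }
    exact Topology.IsEmbedding.subtypeVal.comp e.isEmbedding
  mapsTo := fun x hx => hfr ⟨x, by simpa using hx, rfl⟩
  notMem := fun x hx => openCell_disjoint_carrier hc ⟨x, by simpa using hx, rfl⟩

end Subcomplexes

/-! ### Homology of the skeleta of a covering space of a CW complex -/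

section Skeleta

open Topology Topology.RelCWComplex

variable (k : Type*) [Field k] {X : Type*} [TopologicalSpace X] [T2Space X]
  [CWComplex (Set.univ : Set X)] {Y : Type*} [TopologicalSpace Y] {q : Y → X}

theorem homologySurj_of_dim_lt (hq : IsCoveringMap q) {s t : Set (Cells X)}
    (hs : IsFiniteSubcomplex s) (ht : IsFiniteSubcomplex t) (hst : s ⊆ t) {n : ℕ}
    (hn : ∀ c ∉ s, n < c.1) : HomologySurj k (q ⁻¹' carrier s) (q ⁻¹' carrier t) n := by
  refine hs.induction (P := fun t => HomologySurj k (q ⁻¹' carrier s) (q ⁻¹' carrier t) n) ht hst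
    le_sup_left fun r c hsr _ hcr hr hfr hP => ?_
  rw [carrier_insert_eq hfr]
  exact HomologySurj.trans k (Set.preimage_mono Set.subset_union_left) hP
    ((isCellAttachment hr hcr hfr).homologySurj k hq (hn c fun h => hcr (hsr h)))

theorem homologyInj_of_dim_lt (hq : IsCoveringMap q) {s t : Set (Cells X)}
    (hs : IsFiniteSubcomplex s) (ht : IsFiniteSubcomplex t) (hst : s ⊆ t) {n : ℕ}
    (hn : ∀ c ∉ s, n + 1 < c.1) : HomologyInj k (q ⁻¹' carrier s) (q ⁻¹' carrier t) n := by
  refine hs.induction (P := fun t => HomologyInj k (q ⁻¹' carrier s) (q ⁻¹' carrier t) n) ht hst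
    inf_le_right fun r c hsr _ hcr hr hfr hP => ?_
  rw [carrier_insert_eq hfr]
  exact HomologyInj.trans k (Set.preimage_mono (carrier_mono hsr)) hP
    ((isCellAttachment hr hcr hfr).homologyInj k hq (hn c fun h => hcr (hsr h)))

theorem homologyFG_carrier {H : Type*} [CommGroup H] [MulAction H Y] [ContinuousConstSMul H Y]
    [IsNoetherianRing (MonoidAlgebra k H)] (hq : IsQuotientCoveringMap q H) {t : Set (Cells X)}
    (ht : IsFiniteSubcomplex t) (n : ℕ) : HomologyFG k H (q ⁻¹' carrier t) n := by
  revert n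
  refine isFiniteSubcomplex_empty.induction
    (P := fun t => ∀ n, HomologyFG k H (q ⁻¹' carrier t) n) ht (Set.empty_subset _) (fun n => ?_)
    fun r c _ _ hcr hr hfr hP n => ?_
  · have : carrier (∅ : Set (Cells X)) = ∅ := by simp [carrier]
    rw [this, Set.preimage_empty]
    exact HomologyFG.empty n
  · rw [carrier_insert_eq hfr]
    exact (isCellAttachment hr hcr hfr).homologyFG k hq hP n

/-- Every singular chain lies over a finite subcomplex. -/
theorem exists_mem_chainsIn_carrier (hq : Continuous q) (n : ℕ) (z : Chains k Y (.mk n))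
    {s : Set (Cells X)} (hs : IsFiniteSubcomplex s) :
    ∃ t, IsFiniteSubcomplex t ∧ s ⊆ t ∧ z ∈ chainsIn k (q ⁻¹' carrier t) n := by
  induction z using Finsupp.induction_linear with
  | zero => exact ⟨s, hs, subset_rfl, zero_mem _⟩
  | add f g hf hg =>
    obtain ⟨t, ht, hst, hft⟩ := hf
    obtain ⟨t', ht', hst', hgt'⟩ := hg
    exact ⟨t ∪ t', ht.union ht', hst.trans Set.subset_union_left, add_mem
      (chainsIn_mono k (Set.preimage_mono (carrier_mono Set.subset_union_left)) n hft)
      (chainsIn_mono k (Set.preimage_mono (carrier_mono Set.subset_union_right)) n hgt')⟩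
  | single σ a =>
    have hK : IsCompact (Set.range (q ∘ σ)) := by
      have : CompactSpace (stdSimplex ℝ (Fin (n + 1))) := inferInstance
      exact isCompact_range (hq.comp σ.continuous)
    obtain ⟨t, ht, hKt⟩ := exists_isFiniteSubcomplex (finite_of_isCompact hK)
    refine ⟨s ∪ t, hs.union ht, Set.subset_union_left,
      single_mem_chainsIn k _ fun x => ?_⟩
    obtain ⟨c, hc⟩ := exists_mem_openCell (q (σ x))
    exact mem_carrier.2 ⟨c, Or.inr (hKt ⟨_, ⟨x, rfl⟩, hc⟩), hc⟩

/-- A cycle has compact support and so lies over a finite subcomplex, which arises from `s` by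
attaching cells of dimension greater than `n`. -/
theorem homologySurj_univ (hq : IsCoveringMap q) {s : Set (Cells X)}
    (hs : IsFiniteSubcomplex s) {n : ℕ} (hn : ∀ c ∉ s, n < c.1) :
    HomologySurj k (q ⁻¹' carrier s) Set.univ n := by
  intro z hz
  obtain ⟨t, ht, hst, hzt⟩ := exists_mem_chainsIn_carrier k hq.continuous n z hs
  exact sup_le_sup_left (boundariesIn_mono k (Set.subset_univ _) n) _
    (homologySurj_of_dim_lt k hq hs ht hst hn ⟨hzt, hz.2⟩)

theorem homologyInj_univ (hq : IsCoveringMap q) {s : Set (Cells X)}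
    (hs : IsFiniteSubcomplex s) {n : ℕ} (hn : ∀ c ∉ s, n + 1 < c.1) :
    HomologyInj k (q ⁻¹' carrier s) Set.univ n := by
  rintro z ⟨hz, w, -, hwz⟩
  obtain ⟨t, ht, hst, hwt⟩ := exists_mem_chainsIn_carrier k hq.continuous (n + 1) w hs
  exact homologyInj_of_dim_lt k hq hs ht hst hn ⟨hz, w, hwt, hwz⟩

theorem homologyFG_univ {H : Type*} [CommGroup H] [MulAction H Y] [ContinuousConstSMul H Y]
    [IsNoetherianRing (MonoidAlgebra k H)] (hq : IsQuotientCoveringMap q H) {n : ℕ}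
    (h : ∀ j ≤ n, Finite (RelCWComplex.cell (Set.univ : Set X) j)) :
    HomologyFG k H (Set.univ : Set Y) n :=
  (homologyFG_carrier k hq (isFiniteSubcomplex_skeleton h) n).of_surj (Set.subset_univ _)
    (homologySurj_univ k hq.isCoveringMap (isFiniteSubcomplex_skeleton h) fun _ hc => not_le.1 hc)

end Skeleta

/-! ### Zeroth homology and edges -/

section Edges

variable (k : Type*) [Field k]

/-- A point as a `0`-chain. -/
def pointChain {Y : Type*} [TopologicalSpace Y] (y : Y) : Chains k Y (.mk 0) :=
  Finsupp.single (ContinuousMap.const _ y) 1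

variable {Y : Type*} [TopologicalSpace Y]

theorem pointChain_mem {A : Set Y} {y : Y} (hy : y ∈ A) : pointChain k y ∈ chainsIn k A 0 :=
  single_mem_chainsIn k _ fun _ => hy

theorem chainsIn_zero_le {A : Set Y} {P : Submodule k (Chains k Y (.mk 0))}
    (h : ∀ y ∈ A, pointChain k y ∈ P) : chainsIn k A 0 ≤ P := by
  refine chainsIn_le k fun σ hσ => ?_
  have h1 : σ = ContinuousMap.const _ (σ (stdSimplex.vertex 0)) :=
    constSimplex_injective 0 (ContinuousMap.ext fun x => rfl)
  rw [h1]
  exact h _ (hσ _)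

/-- The points at the ends of a path are homologous. -/
theorem pointChain_sub_mem {A : Set Y} {a b : Y} (γ : Path a b) (hγ : ∀ t, γ t ∈ A) :
    pointChain k b - pointChain k a ∈ boundariesIn k A 0 := by
  let σ : Simplex Y (.mk 1) := ⟨fun x => γ (stdSimplexHomeomorphUnitInterval x), by fun_prop⟩
  have hface (i : Fin 2) : Simplex.pull (SimplexCategory.δ (n := 0) i) σ =
      ContinuousMap.const _ (σ (stdSimplex.vertex (SimplexCategory.δ (n := 0) i 0))) := by
    refine constSimplex_injective 0 (ContinuousMap.ext fun x => ?_)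
    change σ (stdSimplex.map _ (stdSimplex.vertex 0)) = σ _
    congr 1
    exact stdSimplex.map_vertex _ _
  have h0 : σ (stdSimplex.vertex 0) = a := γ.source
  have h1 : σ (stdSimplex.vertex 1) = b := γ.target
  refine ⟨Finsupp.single σ 1, single_mem_chainsIn k (σ := σ) 1 fun x => hγ _, ?_⟩
  rw [singBoundary_single, Fin.sum_univ_two, hface, hface]
  change (-1 : ℤ) ^ 0 • Finsupp.single (ContinuousMap.const _ (σ (stdSimplex.vertex 1))) 1 +
    (-1 : ℤ) ^ 1 • Finsupp.single (ContinuousMap.const _ (σ (stdSimplex.vertex 0))) 1 = _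
  rw [h0, h1, pow_zero, pow_one, one_smul, neg_one_smul, ← sub_eq_add_neg]
  rfl

theorem Deformation.exists_pointChain_sub_mem {A U : Set Y} (h : Deformation A U) {u : Y}
    (hu : u ∈ U) : ∃ a ∈ A, pointChain k a - pointChain k u ∈ boundariesIn k U 0 := by
  refine ⟨h.toHomotopy (1, ⟨u, hu⟩), h.at_one _, pointChain_sub_mem k
    { toFun := fun t => h.toHomotopy (t, ⟨u, hu⟩)
      continuous_toFun := by fun_prop
      source' := h.at_zero _
      target' := rfl } fun t => h.mapsTo t _⟩

variable {k} {H : Type*} [CommGroup H] [MulAction H Y] [ContinuousConstSMul H Y]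

theorem eqSpan_le {n : ℕ} {F : Set (Chains k Y (.mk n))} {P : Submodule k (Chains k Y (.mk n))}
    (hP : ∀ (h : H), ∀ c ∈ P, chainRep k H Y _ h c ∈ P) (hF : F ⊆ P) : eqSpan k H F ≤ P := by
  intro c hc
  exact Submodule.span_le (M := EqChains k H Y n) (R := MonoidAlgebra k H)
    (p := Subrepresentation.asSubmodule ⟨P, fun h c hc => hP h c hc⟩) |>.2 hF hc

theorem chainRep_mem_chainsIn {A : Set Y} (hA : ∀ (h : H), ∀ x ∈ A, h • x ∈ A) {n : ℕ} (h : H)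
    {c : Chains k Y (.mk n)} (hc : c ∈ chainsIn k A n) :
    chainRep k H Y _ h c ∈ chainsIn k A n := by
  suffices h' : chainsIn k A n ≤ (chainsIn k A n).comap (chainRep k H Y _ h) from h' hc
  refine chainsIn_le k fun σ hσ => ?_
  rw [Submodule.mem_comap, chainRep_single]
  exact single_mem_chainsIn k (σ := h • σ) _ fun x => hA h _ (hσ x)

theorem chainRep_mem_boundariesIn {A : Set Y} (hA : ∀ (h : H), ∀ x ∈ A, h • x ∈ A) {n : ℕ} (h : H)
    {c : Chains k Y (.mk n)} (hc : c ∈ boundariesIn k A n) :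
    chainRep k H Y _ h c ∈ boundariesIn k A n := by
  obtain ⟨w, hw, rfl⟩ := hc
  exact ⟨chainRep k H Y _ h w, chainRep_mem_chainsIn hA h hw, singBoundary_chainRep _ _ _⟩

theorem chainRep_pointChain (h : H) (y : Y) :
    chainRep k H Y _ h (pointChain k y) = pointChain k (h • y) :=
  chainRep_single k H 0 h _ 1

/-- If `a` and `b` are homologous, then the `0`-chains on the orbit of `a` are homologous to
`0`-chains on the orbit of `b`. -/
theorem chainsIn_orbit_le {A : Set Y} {a b : Y} (hA : A = MulAction.orbit H a) {B : Set Y}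
    (hb : b ∈ B) (hB : ∀ (h : H), ∀ x ∈ B, h • x ∈ B)
    {F : Set (Chains k Y (.mk 0))} (hF : pointChain k b - pointChain k a ∈ F) :
    chainsIn k A 0 ≤ chainsIn k B 0 ⊔ eqSpan k H F := by
  refine chainsIn_zero_le k fun y hy => ?_
  rw [hA] at hy
  obtain ⟨h, rfl⟩ := hy
  have h1 := chainRep_mem_eqSpan k H h (subset_eqSpan k H hF)
  rw [map_sub, chainRep_pointChain, chainRep_pointChain] at h1
  rw [← sub_sub_cancel (pointChain k (h • b)) (pointChain k ((fun y => h • y) a))]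
  exact sub_mem (Submodule.mem_sup_left (pointChain_mem k (hB h b hb)))
    (Submodule.mem_sup_right h1)

variable {X : Type*} [TopologicalSpace X] [T2Space X] {q : Y → X}
  {φ : (Fin 1 → ℝ) → X} {A B : Set X}

omit [T2Space X] in
/-- The boundaries in an arc, in terms of the ends of the arc. -/
theorem boundariesIn_arc_le {g : (Fin 1 → ℝ) → X} (hq : IsQuotientCoveringMap q H)
    (hg : Topology.IsEmbedding g) : ∃ a ∈ q ⁻¹' (g '' {0}ᶜ), ∃ b ∈ q ⁻¹' (g '' {0}ᶜ),
      chainsIn k (q ⁻¹' (g '' {0}ᶜ)) 0 ⊓ boundariesIn k (q ⁻¹' (g '' Set.univ)) 0 ≤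
        boundariesIn k (q ⁻¹' (g '' {0}ᶜ)) 0 ⊔ eqSpan k H {pointChain k b - pointChain k a} := by
  have hcov := hq.isCoveringMap
  let c : ℝ → Fin 1 → ℝ := fun s => Pi.single 0 s
  have hun : nonzeroBeforeOr 1 (0 : Fin 1) ∪ nonzeroBeforeOr (-1) (0 : Fin 1) = {0}ᶜ := by
    rw [nonzeroBeforeOr_union, ← nonzeroBefore_self]
    rfl
  have hc (s : ℝ) (hs : s ≠ 0) : c s ∈ nonzeroBeforeOr s 0 := single_mem_nonzeroBeforeOr hs _
  have hst (s : ℝ) (hs : s ≠ 0) : StarConvex ℝ (c s) (nonzeroBeforeOr s 0) :=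
    starConvex_nonzeroBeforeOr hs _
  have hfib (s : ℝ) (hs : s ≠ 0) : c s ∈ ({0}ᶜ : Set (Fin 1 → ℝ)) := fun h0 => hs (by
    simpa [c] using congrFun h0 0)
  -- The point `a` lies over one half of the arc, and `b` lies over the other half, at the end of
  -- the arc lifted from `a`.
  obtain ⟨a, ha⟩ := hq.surjective (g (c (-1)))
  obtain ⟨b, hb, hab⟩ := ((Deformation.ofStarConvex hg (Set.mem_univ (c 1))
    (starConvex_univ _)).lift hcov).exists_pointChain_sub_mem k (u := a)
    ⟨c (-1), Set.mem_univ _, ha.symm⟩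
  refine ⟨a, ⟨_, hfib _ (by norm_num), ha.symm⟩, b, ⟨_, hfib _ one_ne_zero, hb.symm⟩, ?_⟩
  rintro x ⟨hx, hx'⟩
  have hsub : (q ⁻¹' (g '' {0}ᶜ)) ⊆ q ⁻¹' (g '' Set.univ) :=
    Set.preimage_mono (Set.image_mono (Set.subset_univ _))
  have hend (s : ℝ) (hs : s ≠ 0) (hs' : nonzeroBeforeOr s (0 : Fin 1) ⊆ {0}ᶜ) :
      chainsIn k (q ⁻¹' (g '' nonzeroBeforeOr s 0)) 0 ≤
        chainsIn k (q ⁻¹' {g (c s)}) 0 ⊔ boundariesIn k (q ⁻¹' (g '' {0}ᶜ)) 0 := by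
    intro z hz
    have h1 := starConvex_homologySurj k hcov hg (hc s hs) (hst s hs) 0
      ((mem_cyclesIn_zero k).2 hz)
    exact sup_le_sup inf_le_left
      (boundariesIn_mono k (Set.preimage_mono (Set.image_mono hs')) 0) h1
  have hpos := hend 1 one_ne_zero (hun ▸ Set.subset_union_left)
  have hneg := hend (-1) (by norm_num) (hun ▸ Set.subset_union_right)
  have horb : q ⁻¹' {g (c (-1))} = MulAction.orbit H a := by
    rw [← ha, fiber_eq_orbit hq]
  have hneg' := chainsIn_orbit_le (F := {pointChain k b - pointChain k a}) horb hb
    (preimage_invariant hq _) rfl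
  -- Modulo boundaries each half of the arc is concentrated over one point. Translates of `b - a`
  -- then move everything into the fibre over `c 1`.
  have hle : chainsIn k (q ⁻¹' (g '' {0}ᶜ)) 0 ≤ chainsIn k (q ⁻¹' {g (c 1)}) 0 ⊔
      (boundariesIn k (q ⁻¹' (g '' {0}ᶜ)) 0 ⊔
        eqSpan k H {pointChain k b - pointChain k a}) := by
    refine chainsIn_zero_le k fun y hy => ?_
    rw [← hun, Set.image_union] at hy
    rcases hy with hy | hy
    · exact (hpos.trans (sup_le_sup_left le_sup_left _)) (pointChain_mem k hy)
    · exact (hneg.trans (sup_le (hneg'.trans (sup_le_sup_left le_sup_right _))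
        (le_sup_left.trans le_sup_right))) (pointChain_mem k hy)
  obtain ⟨y, hy, z, hz, rfl⟩ := Submodule.mem_sup.1 (hle hx)
  have hz' : z ∈ boundariesIn k (q ⁻¹' (g '' Set.univ)) 0 := by
    refine sup_le (boundariesIn_mono k hsub 0) (eqSpan_le
      (fun h c hc => chainRep_mem_boundariesIn (preimage_invariant hq _) h hc) ?_) hz
    exact Set.singleton_subset_iff.2 hab
  have hy' : y ∈ boundariesIn k (q ⁻¹' (g '' Set.univ)) 0 := by
    simpa using sub_mem hx' hz'
  -- What is left lies in one fibre and bounds over the arc. The arc deforms to this fibre, where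
  -- there are no nonzero boundaries in degree zero.
  have h0 := ((Deformation.ofStarConvex hg (Set.mem_univ (c 1))
    (starConvex_univ _)).lift hcov).homologyInj 0 ⟨hy, hy'⟩
  rw [(hasConstantSimplices_fiber hcov _).boundariesIn_zero k, Submodule.mem_bot] at h0
  rwa [h0, zero_add]

/-- The same edge is attached both to `A` and to the smaller set `B`. Excision for `A` reduces the
claim to the arc. The two points of the arc are then pushed radially to the ends of the edge;
performing this push for `B` keeps the ends over `B`. -/
theorem IsCellAttachment.boundariesIn_le (hA : IsCellAttachment φ A) (hB : IsCellAttachment φ B)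
    (hBA : B ⊆ A) (hq : IsQuotientCoveringMap q H) : ∃ a b : Y, a ∈ q ⁻¹' B ∧ b ∈ q ⁻¹' B ∧
      chainsIn k (q ⁻¹' A) 0 ⊓ boundariesIn k (q ⁻¹' (A ∪ φ '' Metric.closedBall 0 1)) 0 ≤
        boundariesIn k (q ⁻¹' A) 0 ⊔ eqSpan k H {pointChain k b - pointChain k a} := by
  have hcov := hq.isCoveringMap
  obtain ⟨a, ha, b, hb, hab⟩ := boundariesIn_arc_le (k := k) (H := H) hq hB.isEmbedding_openParam
  rw [← nonzeroBefore_self] at ha hb hab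
  have hex := hA.isExcisive k hcov.continuous
  have hUV := hA.preimage_inter (q := q)
  have hPB : q ⁻¹' IsCellAttachment.punctured φ B ⊆ q ⁻¹' IsCellAttachment.punctured φ A :=
    Set.preimage_mono (Set.sdiff_subset_sdiff_left (Set.union_subset_union_left _ hBA))
  rw [← hB.preimage_inter] at ha hb
  obtain ⟨a', ha', haa⟩ := (hB.deformation.lift hcov).exists_pointChain_sub_mem k ha.1
  obtain ⟨b', hb', hbb⟩ := (hB.deformation.lift hcov).exists_pointChain_sub_mem k hb.1
  refine ⟨a', b', ha', hb', ?_⟩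
  rintro x ⟨hx, hx'⟩
  have hAU := (hA.deformation.lift hcov).subset
  obtain ⟨u, hu, v, hv, rfl⟩ := hex.exists_add_of_boundary (chainsIn_mono k hAU 0 hx) hx'
  have hv' : singBoundary k Y 0 v ∈ chainsIn k (q ⁻¹' IsCellAttachment.punctured φ A ∩
      q ⁻¹' (IsCellAttachment.openParam φ '' Set.univ)) 0 := by
    rw [chainsIn_inter]
    refine ⟨?_, singBoundary_mem k hv⟩
    simpa using sub_mem (chainsIn_mono k hAU 0 hx) (singBoundary_mem k hu)
  rw [hUV] at hv'
  have h1 := hab ⟨hv', Submodule.mem_map_of_mem hv⟩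
  rw [← hUV] at h1
  have h2 : eqSpan k H {pointChain k b - pointChain k a} ≤
      boundariesIn k (q ⁻¹' IsCellAttachment.punctured φ A) 0 ⊔
        eqSpan k H {pointChain k b' - pointChain k a'} := by
    refine eqSpan_le (fun h c hc => ?_) ?_
    · obtain ⟨y, hy, z, hz, rfl⟩ := Submodule.mem_sup.1 hc
      rw [map_add]
      exact Submodule.add_mem_sup (chainRep_mem_boundariesIn (preimage_invariant hq _) h hy)
        (chainRep_mem_eqSpan k H h hz)
    · rw [Set.singleton_subset_iff]
      have : pointChain k b - pointChain k a = (pointChain k a' - pointChain k a) -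
        (pointChain k b' - pointChain k b) + (pointChain k b' - pointChain k a') := by abel
      rw [this]
      exact Submodule.add_mem_sup (boundariesIn_mono k hPB 0 (sub_mem haa hbb))
        (subset_eqSpan k H rfl)
  obtain ⟨y, hy, z, hz, hyz⟩ := Submodule.mem_sup.1
    (sup_le ((boundariesIn_mono k Set.inter_subset_left 0).trans le_sup_left) h2 h1)
  rw [← hyz, ← add_assoc]
  refine Submodule.add_mem_sup ((hA.deformation.lift hcov).homologyInj 0 ⟨?_,
    add_mem (Submodule.mem_map_of_mem hu) hy⟩) hz
  have hz' : z ∈ chainsIn k (q ⁻¹' A) 0 := by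
    refine eqSpan_le (fun h c hc => chainRep_mem_chainsIn (preimage_invariant hq _) h hc) ?_ hz
    exact Set.singleton_subset_iff.2 (sub_mem (pointChain_mem k (hBA hb'))
      (pointChain_mem k (hBA ha')))
  have := sub_mem hx hz'
  rwa [← hyz, ← add_assoc, add_sub_cancel_right] at this

open Topology Topology.RelCWComplex in
/-- The boundaries between the vertices of a finite subcomplex of dimension one are generated over
the group ring by finitely many differences of points. -/
theorem exists_finite_boundariesIn_le [CWComplex (Set.univ : Set X)]
    (hq : IsQuotientCoveringMap q H) {s t : Set (Cells X)} (hs : IsFiniteSubcomplex s)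
    (ht : IsFiniteSubcomplex t) (hst : s ⊆ t) (hs0 : ∀ c, c ∈ s ↔ c.1 = 0)
    (ht1 : ∀ c ∈ t, c.1 ≤ 1) : ∃ T : Set (Y × Y), T.Finite ∧
      chainsIn k (q ⁻¹' carrier s) 0 ⊓ boundariesIn k (q ⁻¹' carrier t) 0 ≤
        boundariesIn k (q ⁻¹' carrier s) 0 ⊔
          eqSpan k H ((fun z : Y × Y => pointChain k z.2 - pointChain k z.1) '' T) := by
  refine hs.induction (P := fun t => ∃ T : Set (Y × Y), T.Finite ∧
      chainsIn k (q ⁻¹' carrier s) 0 ⊓ boundariesIn k (q ⁻¹' carrier t) 0 ≤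
        boundariesIn k (q ⁻¹' carrier s) 0 ⊔
          eqSpan k H ((fun z : Y × Y => pointChain k z.2 - pointChain k z.1) '' T)) ht hst
    ⟨∅, Set.finite_empty, inf_le_right.trans le_sup_left⟩ ?_
  rintro r ⟨n, c⟩ hsr hct hcr hr hfr ⟨T, hT, hTle⟩
  have hcs : (⟨n, c⟩ : Cells X) ∉ s := fun h => hcr (hsr h)
  obtain rfl : n = 1 := by
    have h1 : n ≤ 1 := ht1 _ hct
    have h2 : n ≠ 0 := fun h => hcs ((hs0 _).2 h)
    omega
  have hfs : cellFrontier 1 c ⊆ carrier s := by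
    intro x hx
    obtain ⟨d, hd, hxd⟩ := exists_dim_lt_of_mem_cellFrontier (c := ⟨1, c⟩) hx
    exact mem_carrier.2 ⟨d, (hs0 d).2 (Nat.lt_one_iff.1 hd), hxd⟩
  -- The edge is attached to the current graph and also to the set of vertices, so the new generator
  -- is a difference of points over vertices.
  obtain ⟨a, b, ha, hb, hab⟩ := (isCellAttachment hr hcr hfr).boundariesIn_le (k := k) (H := H)
    (isCellAttachment hs hcs hfs) (carrier_mono hsr) hq
  refine ⟨insert (a, b) T, hT.insert _, ?_⟩
  rw [carrier_insert_eq hfr, Set.image_insert_eq]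
  rintro x ⟨hx, hx'⟩
  have hsr' := chainsIn_mono k (Set.preimage_mono (f := q) (carrier_mono hsr)) 0
  obtain ⟨y, hy, z, hz, rfl⟩ := Submodule.mem_sup.1 (hab ⟨hsr' hx, hx'⟩)
  have hz' : z ∈ chainsIn k (q ⁻¹' carrier s) 0 := by
    refine eqSpan_le (fun h c hc => chainRep_mem_chainsIn (preimage_invariant hq _) h hc) ?_ hz
    exact Set.singleton_subset_iff.2 (sub_mem (pointChain_mem k hb) (pointChain_mem k ha))
  have hy' : y ∈ chainsIn k (q ⁻¹' carrier s) 0 := by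
    simpa using sub_mem hx hz'
  refine add_mem (sup_le_sup_left (eqSpan_mono k H (Set.subset_insert _ _)) _
    (hTle ⟨hy', hy⟩)) (Submodule.mem_sup_right (eqSpan_mono k H ?_ hz))
  exact Set.singleton_subset_iff.2 (Set.mem_insert _ _)

-- A cell of least dimension has dimension zero: otherwise its frontier would be nonempty and
-- covered by cells of smaller dimension.
open Topology Topology.RelCWComplex in
omit [T2Space X] in
theorem exists_zero_cell [CWComplex (Set.univ : Set X)] (x : X) :
    ∃ c : Cells X, c.1 = 0 := by
  obtain ⟨c, -⟩ := exists_mem_openCell x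
  obtain ⟨n, hn, hmin⟩ : ∃ n, (∃ c : Cells X, c.1 = n) ∧ ∀ m < n, ¬ ∃ c : Cells X, c.1 = m := by
    classical
    have h : ∃ n, ∃ c : Cells X, c.1 = n := ⟨_, c, rfl⟩
    exact ⟨Nat.find h, Nat.find_spec h, fun m hm => Nat.find_min h hm⟩
  obtain ⟨d, rfl⟩ := hn
  refine ⟨d, by_contra fun h0 => ?_⟩
  obtain ⟨y, hy⟩ := CWComplex.nonempty_cellFrontier h0 d.2
  obtain ⟨e, he, -⟩ := exists_dim_lt_of_mem_cellFrontier hy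
  exact hmin _ he ⟨e, rfl⟩

/-- The position of a point in its fibre, relative to a chosen point of the fibre. -/
def fiberLabel (hq : IsQuotientCoveringMap q H) (y : Y) : H :=
  (hq.apply_eq_iff_mem_orbit.1 (Function.surjInv_eq hq.surjective (q y)).symm).choose

omit [T2Space X] [ContinuousConstSMul H Y] in
theorem fiberLabel_smul_surjInv (hq : IsQuotientCoveringMap q H) (y : Y) :
    fiberLabel hq y • Function.surjInv hq.surjective (q y) = y :=
  (hq.apply_eq_iff_mem_orbit.1 (Function.surjInv_eq hq.surjective (q y)).symm).choose_spec

end Edges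

/-! ### The group of a Galois cover of a CW complex with finite 1-skeleton -/

section GroupFG

open Topology Topology.RelCWComplex

variable {X : Type*} [TopologicalSpace X] {Y : Type*} [TopologicalSpace Y] {q : Y → X}
  {H : Type*} [CommGroup H] [MulAction H Y]

/-- The chosen point of a fibre depends only on the image in `X`, and the action is free. -/
theorem fiberLabel_smul (hq : IsQuotientCoveringMap q H) (h : H) (y : Y) :
    fiberLabel hq (h • y) = h * fiberLabel hq y := by
  have h1 := fiberLabel_smul_surjInv hq (h • y)
  have h2 := fiberLabel_smul_surjInv hq y
  rw [hq.map_smul] at h1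
  have := hq.isCancelSMul
  refine IsCancelSMul.right_cancel _ _ (Function.surjInv hq.surjective (q y)) ?_
  rw [h1, mul_smul, h2]

theorem hasConstantSimplices_of_finite [T2Space X] (hq : IsCoveringMap q) {F : Set X}
    (hF : F.Finite) : HasConstantSimplices (q ⁻¹' F) := by
  intro n σ hσ a b
  have : PreconnectedSpace (stdSimplex ℝ (Fin (n + 1))) :=
    Subtype.preconnectedSpace (convex_stdSimplex ℝ _).isPreconnected
  have hFd : IsDiscrete F := hF.isDiscrete
  refine hasConstantSimplices_fiber hq (q (σ a)) n σ (fun x => ?_) a b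
  exact isPreconnected_univ.constant_of_mapsTo (S := Set.univ) hFd (f := fun x => q (σ x))
    (hq.continuous.comp σ.continuous).continuousOn (fun x _ => hσ x) (Set.mem_univ x)
    (Set.mem_univ a)

/-- The sum of the coefficients of a `0`-chain, sorted by the classes of the labels. -/
def labelSum (k : Type*) [Field k] (hq : IsQuotientCoveringMap q H) (S : Subgroup H) :
    Chains k Y (.mk 0) →ₗ[k] (H ⧸ S →₀ k) :=
  Finsupp.lmapDomain k k fun σ => QuotientGroup.mk (s := S) (fiberLabel hq (σ (stdSimplex.vertex 0)))

theorem labelSum_pointChain (k : Type*) [Field k] (hq : IsQuotientCoveringMap q H)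
    (S : Subgroup H) (y : Y) :
    labelSum k hq S (pointChain k y) = Finsupp.single (QuotientGroup.mk (s := S) (fiberLabel hq y)) 1 :=
  Finsupp.mapDomain_single

variable [ContinuousConstSMul H Y]

theorem labelSum_chainRep_eq_zero (k : Type*) [Field k] (hq : IsQuotientCoveringMap q H)
    (S : Subgroup H) (h : H) {c : Chains k Y (.mk 0)} (hc : labelSum k hq S c = 0) :
    labelSum k hq S (chainRep k H Y _ h c) = 0 := by
  have : labelSum k hq S (chainRep k H Y _ h c) =
      Finsupp.mapDomain ((h : H ⧸ S) * ·) (labelSum k hq S c) := by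
    simp only [labelSum, chainRep, MonoidHom.coe_mk, OneHom.coe_mk, Finsupp.lmapDomain_apply,
      ← Finsupp.mapDomain_comp]
    congr 1
    ext σ
    exact congrArg _ (fiberLabel_smul hq h _)
  rw [this, hc, Finsupp.mapDomain_zero]

/-- The group of deck transformations of a connected Galois cover of a CW complex with finite
`1`-skeleton is finitely generated. -/
theorem group_fg_of_finite_one_skeleton [T2Space X] [CWComplex (Set.univ : Set X)]
    [PathConnectedSpace Y] (hq : IsQuotientCoveringMap q H)
    (hfin : ∀ j ≤ 1, Finite (RelCWComplex.cell (Set.univ : Set X) j)) : Group.FG H := by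
  have hs := isFiniteSubcomplex_skeleton (X := X) (n := 0) fun j hj => hfin j (by omega)
  have ht := isFiniteSubcomplex_skeleton (X := X) (n := 1) hfin
  obtain ⟨T, hT, hTle⟩ := exists_finite_boundariesIn_le (k := ℚ) hq hs ht
    (fun c hc => le_trans (show c.1 ≤ 0 from hc) zero_le_one) (fun c => Nat.le_zero) (fun c hc => hc)
  have hF : (carrier {c : Cells X | c.1 ≤ 0}).Finite := by
    refine hs.finite.biUnion fun c hc => ?_
    obtain ⟨n, c⟩ := c
    obtain rfl : n = 0 := Nat.le_zero.1 hc
    rw [openCell_zero_eq_singleton]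
    exact Set.finite_singleton _
  rw [(hasConstantSimplices_of_finite hq.isCoveringMap hF).boundariesIn_zero ℚ, bot_sup_eq] at hTle
  -- For each chosen edge relation, the generator compares the labels of its two ends. Modulo `S`
  -- both ends of each relation carry the same label.
  let S : Subgroup H := Subgroup.closure
    ((fun z : Y × Y => (fiberLabel hq z.1)⁻¹ * fiberLabel hq z.2) '' T)
  suffices hS : S = ⊤ from Group.fg_iff.2 ⟨_, hS, hT.image _⟩
  have hker : eqSpan ℚ H ((fun z : Y × Y => pointChain ℚ z.2 - pointChain ℚ z.1) '' T) ≤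
      LinearMap.ker (labelSum ℚ hq S) := by
    refine eqSpan_le (fun h c hc => labelSum_chainRep_eq_zero ℚ hq S h hc) ?_
    rintro _ ⟨z, hz, rfl⟩
    rw [SetLike.mem_coe, LinearMap.mem_ker, map_sub, labelSum_pointChain, labelSum_pointChain,
      sub_eq_zero]
    congr 1
    have hmem : (fiberLabel hq z.1)⁻¹ * fiberLabel hq z.2 ∈ S :=
      Subgroup.subset_closure ⟨z, hz, rfl⟩
    exact (QuotientGroup.eq.2 hmem).symm
  obtain ⟨y₀⟩ : Nonempty Y := inferInstance
  obtain ⟨⟨n, c⟩, hc0⟩ := exists_zero_cell (q y₀)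
  obtain ⟨y, hy⟩ := hq.surjective (map n c 0)
  have hyS : y ∈ q ⁻¹' carrier {c : Cells X | c.1 ≤ 0} :=
    mem_carrier.2 ⟨⟨n, c⟩, hc0.le, hy ▸ map_zero_mem_openCell n c⟩
  refine (Subgroup.eq_top_iff' S).2 fun h => ?_
  -- Connectedness makes `h • y` and `y` homologous in the cover. They are then homologous over the
  -- 1-skeleton, so their difference is a combination of edge relations and has label sum zero.
  -- Hence `h` lies in `S`.
  have hmem : pointChain ℚ (h • y) - pointChain ℚ y ∈
      chainsIn ℚ (q ⁻¹' carrier {c : Cells X | c.1 ≤ 0}) 0 :=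
    sub_mem (pointChain_mem ℚ (preimage_invariant hq _ h y hyS)) (pointChain_mem ℚ hyS)
  have hbd := pointChain_sub_mem ℚ (A := Set.univ) (PathConnectedSpace.somePath y (h • y))
    fun _ => Set.mem_univ _
  have hle : q ⁻¹' carrier {c : Cells X | c.1 ≤ 0} ⊆ q ⁻¹' carrier {c : Cells X | c.1 ≤ 1} :=
    Set.preimage_mono (carrier_mono fun c hc => le_trans (show c.1 ≤ 0 from hc) zero_le_one)
  have hbd' := homologyInj_univ ℚ hq.isCoveringMap ht (n := 0) (fun c hc => not_le.1 hc)
    ⟨chainsIn_mono ℚ hle 0 hmem, hbd⟩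
  have h0 := hker (hTle ⟨hmem, hbd'⟩)
  rw [LinearMap.mem_ker, map_sub, labelSum_pointChain, labelSum_pointChain, sub_eq_zero,
    fiberLabel_smul] at h0
  have h1 := Finsupp.single_left_injective (one_ne_zero (α := ℚ)) h0
  have h2 := QuotientGroup.eq.1 h1.symm
  rwa [mul_comm h, inv_mul_cancel_left] at h2

theorem isNoetherianRing_monoidAlgebra (k : Type*) [Field k] (H : Type*) [CommGroup H]
    [Group.FG H] : IsNoetherianRing (MonoidAlgebra k H) := by
  have : Monoid.FG H := Group.fg_iff_monoid_fg.1 inferInstance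
  have : Algebra.FiniteType k (MonoidAlgebra k H) := inferInstance
  exact Algebra.FiniteType.isNoetherianRing k _

end GroupFG

/-! ### Complexes of projective modules modulo an ideal -/

section ModIdeal

variable {R : Type*} [CommRing R] {C : ℕ → Type*} [∀ n, AddCommGroup (C n)] [∀ n, Module R (C n)]
  (d : ∀ n, C (n + 1) →ₗ[R] C n)

/-- The chains the boundary of which lies in given submodules. -/
def relativeCycles (P : ∀ n, Submodule R (C n)) : ∀ n, Submodule R (C n)
  | 0 => ⊤
  | n + 1 => (P n).comap (d n)

/-- The homology in degree `n` of the complex relative to given submodules vanishes. -/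
def RelativelyExact (P : ∀ n, Submodule R (C n)) (n : ℕ) : Prop :=
  relativeCycles d P n ≤ LinearMap.range (d n) ⊔ P n

/-- The multiples of the elements of an ideal. -/
def idealMultiples (C : ℕ → Type*) [∀ n, AddCommGroup (C n)] [∀ n, Module R (C n)] (I : Ideal R)
    (n : ℕ) : Submodule R (C n) := I • ⊤

/-- The homology in degree `n` agrees with its multiple by the ideal `I`. -/
def HomologyEqSMul (I : Ideal R) (n : ℕ) : Prop :=
  relativeCycles d (fun _ => ⊥) n ≤ I • relativeCycles d (fun _ => ⊥) n ⊔ LinearMap.range (d n)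

/-- The homology in degree `n` is finitely generated. -/
def HomologyFinite (n : ℕ) : Prop :=
  ∃ S : Submodule R (C n), S.FG ∧ S ≤ relativeCycles d (fun _ => ⊥) n ∧
    relativeCycles d (fun _ => ⊥) n ≤ S ⊔ LinearMap.range (d n)

/-- A retraction of the chains to the cycles, up to an element which is congruent to `1`. -/
structure IsCycleRetraction (I : Ideal R) (n : ℕ) (e : R) (f : C n →ₗ[R] C n) : Prop where
  sub_one_mem : e - 1 ∈ I
  mem_cycles (c : C n) : f c ∈ relativeCycles d (fun _ => ⊥) n
  apply_cycle (c : C n) : c ∈ relativeCycles d (fun _ => ⊥) n → f c = e • c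
  apply_mod (c : C n) : c ∈ relativeCycles d (idealMultiples C I) n →
    f c - e • c ∈ idealMultiples C I n

variable {d}

theorem isCycleRetraction_zero (I : Ideal R) :
    IsCycleRetraction d I 0 1 (LinearMap.id : C 0 →ₗ[R] C 0) where
  sub_one_mem := by simp
  mem_cycles _ := Submodule.mem_top
  apply_cycle c _ := (one_smul R c).symm
  apply_mod c _ := by simp

theorem relativeCycles_mono {P Q : ∀ n, Submodule R (C n)} (h : ∀ n, P n ≤ Q n) (n : ℕ) :
    relativeCycles d P n ≤ relativeCycles d Q n := by
  cases n with
  | zero => exact le_rfl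
  | succ n => exact Submodule.comap_mono (h n)

theorem map_mem_smul {M N : Type*} [AddCommGroup M] [AddCommGroup N] [Module R M] [Module R N]
    (f : M →ₗ[R] N) (I : Ideal R) {P : Submodule R N} (hf : ∀ x, f x ∈ P) {c : M}
    (hc : c ∈ (I • ⊤ : Submodule R M)) : f c ∈ I • P := by
  have h := Submodule.mem_map_of_mem (f := f) hc
  rw [Submodule.map_smul''] at h
  refine Submodule.smul_mono le_rfl ?_ h
  rintro _ ⟨x, -, rfl⟩
  exact hf x

/-- Replaces localization: a factor congruent to `1` can be cancelled modulo multiples of `I`. -/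
theorem mem_of_smul_mem {M : Type*} [AddCommGroup M] [Module R M] {I : Ideal R} {e : R}
    (he : e - 1 ∈ I) {P Q : Submodule R M} {c : M} (hc : c ∈ P) (hQ : I • P ≤ Q)
    (h : e • c ∈ Q) : c ∈ Q := by
  have h1 : e • c - (e - 1) • c = c := by rw [sub_smul, one_smul, sub_sub_cancel]
  rw [← h1]
  exact sub_mem h (hQ (Submodule.smul_mem_smul he hc))

/-- A cycle is a boundary plus some c in IC, and c is itself a cycle. The retraction shows that ec =
f(c) lies in I times the cycles, not merely in IC. -/
theorem HomologyEqSMul.of_relativelyExact {I : Ideal R} {n : ℕ} {e : R} {f : C n →ₗ[R] C n}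
    (hd : ∀ m c, d m (d (m + 1) c) = 0)
    (hf : IsCycleRetraction d I n e f) (h : RelativelyExact d (idealMultiples C I) n) :
    HomologyEqSMul d I n := by
  intro z hz
  have hrange : LinearMap.range (d n) ≤ relativeCycles d (fun _ => ⊥) n := by
    rintro _ ⟨c, rfl⟩
    cases n with
    | zero => exact Submodule.mem_top
    | succ n => exact hd n c
  obtain ⟨b, hb, c, hc, rfl⟩ := Submodule.mem_sup.1
    (h (relativeCycles_mono (fun n => bot_le) n hz))
  have hc' : c ∈ relativeCycles d (fun _ => ⊥) n := by
    simpa using sub_mem hz (hrange hb)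
  rw [add_comm b c]
  refine Submodule.add_mem_sup (mem_of_smul_mem hf.sub_one_mem hc' le_rfl ?_) hb
  rw [← hf.apply_cycle c hc']
  exact map_mem_smul f I hf.mem_cycles hc

/-- Nakayama's lemma for the homology, seen as the image of the cycles modulo boundaries. -/
theorem exists_smul_cycle_mem_range {I : Ideal R} {n : ℕ} (hfin : HomologyFinite d n)
    (h : HomologyEqSMul d I n) : ∃ e : R, e - 1 ∈ I ∧
      ∀ z ∈ relativeCycles d (fun _ => ⊥) n, e • z ∈ LinearMap.range (d n) := by
  obtain ⟨S, hS, hSZ, hZS⟩ := hfin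
  let π := (LinearMap.range (d n)).mkQ
  have hmap : (relativeCycles d (fun _ => ⊥) n).map π = S.map π := by
    refine le_antisymm ((Submodule.map_mono hZS).trans ?_) (Submodule.map_mono hSZ)
    rw [Submodule.map_sup, Submodule.mkQ_map_self, sup_bot_eq]
  have hle : S.map π ≤ I • S.map π := by
    rw [← hmap, ← Submodule.map_smul'']
    refine (Submodule.map_mono h).trans ?_
    rw [Submodule.map_sup, Submodule.mkQ_map_self, sup_bot_eq]
  obtain ⟨e, he, he0⟩ := Submodule.exists_sub_one_mem_and_smul_eq_zero_of_fg_of_le_smul I _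
    (hS.map π) hle
  refine ⟨e, he, fun z hz => ?_⟩
  have h1 := he0 (π z) (hmap ▸ Submodule.mem_map_of_mem hz)
  rwa [← map_smul, ← LinearMap.mem_ker, Submodule.ker_mkQ] at h1

variable [∀ n, Module.Projective R (C n)]

/-- Let e₁ ≡ 1 annihilate the homology. Then e₁f maps to the boundaries, so by projectivity e₁f = ds
for some s. The new retraction is e₁e - sd: it lands in the cycles because dsd = e₁fd = e₁ed, and it
differs from e₁e by sd, which vanishes on cycles and preserves multiples of I. For a cycle c modulo
I, the congruence e₁ec ≡ e₁f(c) = ds(c) shows that c is a boundary modulo I. -/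
theorem exists_isCycleRetraction_succ {I : Ideal R} {n : ℕ} {e : R} {f : C n →ₗ[R] C n}
    (hd : ∀ m c, d m (d (m + 1) c) = 0)
    (hf : IsCycleRetraction d I n e f) (hfin : HomologyFinite d n) (h : HomologyEqSMul d I n) :
    RelativelyExact d (idealMultiples C I) n ∧ ∃ e' f', IsCycleRetraction d I (n + 1) e' f' := by
  obtain ⟨e₁, he₁, hrange⟩ := exists_smul_cycle_mem_range hfin h
  let g : C n →ₗ[R] LinearMap.range (d n) :=
    (e₁ • f).codRestrict _ fun c => hrange _ (hf.mem_cycles c)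
  obtain ⟨s, hs⟩ := Module.projective_lifting_property (d n).rangeRestrict g
    (d n).surjective_rangeRestrict
  have hs' (c : C n) : d n (s c) = e₁ • f c := congrArg Subtype.val (LinearMap.congr_fun hs c)
  have hee : e₁ * e - 1 ∈ I := by
    have : e₁ * e - 1 = e₁ * (e - 1) + (e₁ - 1) := by ring
    rw [this]
    exact add_mem (I.mul_mem_left _ hf.sub_one_mem) he₁
  have hsmul (m : ℕ) (x : R) (c : C m) (hc : c ∈ idealMultiples C I m) :
      x • c ∈ idealMultiples C I m := Submodule.smul_mem _ _ hc
  refine ⟨fun c hc => ?_, e₁ * e, (e₁ * e) • LinearMap.id - s ∘ₗ d n, hee, fun c => ?_,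
    fun c hc => ?_, fun c hc => ?_⟩
  · refine mem_of_smul_mem hee (P := ⊤) Submodule.mem_top le_sup_right ?_
    have h1 : (e₁ * e) • c = d n (s c) + (-(e₁ • (f c - e • c))) := by
      rw [hs', mul_smul, smul_sub]
      abel
    rw [h1]
    exact Submodule.add_mem_sup ⟨_, rfl⟩ (neg_mem (hsmul _ _ _ (hf.apply_mod c hc)))
  · change d n ((e₁ * e) • c - s (d n c)) = 0
    have hdc : d n c ∈ relativeCycles d (fun _ => ⊥) n := by
      cases n with
      | zero => exact Submodule.mem_top
      | succ n => exact hd n c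
    rw [map_sub, hs', hf.apply_cycle _ hdc, map_smul, mul_smul, sub_self]
  · change (e₁ * e) • c - s (d n c) = _
    rw [show d n c = 0 from hc, map_zero, sub_zero]
  · change (e₁ * e) • c - s (d n c) - (e₁ * e) • c ∈ _
    rw [sub_sub_cancel_left]
    exact neg_mem (map_mem_smul s I (fun _ => Submodule.mem_top) hc)

/-- For a complex of projective modules with finitely generated homology up to degree `N`, the
homology up to degree `N` agrees with its multiple by an ideal `I` if and only if the homology of
the reduction modulo `I` vanishes up to degree `N`. -/
theorem forall_homologyEqSMul_iff (hd : ∀ m c, d m (d (m + 1) c) = 0) (I : Ideal R) {N : ℕ}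
    (hfin : ∀ n ≤ N, HomologyFinite d n) :
    (∀ n ≤ N, HomologyEqSMul d I n) ↔ ∀ n ≤ N, RelativelyExact d (idealMultiples C I) n := by
  -- A retraction in degree `n` needs information only in degrees below `n`; hence both implications
  -- go by induction on the degree.
  have key : ∀ n, (∀ i < n, i ≤ N → HomologyEqSMul d I i) → n ≤ N + 1 →
      ∃ e f, IsCycleRetraction d I n e f := by
    intro n
    induction n with
    | zero => exact fun _ _ => ⟨_, _, isCycleRetraction_zero I⟩
    | succ n ih =>
      intro h hn
      obtain ⟨e, f, hf⟩ := ih (fun i hi => h i (by omega)) (by omega)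
      exact (exists_isCycleRetraction_succ hd hf (hfin n (by omega))
        (h n (by omega) (by omega))).2
  constructor
  · intro h n hn
    obtain ⟨e, f, hf⟩ := key n (fun i _ => h i) (by omega)
    exact (exists_isCycleRetraction_succ hd hf (hfin n hn) (h n hn)).1
  · intro h n
    induction n using Nat.strong_induction_on with
    | _ n ih =>
      intro hn
      obtain ⟨e, f, hf⟩ := key n ih (by omega)
      exact HomologyEqSMul.of_relativelyExact hd hf (h n hn)

end ModIdeal

/-! ### The zeroth elementary ideal -/

section ElementaryIdeal

open scoped Matrix

variable {R : Type*} [CommRing R] {M : Type*} [AddCommGroup M] [Module R M]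

theorem exists_isPresentation [Module.FinitePresentation R M] :
    ∃ (n m : ℕ) (A : Matrix (Fin n) (Fin m) R), IsPresentation M A := by
  obtain ⟨n, π, hπ⟩ := Module.Finite.exists_fin' R M
  have hker : (LinearMap.ker π).FG := Module.FinitePresentation.fg_ker π hπ
  obtain ⟨m, s, hs⟩ := Submodule.fg_iff_exists_fin_generating_family.1 hker
  refine ⟨n, m, Matrix.of fun i j => s j i, π, hπ, ?_⟩
  rw [← hs, Matrix.range_mulVecLin]
  rfl

/-- Cramer's rule: the determinant times a vector is the matrix applied to the adjugate applied to
that vector, so it is a combination of relations. A repeated row makes the minor vanish. -/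
theorem IsPresentation.det_smul_eq_zero {n m : ℕ} {A : Matrix (Fin n) (Fin m) R}
    (hA : IsPresentation M A) (r : Fin n → Fin n) (c : Fin n → Fin m) (x : M) :
    (A.submatrix r c).det • x = 0 := by
  obtain ⟨π, hπ, hker⟩ := hA
  by_cases hr : Function.Injective r
  · let σ : Equiv.Perm (Fin n) := Equiv.ofBijective r (Finite.injective_iff_bijective.1 hr)
    have h1 : A.submatrix r c = (A.submatrix id c).submatrix σ id := rfl
    obtain ⟨v, rfl⟩ := hπ x
    rw [h1, Matrix.det_permute, mul_smul, ← map_smul]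
    suffices h : (A.submatrix id c).det • v ∈ LinearMap.ker π by
      rw [LinearMap.mem_ker.1 h, smul_zero]
    rw [hker]
    have h2 : (A.submatrix id c).det • v =
        A.submatrix id c *ᵥ ((A.submatrix id c).adjugate *ᵥ v) := by
      rw [Matrix.mulVec_mulVec, Matrix.mul_adjugate, Matrix.smul_mulVec, Matrix.one_mulVec]
    rw [h2, Matrix.range_mulVecLin, Matrix.mulVec_eq_sum]
    refine Submodule.sum_mem _ fun i _ => ?_
    rw [op_smul_eq_smul]
    exact Submodule.smul_mem _ _ (Submodule.subset_span ⟨c i, rfl⟩)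
  · obtain ⟨i, j, hij, hne⟩ := Function.not_injective_iff.1 hr
    rw [Matrix.det_zero_of_row_eq hne (by ext l; simp [hij]), zero_smul]

/-- The zeroth elementary ideal of `M` is contained in the kernel of a homomorphism to a field
if and only if `M` does not agree with its multiple by that kernel. -/
theorem elementaryIdeal_zero_le_ker_iff [Module.FinitePresentation R M] {k : Type*} [Field k]
    (χ : R →+* k) (hχ : Function.Surjective χ) :
    elementaryIdeal R M 0 ≤ RingHom.ker χ ↔ (RingHom.ker χ • ⊤ : Submodule R M) ≠ ⊤ := by
  constructor
  · intro h htop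
    obtain ⟨e, he, he0⟩ := Submodule.exists_sub_one_mem_and_smul_eq_zero_of_fg_of_le_smul
      (RingHom.ker χ) (⊤ : Submodule R M) Module.Finite.fg_top htop.ge
    have hχe : χ e = 1 := by
      rw [RingHom.mem_ker, map_sub, map_one, sub_eq_zero] at he
      exact he
    obtain ⟨n, m, A, π, hπ, hker⟩ := exists_isPresentation (R := R) (M := M)
    -- Since `e` annihilates `M`, the columns of `e` times the identity may be added as relations.
    -- The minor on these columns is `e ^ n`, which the homomorphism sends to `1`.
    let A' : Matrix (Fin n) (Fin (m + n)) R :=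
      Matrix.of fun i => Fin.addCases (A i) fun j => (e • (1 : Matrix (Fin n) (Fin n) R)) i j
    have hA' : IsPresentation M A' := by
      refine ⟨π, hπ, ?_⟩
      rw [hker, Matrix.range_mulVecLin, Matrix.range_mulVecLin]
      refine le_antisymm (Submodule.span_mono ?_) (Submodule.span_le.2 ?_)
      · rintro _ ⟨j, rfl⟩
        exact ⟨Fin.castAdd n j, by ext i; simp [A']⟩
      · rintro _ ⟨j, rfl⟩
        refine Fin.addCases (fun j => ?_) (fun j => ?_) j
        · exact Submodule.subset_span ⟨j, by ext i; simp [A']⟩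
        · have h1 : (A'.col (Fin.natAdd m j) : Fin n → R) = e • Pi.single j 1 := by
            ext i
            simp [A', Matrix.one_apply, Pi.single_apply]
          rw [← Matrix.range_mulVecLin, ← hker, SetLike.mem_coe, LinearMap.mem_ker, h1, map_smul]
          exact he0 _ trivial
    have hdet : (A'.submatrix id (Fin.natAdd m)).det = e ^ n := by
      have : A'.submatrix id (Fin.natAdd m) = e • (1 : Matrix (Fin n) (Fin n) R) := by
        ext i j
        simp [A']
      rw [this, Matrix.det_smul, Matrix.det_one, mul_one, Fintype.card_fin]
    have hmem : e ^ n ∈ elementaryIdeal R M 0 :=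
      Ideal.subset_span ⟨n, m + n, A', id, Fin.natAdd m, hA', hdet.symm⟩
    have := h hmem
    rw [RingHom.mem_ker, map_pow, hχe, one_pow] at this
    exact one_ne_zero this
  · intro h
    refine Ideal.span_le.2 ?_
    rintro _ ⟨n, m, A, r, c, hA, rfl⟩
    by_contra hD
    refine h (eq_top_iff.2 fun x _ => ?_)
    have hD' : χ (A.submatrix r c).det ≠ 0 := hD
    -- If a minor is not in the kernel, some multiple of it is congruent to `1` and still
    -- annihilates `M`.
    obtain ⟨u, hu⟩ := hχ (χ (A.submatrix r c).det)⁻¹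
    have h1 : u * (A.submatrix r c).det - 1 ∈ RingHom.ker χ := by
      rw [RingHom.mem_ker, map_sub, map_mul, hu, inv_mul_cancel₀ hD', map_one, sub_self]
    refine mem_of_smul_mem h1 (P := ⊤) trivial le_rfl ?_
    have h2 := hA.det_smul_eq_zero r c x
    have h3 : (u * (A.submatrix r c).det) • x = u • ((A.submatrix r c).det • x) := mul_smul _ _ _
    rw [h3]
    erw [h2]
    rw [smul_zero]
    exact zero_mem _

end ElementaryIdeal

/-! ### Homology in terms of cycles and boundaries -/

section Homology

variable {R : Type*} [CommRing R] (K : ChainComplex (ModuleCat R) ℕ)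

/-- The differentials of a complex of modules, as linear maps. -/
def diff (n : ℕ) : K.X (n + 1) →ₗ[R] K.X n := (K.d (n + 1) n).hom

theorem diff_diff (n : ℕ) (c : K.X (n + 1 + 1)) : diff K n (diff K (n + 1) c) = 0 := by
  have h := K.d_comp_d (n + 1 + 1) (n + 1) n
  exact congrArg (fun f => f.hom c) h

/-- The cycles of a complex of modules. -/
abbrev complexCycles (n : ℕ) : Submodule R (K.X n) :=
  relativeCycles (C := fun n => K.X n) (diff K) (fun _ => ⊥) n

/-- The bridge from categorical homology to cycles modulo boundaries; the facts about homology below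
are derived from it. -/
theorem exists_homology_surjection (n : ℕ) :
    ∃ π : complexCycles K n →ₗ[R] K.homology n, Function.Surjective π ∧
      ∀ z, π z = 0 ↔ (z : K.X n) ∈ LinearMap.range (diff K n) := by
  have key : ∀ j, (ComplexShape.down ℕ).next n = j →
      complexCycles K n = LinearMap.ker (K.d n j).hom →
      ∃ π : complexCycles K n →ₗ[R] K.homology n, Function.Surjective π ∧
        ∀ z, π z = 0 ↔ (z : K.X n) ∈ LinearMap.range (diff K n) := by
    intro j hj hker
    let S := K.sc' (n + 1) n j
    let e : K.homology n ≅ S.moduleCatLeftHomologyData.H :=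
      K.homologyIsoSc' (n + 1) n j (ChainComplex.prev ℕ n) hj ≪≫ S.moduleCatHomologyIso
    let e' := e.toLinearEquiv
    let π' : LinearMap.ker S.g.hom →ₗ[R] S.moduleCatLeftHomologyData.H :=
      (LinearMap.range S.moduleCatToCycles).mkQ
    have hπ' : Function.Surjective π' := Submodule.mkQ_surjective _
    refine ⟨e'.symm.toLinearMap ∘ₗ π' ∘ₗ (LinearEquiv.ofEq _ _ hker).toLinearMap,
      e'.symm.surjective.comp (hπ'.comp (LinearEquiv.ofEq _ _ hker).surjective), fun z => ?_⟩
    change e'.symm (π' (LinearEquiv.ofEq _ _ hker z)) = 0 ↔ _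
    rw [LinearEquiv.map_eq_zero_iff]
    have h1 : π' (LinearEquiv.ofEq _ _ hker z) = 0 ↔
        LinearEquiv.ofEq _ _ hker z ∈ LinearMap.range S.moduleCatToCycles :=
      Submodule.Quotient.mk_eq_zero _
    rw [h1]
    constructor
    · rintro ⟨w, hw⟩
      exact ⟨w, congrArg Subtype.val hw⟩
    · rintro ⟨w, hw⟩
      exact ⟨w, Subtype.ext hw⟩
  cases n with
  | zero =>
    -- In degree zero the successor in the shape is `0` again, with zero differential, so every
    -- chain is a cycle.
    refine key 0 ChainComplex.next_nat_zero ?_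
    rw [K.shape 0 0 (by simp)]
    exact LinearMap.ker_zero.symm
  | succ n => exact key n (ChainComplex.next_nat_succ n) rfl

theorem subsingleton_homology_iff (n : ℕ) : Subsingleton (K.homology n) ↔
    complexCycles K n ≤ LinearMap.range (diff K n) := by
  obtain ⟨π, hπ, hker⟩ := exists_homology_surjection K n
  constructor
  · exact fun h z hz => (hker ⟨z, hz⟩).1 (Subsingleton.elim _ _)
  · refine fun h => subsingleton_of_forall_eq 0 fun x => ?_
    obtain ⟨z, rfl⟩ := hπ x
    exact (hker z).2 (h z.2)

theorem homologyEqSMul_iff (I : Ideal R) (n : ℕ) : HomologyEqSMul (C := fun n => K.X n) (diff K) I n ↔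
    (I • ⊤ : Submodule R (K.homology n)) = ⊤ := by
  obtain ⟨π, hπ, hker⟩ := exists_homology_surjection K n
  let Z := complexCycles K n
  have h1 : (I • ⊤ : Submodule R (K.homology n)) = (I • (⊤ : Submodule R Z)).map π := by
    rw [Submodule.map_smul'', Submodule.map_top, LinearMap.range_eq_top.2 hπ]
  have h2 : (I • (⊤ : Submodule R Z)).map Z.subtype = I • Z := by
    rw [Submodule.map_smul'', Submodule.map_top, Submodule.range_subtype]
  rw [h1, eq_top_iff]
  constructor
  · intro h x _
    obtain ⟨z, rfl⟩ := hπ x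
    obtain ⟨y, hy, b, hb, hyb⟩ := Submodule.mem_sup.1 (h z.2)
    rw [← h2] at hy
    obtain ⟨y, hy, rfl⟩ := hy
    refine ⟨y, hy, ?_⟩
    rw [eq_comm, ← sub_eq_zero, ← map_sub, hker]
    have : ((z - y : Z) : K.X n) = b := by
      rw [AddSubgroupClass.coe_sub, ← hyb]
      exact add_sub_cancel_left _ _
    rw [this]
    exact hb
  · intro h z hz
    obtain ⟨y, hy, hyz⟩ := h (Submodule.mem_top : π ⟨z, hz⟩ ∈ ⊤)
    have h3 : π (⟨z, hz⟩ - y) = 0 := by rw [map_sub, hyz, sub_self]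
    refine Submodule.mem_sup.2 ⟨y, h2 ▸ Submodule.mem_map_of_mem hy, _, (hker _).1 h3, ?_⟩
    exact add_sub_cancel _ _

theorem finite_homology (n : ℕ) (h : HomologyFinite (C := fun n => K.X n) (diff K) n) :
    Module.Finite R (K.homology n) := by
  obtain ⟨π, hπ, hker⟩ := exists_homology_surjection K n
  obtain ⟨S, hS, hSZ, hZS⟩ := h
  have hfin : (S.comap (complexCycles K n).subtype).FG := by
    refine Submodule.fg_of_fg_map_injective _ (Submodule.subtype_injective _) ?_
    rwa [Submodule.map_comap_subtype, inf_eq_right.2 hSZ]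
  refine ⟨?_⟩
  have htop : (S.comap (complexCycles K n).subtype).map π = ⊤ := by
    refine eq_top_iff.2 fun x _ => ?_
    obtain ⟨z, rfl⟩ := hπ x
    obtain ⟨y, hy, b, hb, hyb⟩ := Submodule.mem_sup.1 (hZS z.2)
    refine ⟨⟨y, hSZ hy⟩, hy, ?_⟩
    rw [eq_comm, ← sub_eq_zero, ← map_sub, hker]
    have : ((z - ⟨y, hSZ hy⟩ : complexCycles K n) : K.X n) = b := by
      rw [AddSubgroupClass.coe_sub, ← hyb]
      exact add_sub_cancel_left _ _
    rw [this]
    exact hb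
  rw [← htop]
  exact hfin.map π

end Homology

/-! ### The chains of a Galois cover as a complex of projective modules -/

section EquivariantComplex

variable (k : Type*) [Field k] (H : Type*) [CommGroup H] (E : Type*) [TopologicalSpace E]
  [MulAction H E] [ContinuousConstSMul H E]

/-- The singular chain complex as a complex of modules over the group ring. -/
abbrev equivariantComplex :=
  (AlgebraicTopology.alternatingFaceMapComplex _).obj (equivariantChains k H E)

theorem diff_equivariantComplex (n : ℕ) (c : Chains k E (.mk (n + 1))) :
    diff (equivariantComplex k H E) n c = singBoundary k E n c := by
  have h : (equivariantComplex k H E).d (n + 1) n = _ :=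
    AlgebraicTopology.AlternatingFaceMapComplex.obj_d_eq (equivariantChains k H E) n
  rw [diff, h, ModuleCat.hom_sum, singBoundary]
  change (∑ i : Fin (n + 2), (((-1 : ℤ) ^ (i : ℕ)) • (equivariantChains k H E).δ i).hom) c = _
  erw [LinearMap.sum_apply, LinearMap.sum_apply]
  rfl

/-- The character of the group ring given by a character of the group. -/
def groupRingCharacter {k H : Type*} [Field k] [CommGroup H] (ρ : H →* kˣ) :
    MonoidAlgebra k H →ₐ[k] k :=
  MonoidAlgebra.lift k k H ((Units.coeHom k).comp ρ)

theorem groupRingCharacter_single {k H : Type*} [Field k] [CommGroup H] (ρ : H →* kˣ) (h : H)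
    (a : k) : groupRingCharacter ρ (MonoidAlgebra.single h a) = a * (ρ h : k) := by
  simp [groupRingCharacter]

theorem groupRingCharacter_surjective {k H : Type*} [Field k] [CommGroup H] (ρ : H →* kˣ) :
    Function.Surjective (groupRingCharacter ρ).toRingHom := fun a =>
  ⟨MonoidAlgebra.single 1 a, by
    change groupRingCharacter ρ _ = a
    simp [groupRingCharacter_single]⟩

variable {k H E}

theorem asAlgebraHom_sub_mem_twistRel (ρ : H →* kˣ) (n : ℕ) (r : MonoidAlgebra k H)
    (c : Chains k E (.mk n)) : (chainRep k H E (.mk n)).asAlgebraHom r c -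
      groupRingCharacter ρ r • c ∈ twistRel k E ρ (.mk n) := by
  induction r using MonoidAlgebra.induction_linear with
  | zero => simp
  | add r s hr hs =>
    rw [map_add, LinearMap.add_apply, map_add, add_smul, add_sub_add_comm]
    exact add_mem hr hs
  | single h b =>
    rw [Representation.asAlgebraHom_single, LinearMap.smul_apply, groupRingCharacter_single]
    induction c using Finsupp.induction_linear with
    | zero => simp
    | add c c' hc hc' =>
      rw [map_add, smul_add, smul_add, add_sub_add_comm]
      exact add_mem hc hc'
    | single σ a =>
      refine Submodule.subset_span ⟨h, σ, b * a, ?_⟩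
      rw [chainRep_single, Finsupp.smul_single, Finsupp.smul_single, smul_eq_mul, smul_eq_mul,
        mul_right_comm]

theorem asAlgebraHom_mem_twistRel (ρ : H →* kˣ) (n : ℕ) {r : MonoidAlgebra k H}
    (hr : groupRingCharacter ρ r = 0) (c : Chains k E (.mk n)) :
    (chainRep k H E (.mk n)).asAlgebraHom r c ∈ twistRel k E ρ (.mk n) := by
  simpa [hr] using asAlgebraHom_sub_mem_twistRel ρ n r c

theorem smul_eq_asAlgebraHom (n : ℕ) (r : MonoidAlgebra k H) (c : EqChains k H E n) :
    r • c = (chainRep k H E (.mk n)).asAlgebraHom r c := rfl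

/-- Identifies the twisted chains with C/IC: modulo the twisting relations an element of the group
ring acts through the character, and conversely each relation is a chain multiplied by h - ρ(h). -/
theorem mem_ker_smul_top_iff (ρ : H →* kˣ) (n : ℕ) (c : EqChains k H E n) :
    c ∈ (RingHom.ker (groupRingCharacter ρ).toRingHom • ⊤ :
      Submodule (MonoidAlgebra k H) (EqChains k H E n)) ↔
      (c : Chains k E (.mk n)) ∈ twistRel k E ρ (.mk n) := by
  constructor
  · intro hc
    induction hc using Submodule.smul_induction_on' with
    | smul r hr c _ =>
      exact asAlgebraHom_mem_twistRel ρ n hr c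
    | add x _ y _ hx hy => exact add_mem (S := Submodule k (Chains k E (.mk n))) hx hy
  · intro hc
    have hle : twistRel k E ρ (.mk n) ≤
        ((RingHom.ker (groupRingCharacter ρ).toRingHom • ⊤ :
          Submodule (MonoidAlgebra k H) (EqChains k H E n)).restrictScalars k :
            Submodule k (EqChains k H E n)) := by
      refine Submodule.span_le.2 ?_
      rintro _ ⟨h, σ, a, rfl⟩
      have hmem : MonoidAlgebra.single h (1 : k) - MonoidAlgebra.single 1 (ρ h : k) ∈
          RingHom.ker (groupRingCharacter ρ).toRingHom := by
        change groupRingCharacter ρ _ = 0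
        rw [map_sub, groupRingCharacter_single, groupRingCharacter_single]
        simp
      have h1 := Submodule.smul_mem_smul (N := (⊤ : Submodule (MonoidAlgebra k H)
        (EqChains k H E n))) (n := (Finsupp.single σ a : Chains k E (.mk n))) hmem trivial
      have e : (chainRep k H E (.mk n)).asAlgebraHom
          (MonoidAlgebra.single h (1 : k) - MonoidAlgebra.single 1 (ρ h : k))
            (Finsupp.single σ a) =
          Finsupp.single (h • σ) a - Finsupp.single σ (a * (ρ h : k)) := by
        rw [map_sub, LinearMap.sub_apply, Representation.asAlgebraHom_single,
          Representation.asAlgebraHom_single, LinearMap.smul_apply, LinearMap.smul_apply, map_one,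
          Module.End.one_apply, chainRep_single, one_smul, Finsupp.smul_single, smul_eq_mul,
          mul_comm]
      exact e ▸ h1
    exact hle hc

/-- The chains of a Galois cover form a projective module over the group ring. -/
theorem projective_eqChains {X : Type*} [TopologicalSpace X] {q : E → X}
    (hq : IsQuotientCoveringMap q H) (n : ℕ) :
    Module.Projective (MonoidAlgebra k H) (EqChains k H E n) := by
  let lab : Simplex E (.mk n) → H := fun σ => fiberLabel hq (σ (stdSimplex.vertex 0))
  have hlab (h : H) (σ) : lab (h • σ) = h * lab σ := fiberLabel_smul hq h _
  -- The simplex in the orbit of `σ` whose first vertex has label `1`. Writing `σ` as its label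
  -- times this representative gives an equivariant section of the canonical map from the free
  -- module on all chains.
  let base : Simplex E (.mk n) → EqChains k H E n := fun σ =>
    (Finsupp.single ((lab σ)⁻¹ • σ) 1 : Chains k E (.mk n))
  let s : Chains k E (.mk n) →ₗ[k] (EqChains k H E n →₀ MonoidAlgebra k H) :=
    Finsupp.linearCombination k fun σ => Finsupp.single (base σ) (MonoidAlgebra.single (lab σ) 1)
  have hs (σ : Simplex E (.mk n)) (a : k) : s (Finsupp.single σ a) =
      a • Finsupp.single (base σ) (MonoidAlgebra.single (lab σ) (1 : k)) :=
    Finsupp.linearCombination_single _ _ _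
  have hequiv : ∀ (h : H) (c : Chains k E (.mk n)),
      s (chainRep k H E (.mk n) h c) = MonoidAlgebra.single h (1 : k) • s c := by
    intro h c
    induction c using Finsupp.induction_linear with
    | zero => simp
    | add c c' hc hc' => rw [map_add, map_add, map_add, hc, hc', smul_add]
    | single σ a =>
      have hb : base (h • σ) = base σ := by
        change (Finsupp.single _ _ : Chains k E (.mk n)) = Finsupp.single _ _
        rw [hlab, mul_inv_rev, mul_smul, inv_smul_smul]
      rw [chainRep_single, hs, hs, hb, hlab, smul_comm _ a, Finsupp.smul_single (MonoidAlgebra.single h _),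
        smul_eq_mul,        MonoidAlgebra.single_mul_single, one_mul]
  let s' : EqChains k H E n →ₗ[k] (EqChains k H E n →₀ MonoidAlgebra k H) := s
  let S : EqChains k H E n →ₗ[MonoidAlgebra k H] (EqChains k H E n →₀ MonoidAlgebra k H) :=
    MonoidAlgebra.equivariantOfLinearOfComm s' fun h c => by
      have h1 : (MonoidAlgebra.single h (1 : k) • c : EqChains k H E n) =
          chainRep k H E (.mk n) h c := by
        rw [smul_eq_asAlgebraHom, Representation.asAlgebraHom_single, one_smul]
      rw [h1]
      exact hequiv h c
  refine ⟨S, fun c => ?_⟩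
  let T : Chains k E (.mk n) →ₗ[k] EqChains k H E n :=
    (Finsupp.linearCombination (MonoidAlgebra k H) (id : EqChains k H E n → _)).restrictScalars k ∘ₗ s
  suffices h : ∀ c, T c = c from h c
  intro c
  induction c using Finsupp.induction_linear with
  | zero => exact map_zero T
  | add c c' hc hc' => exact (map_add T c c').trans (congrArg₂ (· + ·) hc hc')
  | single σ a =>
    change Finsupp.linearCombination _ _ (s (Finsupp.single σ a)) = _
    rw [hs, Finsupp.smul_single, Finsupp.linearCombination_single, smul_eq_asAlgebraHom,
      MonoidAlgebra.smul_single, smul_eq_mul, mul_one, Representation.asAlgebraHom_single]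
    change a • chainRep k H E _ _ (Finsupp.single _ _ : Chains k E (.mk n)) = _
    rw [chainRep_single, smul_inv_smul, Finsupp.smul_single, smul_eq_mul, mul_one]

end EquivariantComplex

/-! ### The zero locus of the zeroth elementary ideal of the homology -/

section TwistExact

variable (k : Type*) [Field k]

/-- The homology in degree `n` of the chains of `E` twisted by the character `χ` vanishes. -/
def TwistExact {D : Type*} [Group D] (E : Type*) [TopologicalSpace E] [MulAction D E]
    [ContinuousConstSMul D E] (χ : D → kˣ) (n : ℕ) : Prop :=
  relCycles k (fun n => twistRel k E χ (.mk n)) n ≤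
    LinearMap.range (singBoundary k E n) ⊔ twistRel k E χ (.mk n)

variable {k} {H : Type*} [CommGroup H] {E : Type*} [TopologicalSpace E] [MulAction H E]
  [ContinuousConstSMul H E]

theorem chainsIn_univ (n : ℕ) : chainsIn k (Set.univ : Set E) n = ⊤ :=
  eq_top_iff.2 fun c _ => by
    induction c using Finsupp.induction_linear with
    | zero => exact zero_mem _
    | add f g hf hg => exact add_mem (hf trivial) (hg trivial)
    | single σ a => exact single_mem_chainsIn k _ fun _ => Set.mem_univ _

theorem complexCycles_equivariantComplex (n : ℕ) (c : Chains k E (.mk n)) :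
    c ∈ cyclesIn k (Set.univ : Set E) n ↔
      @Membership.mem ((equivariantComplex k H E).X n) _ _
        (complexCycles (equivariantComplex k H E) n) c := by
  cases n with
  | zero =>
    rw [mem_cyclesIn_zero, chainsIn_univ]
    exact ⟨fun _ => trivial, fun _ => trivial⟩
  | succ n =>
    rw [mem_cyclesIn_succ, chainsIn_univ]
    refine (and_iff_right trivial).trans ?_
    rw [← diff_equivariantComplex k H E]
    exact Iff.rfl

theorem mem_range_diff_iff (n : ℕ) (c : Chains k E (.mk n)) :
    c ∈ LinearMap.range (singBoundary k E n) ↔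
      @Membership.mem ((equivariantComplex k H E).X n) _ _
        (LinearMap.range (diff (equivariantComplex k H E) n)) c := by
  constructor
  · rintro ⟨w, rfl⟩
    exact ⟨w, diff_equivariantComplex k H E n w⟩
  · rintro ⟨w, rfl⟩
    exact ⟨w, (diff_equivariantComplex k H E n w).symm⟩

theorem HomologyFG.homologyFinite {n : ℕ} (h : HomologyFG k H (Set.univ : Set E) n) :
    HomologyFinite (C := fun n => (equivariantComplex k H E).X n)
      (diff (equivariantComplex k H E)) n := by
  obtain ⟨F, hF, hFc, hFz⟩ := h
  let S : Submodule (MonoidAlgebra k H) ((equivariantComplex k H E).X n) :=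
    Submodule.span (M := EqChains k H E n) (MonoidAlgebra k H) F
  have hS : S ≤ complexCycles (equivariantComplex k H E) n :=
    (Submodule.span_le (M := EqChains k H E n)).2 fun c hc =>
      (complexCycles_equivariantComplex n c).1 (hFc hc)
  refine ⟨S, Submodule.fg_span (M := EqChains k H E n) hF, hS, fun z hz => ?_⟩
  obtain ⟨y, hy, hyz⟩ := hFz z ((complexCycles_equivariantComplex n z).2 hz)
  obtain ⟨w, -, hw⟩ := hyz
  have h1 := (mem_range_diff_iff (H := H) n _).1 ⟨w, hw⟩
  exact Submodule.mem_sup.2 ⟨y, hy, _, h1, add_sub_cancel (G := Chains k E (.mk n)) y z⟩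

theorem relativelyExact_iff_twistExact (ρ : H →* kˣ) (n : ℕ) :
    RelativelyExact (C := fun n => (equivariantComplex k H E).X n)
      (diff (equivariantComplex k H E))
      (idealMultiples (fun n => (equivariantComplex k H E).X n)
        (RingHom.ker (groupRingCharacter ρ).toRingHom)) n ↔ TwistExact k E ρ n := by
  have hcyc : ∀ c : Chains k E (.mk n), c ∈ relCycles k (fun n => twistRel k E ρ (.mk n)) n ↔
      @Membership.mem ((equivariantComplex k H E).X n) _ _
        (relativeCycles (C := fun n => (equivariantComplex k H E).X n)
          (diff (equivariantComplex k H E)) (idealMultiples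
            (fun n => (equivariantComplex k H E).X n)
            (RingHom.ker (groupRingCharacter ρ).toRingHom)) n) c := by
    intro c
    cases n with
    | zero => exact Iff.rfl
    | succ n =>
      refine (mem_ker_smul_top_iff ρ n (singBoundary k E n c)).symm.trans ?_
      rw [← diff_equivariantComplex k H E]
      exact Iff.rfl
  constructor
  · intro h c hc
    obtain ⟨b, hb, y, hy, hby⟩ := Submodule.mem_sup.1 (h ((hcyc c).1 hc))
    exact Submodule.mem_sup.2 ⟨b, (mem_range_diff_iff (H := H) n b).2 hb, y,
      (mem_ker_smul_top_iff ρ n y).1 hy, hby⟩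
  · intro h c hc
    obtain ⟨b, hb, y, hy, hby⟩ := Submodule.mem_sup.1 (h ((hcyc c).2 hc))
    exact Submodule.mem_sup.2 ⟨b, (mem_range_diff_iff (H := H) n b).1 hb, y,
      (mem_ker_smul_top_iff ρ n y).2 hy, hby⟩

/-- Over the Noetherian group ring finitely generated homology is finitely presented, so the
criterion for the zeroth elementary ideal applies. -/
theorem mem_zeroLocus_iff [IsNoetherianRing (MonoidAlgebra k H)] (ρ : H →* kˣ) {n : ℕ}
    (h : HomologyFG k H (Set.univ : Set E) n) :
    ρ ∈ zeroLocus (elementaryIdeal (MonoidAlgebra k H) (EquivariantHomology k H E n) 0) ↔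
      ¬ HomologyEqSMul (C := fun n => (equivariantComplex k H E).X n)
        (diff (equivariantComplex k H E)) (RingHom.ker (groupRingCharacter ρ).toRingHom) n := by
  have h1 : Module.Finite (MonoidAlgebra k H) (EquivariantHomology k H E n) :=
    finite_homology _ n h.homologyFinite
  have h2 : Module.FinitePresentation (MonoidAlgebra k H) (EquivariantHomology k H E n) :=
    Module.finitePresentation_of_finite _ _
  rw [homologyEqSMul_iff]
  exact elementaryIdeal_zero_le_ker_iff (groupRingCharacter ρ).toRingHom
    (groupRingCharacter_surjective ρ)

theorem forall_notMem_zeroLocus_iff [IsNoetherianRing (MonoidAlgebra k H)] {X : Type*}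
    [TopologicalSpace X] {q : E → X} (hq : IsQuotientCoveringMap q H) (ρ : H →* kˣ) {N : ℕ}
    (h : ∀ n ≤ N, HomologyFG k H (Set.univ : Set E) n) :
    (∀ n ≤ N, ρ ∉ zeroLocus
      (elementaryIdeal (MonoidAlgebra k H) (EquivariantHomology k H E n) 0)) ↔
      ∀ n ≤ N, TwistExact k E ρ n := by
  have hproj : ∀ n, Module.Projective (MonoidAlgebra k H) ((equivariantComplex k H E).X n) :=
    fun n => projective_eqChains hq n
  have h1 := forall_homologyEqSMul_iff (C := fun n => (equivariantComplex k H E).X n)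
    (d := diff (equivariantComplex k H E)) (diff_diff _)
    (RingHom.ker (groupRingCharacter ρ).toRingHom) (N := N) fun n hn => (h n hn).homologyFinite
  simp only [relativelyExact_iff_twistExact] at h1
  rw [← h1]
  exact forall₂_congr fun n hn => by rw [mem_zeroLocus_iff ρ (h n hn), not_not]

end TwistExact

/-! ### Twisted homology -/

section TwistedComplex

variable (k : Type*) [Field k] {D : Type*} [Group D] (E : Type*) [TopologicalSpace E]
  [MulAction D E] [ContinuousConstSMul D E] (χ : D → kˣ)

/-- The twisted chain complex. -/
abbrev twistedComplex :=
  (AlgebraicTopology.alternatingFaceMapComplex _).obj (twistedChains k E χ)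

theorem diff_twistedComplex (n : ℕ) (c : Chains k E (.mk (n + 1))) :
    diff (twistedComplex k E χ) n ((twistRel k E χ (.mk (n + 1))).mkQ c) =
      (twistRel k E χ (.mk n)).mkQ (singBoundary k E n c) := by
  have h : (twistedComplex k E χ).d (n + 1) n = _ :=
    AlgebraicTopology.AlternatingFaceMapComplex.obj_d_eq (twistedChains k E χ) n
  rw [diff, h, ModuleCat.hom_sum, singBoundary]
  change (∑ i : Fin (n + 2), (((-1 : ℤ) ^ (i : ℕ)) • (twistedChains k E χ).δ i).hom)
    ((twistRel k E χ (.mk (n + 1))).mkQ c) = _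
  erw [LinearMap.sum_apply]
  rw [LinearMap.sum_apply, map_sum]
  refine Finset.sum_congr rfl fun i _ => ?_
  rw [LinearMap.smul_apply, map_zsmul]
  rfl

theorem subsingleton_twistedHomology_iff (n : ℕ) :
    Subsingleton (TwistedHomology k E χ n) ↔ TwistExact k E χ n := by
  rw [subsingleton_homology_iff]
  have hcyc : ∀ c : Chains k E (.mk n), c ∈ relCycles k (fun n => twistRel k E χ (.mk n)) n ↔
      @Membership.mem ((twistedComplex k E χ).X n) _ _ (complexCycles (twistedComplex k E χ) n)
        ((twistRel k E χ (.mk n)).mkQ c) := by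
    intro c
    cases n with
    | zero => exact Iff.rfl
    | succ n =>
      change singBoundary k E n c ∈ twistRel k E χ (.mk n) ↔
        diff (twistedComplex k E χ) n ((twistRel k E χ (.mk (n + 1))).mkQ c) = 0
      rw [diff_twistedComplex]
      exact (Submodule.Quotient.mk_eq_zero _).symm
  constructor
  · intro h c hc
    obtain ⟨w, hw⟩ := h ((hcyc c).1 hc)
    obtain ⟨w, rfl⟩ := Submodule.mkQ_surjective _ w
    have h1 := (diff_twistedComplex k E χ n w).symm.trans hw
    have h2 : c - singBoundary k E n w ∈ twistRel k E χ (.mk n) :=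
      (Submodule.Quotient.eq _).1 h1.symm
    exact Submodule.mem_sup.2 ⟨_, ⟨w, rfl⟩, _, h2, add_sub_cancel _ _⟩
  · intro h z hz
    obtain ⟨c, rfl⟩ := Submodule.mkQ_surjective _ z
    obtain ⟨_, ⟨w, rfl⟩, y, hy, rfl⟩ := Submodule.mem_sup.1 (h ((hcyc c).2 hz))
    refine ⟨(twistRel k E χ (.mk (n + 1))).mkQ w, (diff_twistedComplex k E χ n w).trans ?_⟩
    rw [map_add, Submodule.mkQ_apply _ y, (Submodule.Quotient.mk_eq_zero _).2 hy, add_zero]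

theorem one_le_rank_twistedHomology_iff (n : ℕ) :
    ((1 : ℕ) : Cardinal) ≤ Module.rank k (TwistedHomology k E χ n) ↔ ¬ TwistExact k E χ n := by
  rw [← subsingleton_twistedHomology_iff, not_subsingleton_iff_nontrivial,
    ← rank_pos_iff_nontrivial (R := k), Nat.cast_one, Cardinal.one_le_iff_pos]

end TwistedComplex

/-! ### The map from the universal cover to another Galois cover -/

section LiftAlong

variable {X : Type*} [TopologicalSpace X] {E : Type*} [TopologicalSpace E]
  {Y : Type*} [TopologicalSpace Y] {p : E → X} {q : Y → X} {f : E → Y}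

theorem exists_pathLift (hq : IsCoveringMap q) (hp : Continuous p) {a b : E} (Γ : Path a b) {y : Y}
    (hy : q y = p a) : ∃ (z : Y) (Γ' : Path y z), ∀ t, q (Γ' t) = p (Γ t) := by
  let γ : C(Set.Icc (0 : ℝ) 1, X) := ⟨p ∘ Γ, hp.comp Γ.continuous⟩
  have h0 : γ 0 = q y := by simp [γ, hy]
  exact ⟨_, ⟨hq.liftPath γ y h0, hq.liftPath_zero γ y h0, rfl⟩,
    fun t => congrFun (hq.liftPath_lifts γ y h0) t⟩

/-- Paths with the same ends are homotopic in the simply connected space, and homotopic paths in the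
base have lifts with the same end. -/
theorem pathLift_target_eq [SimplyConnectedSpace E] (hq : IsCoveringMap q) (hp : Continuous p)
    {a b : E} {Γ₁ Γ₂ : Path a b} {y z₁ z₂ : Y} {Γ₁' : Path y z₁} {Γ₂' : Path y z₂}
    (h₁ : ∀ t, q (Γ₁' t) = p (Γ₁ t)) (h₂ : ∀ t, q (Γ₂' t) = p (Γ₂ t)) : z₁ = z₂ := by
  have h0 : q y = p a := by simpa using h₁ 0
  have h := hq.liftPath_apply_one_eq_of_homotopicRel
    (ContinuousMap.HomotopicRel.comp_continuousMap (SimplyConnectedSpace.paths_homotopic Γ₁ Γ₂)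
      ⟨p, hp⟩) y (by simp [h0]) (by simp [h0])
  have e₁ := congrArg (· 1) ((hq.eq_liftPath_iff' (γ := (⟨p, hp⟩ : C(E, X)).comp Γ₁.toContinuousMap)
    (Γ := Γ₁'.toContinuousMap) (by simp [h0])).2 ⟨funext h₁, Γ₁'.source⟩)
  have e₂ := congrArg (· 1) ((hq.eq_liftPath_iff' (γ := (⟨p, hp⟩ : C(E, X)).comp Γ₂.toContinuousMap)
    (Γ := Γ₂'.toContinuousMap) (by simp [h0])).2 ⟨funext h₂, Γ₂'.source⟩)
  exact Γ₁'.target.symm.trans ((e₁.trans (h.trans e₂.symm)).trans Γ₂'.target)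

/-- The map `f : E → Y` commutes with the lifting of paths along `p : E → X` and `q : Y → X`. -/
structure IsLiftAlong (p : E → X) (q : Y → X) (f : E → Y) : Prop where
  comp_eq : ∀ e, q (f e) = p e
  target_eq : ∀ {a b : E} (Γ : Path a b) {y : Y} (Γ' : Path (f a) y),
    (∀ t, q (Γ' t) = p (Γ t)) → f b = y

theorem exists_isLiftAlong [SimplyConnectedSpace E] (hq : IsCoveringMap q) (hp : Continuous p)
    {e₀ : E} {y₀ : Y} (h0 : q y₀ = p e₀) : ∃ f : E → Y, f e₀ = y₀ ∧ IsLiftAlong p q f := by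
  choose f Γ' hΓ' using fun e => exists_pathLift hq hp (PathConnectedSpace.somePath e₀ e) h0
  refine ⟨f, (pathLift_target_eq hq hp (Γ₁ := Path.refl e₀) (Γ₁' := Path.refl y₀)
    (fun _ => h0) (hΓ' e₀)).symm, fun e => by simpa using hΓ' e 1, fun {a b} Γ y Δ hΔ => ?_⟩
  refine pathLift_target_eq hq hp (hΓ' b) (Γ₂ := (PathConnectedSpace.somePath e₀ a).trans Γ)
    (Γ₂' := (Γ' a).trans Δ) fun t => ?_
  simp only [Path.trans_apply]
  split_ifs
  · exact hΓ' a _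
  · exact hΔ _

instance simplyConnectedSpace_stdSimplex (n : ℕ) :
    SimplyConnectedSpace (stdSimplex ℝ (Fin (n + 1))) :=
  haveI := (convex_stdSimplex ℝ (Fin (n + 1))).contractibleSpace
    ⟨_, single_mem_stdSimplex ℝ (0 : Fin (n + 1))⟩
  inferInstance

instance locallyPathConnectedSpace_stdSimplex (n : ℕ) :
    LocallyPathConnectedSpace (stdSimplex ℝ (Fin (n + 1))) :=
  (convex_stdSimplex ℝ (Fin (n + 1))).locallyPathConnectedSpace

/-- Continuity of `f` itself would call for local path connectedness of `E`. Along a simplex, `f`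
agrees with the continuous lift of the projected simplex, and that is enough for singular chains. -/
theorem IsLiftAlong.continuous_comp (hf : IsLiftAlong p q f) (hq : IsCoveringMap q)
    (hp : Continuous p) {n : SimplexCategory} (σ : Simplex E n) : Continuous (f ∘ σ) := by
  let a : stdSimplex ℝ (Fin (n.len + 1)) := ⟨_, single_mem_stdSimplex ℝ 0⟩
  obtain ⟨τ, ⟨h0, hτ⟩, -⟩ := hq.existsUnique_continuousMap_lifts
    ((⟨p, hp⟩ : C(E, X)).comp σ) a (f (σ a)) (hf.comp_eq _)
  convert! τ.continuous using 1
  funext t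
  let δ := PathConnectedSpace.somePath a t
  exact hf.target_eq (δ.map σ.continuous) ((δ.map τ.continuous).cast h0.symm rfl)
    fun s => congrFun hτ (δ s)

variable {G H : Type*} [Group G] [Group H] [MulAction G E] [MulAction H Y]
  [ContinuousConstSMul G E] [ContinuousConstSMul H Y]

/-- Translating a path and its lift shows that equivariance at `e₀` propagates along paths to every
point. -/
theorem IsLiftAlong.map_smul [PathConnectedSpace E] (hf : IsLiftAlong p q f)
    (hp : IsQuotientCoveringMap p G) (hq : IsQuotientCoveringMap q H) (e₀ : E) {g : G} {h : H}
    (h0 : f (g • e₀) = h • f e₀) (e : E) : f (g • e) = h • f e := by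
  let Γ := PathConnectedSpace.somePath e₀ e
  obtain ⟨z, Γ', hΓ'⟩ := exists_pathLift hq.isCoveringMap hp.isCoveringMap.continuous Γ
    (hf.comp_eq e₀)
  rw [hf.target_eq Γ Γ' hΓ']
  refine hf.target_eq (Γ.map (continuous_const_smul g))
    ((Γ'.map (continuous_const_smul h)).cast h0 rfl) fun t => ?_
  simp [hq.map_smul, hp.map_smul, hΓ']

end LiftAlong

/-! ### Comparison of twisted chains -/

section Transfer

variable {E : Type*} [TopologicalSpace E] {Y : Type*} [TopologicalSpace Y]
  {G H : Type*} [Group G] [Group H] [MulAction G E] [MulAction H Y]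
  [ContinuousConstSMul G E] [ContinuousConstSMul H Y]

/-- A compatible family of maps on singular simplices that identifies the simplices of `Y` with the
orbits of the simplices of `E` under the kernel of the surjection `φ`. -/
structure SimplexQuotient (φ : G → H) (F : ∀ n : SimplexCategory, Simplex E n → Simplex Y n) :
    Prop where
  pull : ∀ {m n : SimplexCategory} (θ : m ⟶ n) (σ : Simplex E n),
    F m (Simplex.pull θ σ) = Simplex.pull θ (F n σ)
  smul : ∀ {n : SimplexCategory} (g : G) (σ : Simplex E n), F n (g • σ) = φ g • F n σ
  surjective_group : Function.Surjective φ
  surjective : ∀ n, Function.Surjective (F n)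
  exists_smul_eq : ∀ {n : SimplexCategory} (σ σ' : Simplex E n), F n σ = F n σ' →
    ∃ g : G, φ g = 1 ∧ σ' = g • σ

variable {φ : G → H} {F : ∀ n : SimplexCategory, Simplex E n → Simplex Y n}
  (hF : SimplexQuotient φ F) {k : Type*} [Field k]

include hF

theorem SimplexQuotient.lmapDomain_singBoundary (n : ℕ) (c : Chains k E (.mk (n + 1))) :
    Finsupp.lmapDomain k k (F (.mk n)) (singBoundary k E n c) =
      singBoundary k Y n (Finsupp.lmapDomain k k (F (.mk (n + 1))) c) := by
  induction c using Finsupp.induction_linear with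
  | zero => simp
  | add f g hf hg => simp only [map_add, hf, hg]
  | single σ a =>
    simp only [singBoundary_single, map_sum, map_zsmul, Finsupp.lmapDomain_apply,
      Finsupp.mapDomain_single, hF.pull]

theorem SimplexQuotient.twistRel_le_comap (χ : H → kˣ) (n : SimplexCategory) :
    twistRel k E (χ ∘ φ) n ≤ (twistRel k Y χ n).comap (Finsupp.lmapDomain k k (F n)) := by
  refine Submodule.span_le.2 ?_
  rintro _ ⟨d, σ, a, rfl⟩
  refine Submodule.subset_span ⟨φ d, F n σ, a, ?_⟩
  simp only [map_sub, Finsupp.lmapDomain_apply, Finsupp.mapDomain_single, hF.smul,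
    Function.comp_apply]

theorem SimplexQuotient.twistRel_le_map (χ : H → kˣ) (n : SimplexCategory) :
    twistRel k Y χ n ≤ (twistRel k E (χ ∘ φ) n).map (Finsupp.lmapDomain k k (F n)) := by
  refine Submodule.span_le.2 ?_
  rintro _ ⟨d, τ, a, rfl⟩
  obtain ⟨g, rfl⟩ := hF.surjective_group d
  obtain ⟨σ, rfl⟩ := hF.surjective n τ
  refine ⟨_, Submodule.subset_span ⟨g, σ, a, rfl⟩, ?_⟩
  simp only [map_sub, Finsupp.lmapDomain_apply, Finsupp.mapDomain_single, hF.smul,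
    Function.comp_apply]

/-- Choose one simplex over each simplex of `Y`. Any other simplex with that image differs from it
by an element of the kernel of `φ`, where the character is `1`, so the two are identified in the
twisted chains. -/
theorem SimplexQuotient.ker_le_twistRel {χ : H → kˣ} (hχ : χ 1 = 1) (n : SimplexCategory) :
    LinearMap.ker (Finsupp.lmapDomain k k (F n)) ≤ twistRel k E (χ ∘ φ) n := by
  let s := Function.surjInv (hF.surjective n)
  have key (c : Chains k E n) :
      Finsupp.lmapDomain k k s (Finsupp.lmapDomain k k (F n) c) - c ∈ twistRel k E (χ ∘ φ) n := by
    induction c using Finsupp.induction_linear with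
    | zero => simp
    | add f g hf hg =>
      rw [map_add, map_add, add_sub_add_comm]
      exact add_mem hf hg
    | single σ a =>
      obtain ⟨g, hg, h⟩ := hF.exists_smul_eq σ (s (F n σ))
        (Function.surjInv_eq (hF.surjective n) _).symm
      refine Submodule.subset_span ⟨g, σ, a, ?_⟩
      simp only [Finsupp.lmapDomain_apply, Finsupp.mapDomain_single, Function.comp_apply, hg, hχ, h,
        Units.val_one, mul_one]
  intro c hc
  have h := key c
  rw [LinearMap.mem_ker.1 hc, map_zero, zero_sub] at h
  exact neg_mem_iff.1 h

theorem SimplexQuotient.lmapDomain_mem_iff {χ : H → kˣ} (hχ : χ 1 = 1) {n : SimplexCategory}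
    {c : Chains k E n} :
    Finsupp.lmapDomain k k (F n) c ∈ twistRel k Y χ n ↔ c ∈ twistRel k E (χ ∘ φ) n := by
  refine ⟨fun h => ?_, fun h => hF.twistRel_le_comap χ n h⟩
  obtain ⟨r, hr, hrc⟩ := hF.twistRel_le_map χ n h
  rw [← sub_add_cancel c r]
  exact add_mem (hF.ker_le_twistRel hχ n (by simp only [LinearMap.mem_ker, map_sub, hrc, sub_self]))
    hr

/-- The map on chains is surjective, and the twisting relations upstairs are exactly the preimage of
those downstairs. So the two twisted complexes are isomorphic. -/
theorem SimplexQuotient.twistExact_iff {χ : H → kˣ} (hχ : χ 1 = 1) (n : ℕ) :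
    TwistExact k E (χ ∘ φ) n ↔ TwistExact k Y χ n := by
  have hsurj (n : SimplexCategory) : Function.Surjective (Finsupp.lmapDomain k k (F n)) :=
    Finsupp.mapDomain_surjective (hF.surjective n)
  have h1 (c : Chains k E (.mk n)) :
      Finsupp.lmapDomain k k (F (.mk n)) c ∈ relCycles k (fun n => twistRel k Y χ (.mk n)) n ↔
        c ∈ relCycles k (fun n => twistRel k E (χ ∘ φ) (.mk n)) n := by
    cases n with
    | zero => exact Iff.rfl
    | succ n =>
      simp only [relCycles, Submodule.mem_comap, ← hF.lmapDomain_singBoundary,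
        hF.lmapDomain_mem_iff hχ]
  have h2 (c : Chains k E (.mk n)) : Finsupp.lmapDomain k k (F (.mk n)) c ∈
      LinearMap.range (singBoundary k Y n) ⊔ twistRel k Y χ (.mk n) ↔
        c ∈ LinearMap.range (singBoundary k E n) ⊔ twistRel k E (χ ∘ φ) (.mk n) := by
    simp only [Submodule.mem_sup, LinearMap.mem_range]
    constructor
    · rintro ⟨_, ⟨y, rfl⟩, r, hr, h⟩
      obtain ⟨x, rfl⟩ := hsurj _ y
      refine ⟨_, ⟨x, rfl⟩, c - singBoundary k E n x, (hF.lmapDomain_mem_iff hχ).1 ?_,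
        add_sub_cancel _ _⟩
      rw [map_sub, ← h, hF.lmapDomain_singBoundary, add_sub_cancel_left]
      exact hr
    · rintro ⟨_, ⟨x, rfl⟩, r, hr, rfl⟩
      refine ⟨_, ⟨Finsupp.lmapDomain k k (F _) x, rfl⟩, _, (hF.lmapDomain_mem_iff hχ).2 hr, ?_⟩
      rw [map_add (Finsupp.lmapDomain k k (F _)), hF.lmapDomain_singBoundary]
  constructor
  · intro h y hy
    obtain ⟨c, rfl⟩ := hsurj _ y
    exact (h2 c).2 (h ((h1 c).1 hy))
  · intro h c hc
    exact (h2 c).1 (h ((h1 c).2 hc))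

end Transfer

/-! ### Simplices of a cover as orbits of simplices of the universal cover -/

section Covers

variable {X : Type*} [TopologicalSpace X] {E : Type*} [TopologicalSpace E]
  {Y : Type*} [TopologicalSpace Y] {p : E → X} {q : Y → X} {f : E → Y}
  {G H : Type*} [Group G] [Group H] [MulAction G E] [MulAction H Y]
  [ContinuousConstSMul G E] [ContinuousConstSMul H Y]

theorem IsLiftAlong.simplexQuotient (hf : IsLiftAlong p q f)
    (hp : IsQuotientCoveringMap p G) (hq : IsQuotientCoveringMap q H) {φ : G → H}
    (hφ : Function.Surjective φ) (hsmul : ∀ g e, f (g • e) = φ g • f e) :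
    SimplexQuotient φ fun n (σ : Simplex E n) => (⟨f ∘ σ, hf.continuous_comp hq.isCoveringMap
      hp.isCoveringMap.continuous σ⟩ : Simplex Y n) where
  pull θ σ := rfl
  smul g σ := ContinuousMap.ext fun t => hsmul g (σ t)
  surjective_group := hφ
  surjective n τ := by
    let a : stdSimplex ℝ (Fin (n.len + 1)) := ⟨_, single_mem_stdSimplex ℝ 0⟩
    obtain ⟨e, he⟩ := hp.surjective (q (τ a))
    obtain ⟨σ, ⟨h0, hσ⟩, -⟩ := hp.isCoveringMap.existsUnique_continuousMap_lifts
      ((⟨q, hq.isCoveringMap.continuous⟩ : C(Y, X)).comp τ) a e he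
    -- The lift of the projected simplex may have an image starting at another point of the fibre; a
    -- deck transformation of `E` corrects this, and then uniqueness of lifts applies.
    obtain ⟨h, hh⟩ := hq.apply_eq_iff_mem_orbit.1
      (show q (τ a) = q (f (σ a)) by rw [hf.comp_eq, h0, he])
    obtain ⟨g, rfl⟩ := hφ h
    refine ⟨g • σ, DFunLike.coe_injective (hq.isCoveringMap.eq_of_comp_eq
      (ContinuousMap.continuous _) τ.continuous (funext fun t => ?_) a ?_)⟩
    · exact (hf.comp_eq _).trans ((hp.map_smul g).trans (congrFun hσ t))
    · exact (hsmul g _).trans hh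
  exists_smul_eq {n} σ σ' h := by
    let a : stdSimplex ℝ (Fin (n.len + 1)) := ⟨_, single_mem_stdSimplex ℝ 0⟩
    have hfσ (t) : f (σ t) = f (σ' t) := DFunLike.congr_fun h t
    have hpσ (t) : p (σ' t) = p (σ t) := by rw [← hf.comp_eq, ← hfσ, hf.comp_eq]
    obtain ⟨g, hg⟩ := hp.apply_eq_iff_mem_orbit.1 (hpσ a)
    have := hq.isCancelSMul
    refine ⟨g, IsCancelSMul.right_cancel _ _ (f (σ a)) ?_,
      DFunLike.coe_injective (hp.isCoveringMap.eq_of_comp_eq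
        σ'.continuous (ContinuousMap.continuous _) (funext fun t => ?_) a hg.symm)⟩
    · rw [← hsmul, one_smul, hfσ]
      exact congrArg f hg
    · exact (hpσ t).trans (hp.map_smul g).symm

end Covers

/-- The map lifting paths from the universal cover is equivariant along ν. At the base point,
project a path from `e₀` to `g • e₀` to a loop: monodromy in the universal cover says that the loop
represents `g`, and monodromy in the Galois cover says that its lift there ends at the translate of
`y₀` by the image of `g` under ν. -/
theorem IsUniversalCover.twistExact_iff {X : Type*} [TopologicalSpace X] {x₀ : X}
    {k : Type*} [Field k] {H : Type*} [Group H] {ν : FundamentalGroup X x₀ →* H}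
    (hν : Function.Surjective ν) {E : Type*} [TopologicalSpace E]
    [MulAction (FundamentalGroup X x₀)ᵐᵒᵖ E] [ContinuousConstSMul (FundamentalGroup X x₀)ᵐᵒᵖ E]
    {p : E → X} {e₀ : E} (hp : IsUniversalCover p x₀ e₀) {Y : Type*} [TopologicalSpace Y]
    [MulAction H Y] [ContinuousConstSMul H Y] {q : Y → X} {y₀ : Y} (hq : IsGaloisCover q x₀ y₀ ν)
    (ρ : H →* kˣ) (n : ℕ) :
    TwistExact k E (fun g : (FundamentalGroup X x₀)ᵐᵒᵖ => ρ.comp ν g.unop) n ↔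
      TwistExact k Y ρ n := by
  have := hp.simplyConnectedSpace
  have hp' := hp.isGaloisCover.isQuotientCoveringMap
  have hq' := hq.isQuotientCoveringMap
  have hpc := hp'.isCoveringMap.continuous
  have h0 : q y₀ = p e₀ := hq.map_basepoint.trans hp.isGaloisCover.map_basepoint.symm
  obtain ⟨f, hf0, hf⟩ := exists_isLiftAlong hq'.isCoveringMap hpc h0
  have hsmul (g : (FundamentalGroup X x₀)ᵐᵒᵖ) (e : E) : f (g • e) = ν g.unop • f e := by
    refine hf.map_smul hp' hq' e₀ ?_ e
    let Γ := PathConnectedSpace.somePath e₀ (g • e₀)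
    obtain ⟨z, Γ', hΓ'⟩ := exists_pathLift hq'.isCoveringMap hpc Γ (hf.comp_eq e₀)
    rw [hf.target_eq Γ Γ' hΓ']
    have hz : q z = q y₀ := by
      have := hΓ' 1
      rw [Path.target, Path.target, hp'.map_smul] at this
      rw [this, h0]
    obtain ⟨d, rfl⟩ := hq'.apply_eq_iff_mem_orbit.1 hz
    let γ : Path x₀ x₀ := (Γ.map hpc).cast hp.isGaloisCover.map_basepoint.symm
      ((hp'.map_smul g).trans hp.isGaloisCover.map_basepoint).symm
    have h1 := hp.isGaloisCover.monodromy g Γ γ fun t => rfl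
    have h2 := hq.monodromy d (Γ'.cast hf0.symm rfl) γ hΓ'
    rw [← h1, MulOpposite.unop_op, h2, hf0]
  exact (hf.simplexQuotient hp' hq' (φ := fun g => ν g.unop)
    (hν.comp MulOpposite.unop_surjective) hsmul).twistExact_iff (map_one ρ) n

/-! ### Depth one Alexander and characteristic varieties -/

theorem finite_cell_of_le_finitenessLength {X : Type*} [TopologicalSpace X]
    [Topology.CWComplex (Set.univ : Set X)] {i : ℕ} (hi : 1 ≤ i)
    (h : (i : ℕ∞) ≤ finitenessLength X) {j : ℕ} (hj : j ≤ i) :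
    Finite (Topology.CWComplex.cell (Set.univ : Set X) j) := by
  by_contra hfin
  -- If there are infinitely many `j`-cells, only indices below `j ≤ i` enter the supremum. The
  -- condition `1 ≤ i` matters because an empty supremum is `0`.
  have h1 : finitenessLength X ≤ ((i - 1 : ℕ) : ℕ∞) := by
    refine iSup₂_le fun l hl => Nat.cast_le.2 ?_
    by_contra hlt
    exact hfin (hl j (by omega))
  have h2 : i ≤ i - 1 := Nat.cast_le.1 (h.trans h1)
  omega

end JumpLoci

end

theorem mainTheorem5
    {X : Type*} [TopologicalSpace X] [T2Space X] [Topology.CWComplex (Set.univ : Set X)]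
    [ConnectedSpace X] (hX : 1 ≤ JumpLoci.finitenessLength X) (x₀ : X)
    (k : Type*) [Field k]
    {H : Type*} [CommGroup H] (ν : FundamentalGroup X x₀ →* H) (hν : Function.Surjective ν)
    -- the universal cover of `X`
    {E : Type*} [TopologicalSpace E] [MulAction (FundamentalGroup X x₀)ᵐᵒᵖ E]
    [ContinuousConstSMul (FundamentalGroup X x₀)ᵐᵒᵖ E] (p : E → X) (e₀ : E)
    (hp : JumpLoci.IsUniversalCover p x₀ e₀)
    -- the Galois cover `X^ν` of `X`
    {Xν : Type*} [TopologicalSpace Xν] [MulAction H Xν] [ContinuousConstSMul H Xν]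
    (q : Xν → X) (y₀ : Xν) (hq : JumpLoci.IsGaloisCover q x₀ y₀ ν)
    (m : ℕ∞) (hm : m ≤ JumpLoci.finitenessLength X) :
    (⋃ (i : ℕ) (_ : (i : ℕ∞) ≤ m), JumpLoci.alexanderVariety ν k Xν i 1) =
      Set.range (JumpLoci.pullback ν k) ∩
        ⋃ (i : ℕ) (_ : (i : ℕ∞) ≤ m), JumpLoci.characteristicVariety x₀ k E i 1 := by
  have hfin (i : ℕ) (hi : (i : ℕ∞) ≤ m) (j : ℕ) (hj : j ≤ i) :
      Finite (Topology.RelCWComplex.cell (Set.univ : Set X) j) := by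
    -- Finiteness of the set of vertices comes from `hX`; the bound `0 ≤ finitenessLength X` carries
    -- no information.
    rcases Nat.eq_zero_or_pos i with rfl | h
    · exact JumpLoci.finite_cell_of_le_finitenessLength le_rfl (by exact_mod_cast hX) (by omega)
    · exact JumpLoci.finite_cell_of_le_finitenessLength h (hi.trans hm) hj
  have := hq.pathConnectedSpace
  have : Group.FG H := JumpLoci.group_fg_of_finite_one_skeleton hq.isQuotientCoveringMap
    fun j hj => JumpLoci.finite_cell_of_le_finitenessLength le_rfl (by exact_mod_cast hX) hj
  have := JumpLoci.isNoetherianRing_monoidAlgebra k H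
  have key (ρ : H →* kˣ) : (∃ i : ℕ, (i : ℕ∞) ≤ m ∧ ρ ∈ JumpLoci.zeroLocus
      (JumpLoci.elementaryIdeal (MonoidAlgebra k H) (JumpLoci.EquivariantHomology k H Xν i) 0)) ↔
        ∃ i : ℕ, (i : ℕ∞) ≤ m ∧ ρ.comp ν ∈ JumpLoci.characteristicVariety x₀ k E i 1 := by
    -- The algebraic equivalence is applied up to one finite degree `i` at a time, which also covers
    -- `m = ∞`.
    have h1 (i : ℕ) (hi : (i : ℕ∞) ≤ m) :=
      JumpLoci.forall_notMem_zeroLocus_iff hq.isQuotientCoveringMap ρ (N := i) fun n hn =>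
        JumpLoci.homologyFG_univ k hq.isQuotientCoveringMap fun j hj =>
          hfin i hi j (hj.trans hn)
    have h2 (i : ℕ) : ρ.comp ν ∈ JumpLoci.characteristicVariety x₀ k E i 1 ↔
        ¬ JumpLoci.TwistExact k Xν ρ i :=
      (JumpLoci.one_le_rank_twistedHomology_iff k E _ i).trans
        (not_congr (hp.twistExact_iff hν hq ρ i))
    have hle {i n : ℕ} (hi : (i : ℕ∞) ≤ m) (hn : n ≤ i) : (n : ℕ∞) ≤ m :=
      (Nat.cast_le.2 hn).trans hi
    simp only [h2]
    constructor
    · rintro ⟨i, hi, h⟩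
      -- If the other condition failed in every degree up to `i`, the equivalence up to `i` would
      -- exclude the given one in degree `i`.
      by_contra! hc
      exact (h1 i hi).2 (fun n hn => hc n (hle hi hn)) i le_rfl h
    · rintro ⟨i, hi, h⟩
      by_contra! hc
      exact h ((h1 i hi).1 (fun n hn => hc n (hle hi hn)) i le_rfl)
  ext ρ
  simp only [Set.mem_iUnion, exists_prop, Set.mem_inter_iff]
  constructor
  · rintro ⟨i, hi, ρ, hρ, rfl⟩
    exact ⟨⟨ρ, rfl⟩, (key ρ).1 ⟨i, hi, hρ⟩⟩
  · rintro ⟨⟨ρ, rfl⟩, h⟩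
    obtain ⟨i, hi, hρ⟩ := (key ρ).2 h
    exact ⟨i, hi, ρ, hρ, rfl⟩
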